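/- Let $\mathcal S(\mathbb R^3)$ be the Schwartz space, and for $\varphi\in\mathcal S(\mathbb R^3)$ let $(-\Delta)^{1/2}\varphi$ be the function with Fourier transform $|\xi|\hat\varphi(\xi)$, where $\hat\varphi(\xi)=(2\pi)^{-3/2}\int_{\mathbb R^3}\varphi(x)e^{-ix\cdot\xi}\,dx$. Let $L_{1/2}(\mathbb R^3)$ be the set of $g\in L^1_{loc}(\mathbb R^3)$ with $\int_{\mathbb R^3}\frac{|g(x)|}{1+|x|^4}\,dx<\infty$. **Theorem.** Let $u\in C^\infty(\mathbb R^3)$ be real-valued with $$V:=\int_{\mathbb R^3}e^{3u}\,dx<\infty,$$ and let $u$ solve $(-\Delta)^{3/2}u=2e^{3u}$ in $\mathbb R^3$ in the sense that $\Delta u\in L_{1/2}(\mathbb R^3)$ and $$\int_{\mathbb R^3}(-\Delta u)\,(-\Delta)^{1/2}\varphi\,dx=\int_{\mathbb R^3}2e^{3u}\varphi\,dx\qquad\text{for every }\varphi\in\mathcal S(\mathbb R^3).$$ Suppose that $u$ is not spherical, i.e. there are no $x_0\in\mathbb R^3$ and $\lambda>0$ with $u(x)=\log\frac{2\lambda}{1+\lambda^2|x-x_0|^2}$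 for all $x\in\mathbb R^3$. Then $V<2\pi^2$. -/

import Mathlib

open MeasureTheory
open scoped FourierTransform SchwartzMap ContDiff Laplacian

/-- Euclidean three-space. -/
abbrev R3 : Type := EuclideanSpace ℝ (Fin 3)

/-- The space `L_{1/2}(ℝ³)`: locally integrable functions `g` with
`∫ |g(x)| / (1 + |x|⁴) dx < ∞`. -/
def MemLHalf (g : R3 → ℝ) : Prop :=
  LocallyIntegrable g volume ∧ Integrable (fun x : R3 => g x / (1 + ‖x‖ ^ 4)) volume

/-- The operator `(-Δ)^{1/2}` on Schwartz functions, as the Fourier multiplier with symbol `|ξ|`.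
Mathlib's Fourier transform has kernel `exp (-2πi ⟨x, ξ⟩)`, so that the symbol reads `2π|ξ|`. -/
noncomputable def halfLaplacian (φ : 𝓢(R3, ℂ)) : R3 → ℂ :=
  𝓕⁻ (fun ξ : R3 => ((2 * Real.pi * ‖ξ‖ : ℝ) : ℂ) * 𝓕 (φ : R3 → ℂ) ξ)

/-- `u` is a smooth solution of `(-Δ)^{3/2} u = f` in `ℝ³`, where `(-Δ)^{3/2}` is understood as
`(-Δ)^{1/2} ∘ (-Δ)`: `u` is smooth, `Δu ∈ L_{1/2}(ℝ³)`, and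
`∫ (-Δu) (-Δ)^{1/2}φ dx = ∫ f φ dx` for all Schwartz functions `φ`. (A smooth function lies in
`W^{2,1}_loc`, and its weak Laplacian is the classical one. The function `f` is meant to define a
tempered distribution, for instance by being integrable.) -/
structure IsSmoothSolution (u f : R3 → ℝ) : Prop where
  contDiff : ContDiff ℝ ∞ u
  memLHalf_laplacian : MemLHalf (Δ u)
  weak_eq : ∀ φ : 𝓢(R3, ℂ),
    ∫ x : R3, ((-(Δ u) x : ℝ) : ℂ) * halfLaplacian φ x = ∫ x : R3, (f x : ℂ) * φ x

/-- The spherical function `w_{x₀,λ}(x) = log (2λ / (1 + λ²|x - x₀|²))`. -/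
noncomputable def sphericalFun (x₀ : R3) (l : ℝ) (x : R3) : ℝ :=
  Real.log (2 * l / (1 + l ^ 2 * ‖x - x₀‖ ^ 2))

/-- `u` is spherical: `u = w_{x₀,λ}` for some `x₀ ∈ ℝ³` and `λ > 0`. -/
def IsSpherical (u : R3 → ℝ) : Prop :=
  ∃ (x₀ : R3) (l : ℝ), 0 < l ∧ u = sphericalFun x₀ l

open Filter Topology Set

/-! Write `m = e^{3u}` and `V = ∫ m`. The plan is to represent `u` as a logarithmic potential plus a
quadratic polynomial, to read `V ≤ 2π²` off a Pohozaev identity, and to show that equality forces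
`u` to be spherical.

Representation. The kernel of `(-Δ)^{-1/2}` is `|x|⁻² / (2π²)`, so `-Δu` and `π⁻² ∫ |x-y|⁻² m(y) dy`
have the same pairing with every test function whose Fourier transform is compactly supported away
from the origin. Their difference lies in `L_{1/2}`, hence is constant (`neg_laplacian_eq_riesz`).
Since `Δ log|x| = |x|⁻²` in dimension three, `u - v` has constant Laplacian, where `v(x) = π⁻² ∫
log((1+|y|)/|x-y|) m(y) dy`. The pointwise bound `u ≤ e^{3u}` and the lower bound `v ≥ -π⁻² V
log(1+|x|)` give quadratic growth from above in the mean, and a Liouville argument yields `u = v +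
p` with `p` quadratic (`exists_eq_logPotential_add_quadratic`). Because `e^{3p}` is at most a power
of `1+|x|` times `m`, the Hessian `H` of `p` is nonpositive and `p` has a centre `x₀`
(`exists_center_of_integrable`).

Pohozaev. Testing with truncations of the field `x - x₀` and symmetrising the kernel gives in the
limit `V (1 - V/(2π²)) = lim -∫ ⟨H(x-x₀), η_R (x-x₀)⟩ m ≥ 0`. Hence `V ≤ 2π²`, and equality makes
the quadratic form of `H` vanish (`pohozaev`).

Equality. Now `u = v + const`. Splitting off the small mass of `m` far away and applying Jensen's
inequality gives enough integrability for `u(x) + 2 log|x|` to converge at infinity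
(`exists_logSolution`). The method of moving spheres, run on the integral equation, shows that about
every centre `u` coincides with one of its Kelvin transforms (`LogSolution.exists_kelvin_eq`).
Comparing the expansions at infinity for different centres determines the gradient of `e^{-u}`, so
`e^{-u}` is a quadratic polynomial, and the value of `V` fixes its last parameter
(`LogSolution.isSpherical`). A solution that is not spherical therefore has `V < 2π²`. -/

/-! ### Convolution with weakly singular kernels -/

/-- A kernel on `ℝ³` which is the sum of an integrable function supported in the unit ball and of a
bounded continuous function. -/
def SingKernel (k : R3 → ℝ) : Prop :=
  ∃ k₁ k₂ : R3 → ℝ, k = k₁ + k₂ ∧ Integrable k₁ ∧ (∀ z, 1 ≤ ‖z‖ → k₁ z = 0) ∧ Continuous k₂ ∧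
    ∃ B, ∀ z, |k₂ z| ≤ B

namespace SingKernel

variable {k : R3 → ℝ}

theorem aestronglyMeasurable (hk : SingKernel k) : AEStronglyMeasurable k volume := by
  obtain ⟨k₁, k₂, rfl, h1, -, h2, -⟩ := hk
  exact h1.1.add h2.aestronglyMeasurable

theorem integrable_mul_sub (hk : SingKernel k) {f : R3 → ℝ} (hf : Continuous f)
    (hfi : Integrable f) (x : R3) : Integrable (fun y => k (x - y) * f y) := by
  obtain ⟨k₁, k₂, rfl, h1, h1s, h2, B, hB⟩ := hk
  simp only [Pi.add_apply, add_mul]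
  refine Integrable.add ?_ ?_
  · obtain ⟨M, hM⟩ := (isCompact_closedBall x 1).exists_bound_of_continuousOn hf.continuousOn
    refine Integrable.mono' (((h1.comp_sub_left x).norm).mul_const M)
      ((h1.comp_sub_left x).1.mul hf.aestronglyMeasurable) (ae_of_all _ fun y => ?_)
    rw [norm_mul]
    by_cases hy : 1 ≤ ‖x - y‖
    · simp [h1s _ hy]
    · refine mul_le_mul_of_nonneg_left (hM y ?_) (norm_nonneg _)
      rw [Metric.mem_closedBall, dist_comm, dist_eq_norm]; linarith
  · exact hfi.bdd_mul (c := B) (by fun_prop) (ae_of_all _ fun y => hB _)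

/-- The density need not be bounded. The singular part is therefore written as `∫ k₁(z) f(x-z) dz`,
which only involves `f` on a compact set when `x` stays near a point; the bounded part is dominated
by a multiple of `|f|`. -/
theorem continuous_integral (hk : SingKernel k) {f : R3 → ℝ} (hf : Continuous f)
    (hfi : Integrable f) : Continuous (fun x => ∫ y, k (x - y) * f y) := by
  obtain ⟨k₁, k₂, rfl, h1, h1s, h2, B, hB⟩ := hk
  have hk1 : SingKernel k₁ := ⟨k₁, 0, by simp, h1, h1s, continuous_const, 0, by simp⟩
  have hk2 : SingKernel k₂ := ⟨0, k₂, by simp, integrable_zero _ _ _, by simp, h2, B, hB⟩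
  have heq : (fun x => ∫ y, (k₁ + k₂) (x - y) * f y)
      = fun x => (∫ z, k₁ z * f (x - z)) + ∫ y, k₂ (x - y) * f y := by
    ext x
    simp only [Pi.add_apply, add_mul]
    rw [integral_add (hk1.integrable_mul_sub hf hfi x) (hk2.integrable_mul_sub hf hfi x)]
    congr 1
    rw [← integral_sub_left_eq_self _ _ x]
    simp
  rw [heq]
  refine Continuous.add ?_ ?_
  · rw [continuous_iff_continuousAt]
    intro x₀
    obtain ⟨M, hM⟩ := (isCompact_closedBall x₀ 2).exists_bound_of_continuousOn hf.continuousOn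
    refine continuousAt_of_dominated (bound := fun z => ‖k₁ z‖ * M) ?_ ?_ (h1.norm.mul_const M) ?_
    · exact Eventually.of_forall fun x => h1.1.mul (by fun_prop)
    · filter_upwards [Metric.ball_mem_nhds x₀ one_pos] with x hx
      refine ae_of_all _ fun z => ?_
      rw [norm_mul]
      by_cases hz : 1 ≤ ‖z‖
      · simp [h1s _ hz]
      · refine mul_le_mul_of_nonneg_left (hM _ ?_) (norm_nonneg _)
        rw [Metric.mem_closedBall, dist_eq_norm]
        rw [Metric.mem_ball, dist_eq_norm] at hx
        calc ‖x - z - x₀‖ = ‖(x - x₀) - z‖ := by congr 1; abel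
          _ ≤ ‖x - x₀‖ + ‖z‖ := norm_sub_le _ _
          _ ≤ 2 := by linarith
    · exact ae_of_all _ fun z => by fun_prop
  · refine continuous_of_dominated (bound := fun y => B * ‖f y‖) ?_ ?_ (hfi.norm.const_mul B) ?_
    · intro x; exact AEStronglyMeasurable.mul (by fun_prop) (by fun_prop)
    · intro x
      refine ae_of_all _ fun y => ?_
      rw [norm_mul]
      exact mul_le_mul_of_nonneg_right (hB _) (norm_nonneg _)
    · exact ae_of_all _ fun y => by fun_prop

/-- This justifies Fubini for potentials: the singular part is an integrand of an `L¹` convolution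
times a bounded function, and the rest is a bounded function times a tensor product. -/
theorem integrable_prod {E : Type*} [NormedAddCommGroup E] [NormedSpace ℝ E] (hk : SingKernel k)
    {w : R3 → E} (hw : Integrable w) {W : ℝ} (hW : ∀ x, ‖w x‖ ≤ W) {f : R3 → ℝ}
    (hf : Integrable f) :
    Integrable (fun p : R3 × R3 => (k (p.1 - p.2) * f p.2) • w p.1) (volume.prod volume) := by
  obtain ⟨k₁, k₂, rfl, h1, h1s, h2, B, hB⟩ := hk
  simp only [Pi.add_apply, add_mul, add_smul]
  refine Integrable.add ?_ ?_
  · have h := hf.convolution_integrand (ContinuousLinearMap.mul ℝ ℝ) h1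
    refine (h.norm.mul_const W).mono' ?_ (ae_of_all _ fun p => ?_)
    · refine AEStronglyMeasurable.smul ?_ hw.1.comp_fst
      exact h.1.congr (ae_of_all _ fun p => by simp [mul_comm])
    · rw [norm_smul]
      simp only [ContinuousLinearMap.mul_apply']
      rw [mul_comm (k₁ _)]
      exact mul_le_mul_of_nonneg_left (hW _) (norm_nonneg _)
  · have h : Integrable (fun p : R3 × R3 => f p.2 • w p.1) (volume.prod volume) :=
      (hf.smul_prod hw).swap
    refine (h.norm.const_mul B).mono' ?_ (ae_of_all _ fun p => ?_)
    · refine AEStronglyMeasurable.smul (AEStronglyMeasurable.mul ?_ hf.1.comp_snd) hw.1.comp_fst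
      exact (by fun_prop : Continuous fun p : R3 × R3 => k₂ (p.1 - p.2)).aestronglyMeasurable
    · rw [mul_smul, norm_smul]
      exact mul_le_mul_of_nonneg_right (hB _) (norm_nonneg _)

theorem integral_integral_swap_smul {E : Type*} [NormedAddCommGroup E] [NormedSpace ℝ E]
    [CompleteSpace E] (hk : SingKernel k) {w : R3 → E} (hw : Integrable w) {W : ℝ} (hW : ∀ x, ‖w x‖ ≤ W)
    {f : R3 → ℝ} (hf : Integrable f) :
    ∫ x, (∫ y, k (x - y) * f y) • w x = ∫ y, f y • ∫ x, k (x - y) • w x := by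
  have : ∀ x, (∫ y, k (x - y) * f y) • w x = ∫ y, (k (x - y) * f y) • w x := fun x =>
    (integral_smul_const _ _).symm
  simp_rw [this, ← integral_smul]
  rw [integral_integral_swap (hk.integrable_prod hw hW hf)]
  simp_rw [smul_smul, mul_comm]

/-- Polar coordinates in dimension three: `r² φ(r)` only has to extend continuously to the origin.
The split is `φ(|z|) = (φ(|z|) - φ(max |z| 1)) + φ(max |z| 1)`. -/
theorem of_radial {φ ψ : ℝ → ℝ} (hφ : ContinuousOn φ (Ici 1)) {B : ℝ}
    (hB : ∀ r, 1 ≤ r → |φ r| ≤ B) (hψ : Continuous ψ)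
    (h : ∀ r, 0 < r → r < 1 → r ^ 2 * φ r = ψ r) : SingKernel (fun z => φ ‖z‖) := by
  refine ⟨fun z => φ ‖z‖ - φ (max ‖z‖ 1), fun z => φ (max ‖z‖ 1), ?_, ?_, ?_, ?_, B, ?_⟩
  · ext z; simp
  · have h1 : IntegrableOn (fun z : R3 => φ ‖z‖ - φ 1) (Metric.ball 0 1) := by
      rw [integrableOn_fun_norm_addHaar volume (f := fun r => φ r - φ 1)]
      have : IntegrableOn (fun r => ψ r - r ^ 2 * φ 1) (Ioo 0 1) :=
        ((by fun_prop : Continuous (fun r => ψ r - r ^ 2 * φ 1)).integrableOn_Icc).mono_set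
          Ioo_subset_Icc_self
      refine this.congr_fun (fun r hr => ?_) measurableSet_Ioo
      simp [← h r hr.1 hr.2, mul_sub]
    refine (integrable_indicator_iff Metric.isOpen_ball.measurableSet |>.2 h1).congr
      (ae_of_all _ fun z => ?_)
    by_cases hz : ‖z‖ < 1
    · simp [indicator, hz, max_eq_right hz.le]
    · simp [indicator, hz, max_eq_left (not_lt.1 hz)]
  · intro z hz; simp [max_eq_left hz]
  · exact hφ.comp_continuous (by fun_prop) fun z => mem_Ici.2 (le_max_right _ _)
  · intro z; exact hB _ (le_max_right _ _)

theorem inv_norm : SingKernel (fun z => ‖z‖⁻¹) := by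
  refine of_radial (φ := fun r => r⁻¹) (ψ := fun r => r) (B := 1) ?_ ?_ continuous_id ?_
  · exact continuousOn_inv₀.mono fun r (hr : 1 ≤ r) => (by simp; positivity)
  · intro r hr; rw [abs_of_nonneg (by positivity)]; exact inv_le_one_of_one_le₀ hr
  · intro r hr _; field_simp

theorem inv_norm_sq : SingKernel (fun z => (‖z‖ ^ 2)⁻¹) := by
  refine of_radial (φ := fun r => (r ^ 2)⁻¹) (ψ := fun r => 1) (B := 1) ?_ ?_ continuous_const ?_
  · exact ContinuousOn.inv₀ (by fun_prop) fun r (hr : 1 ≤ r) => by positivity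
  · intro r hr; rw [abs_of_nonneg (by positivity)]; exact inv_le_one_of_one_le₀ (one_le_pow₀ hr)
  · intro r hr _; field_simp

theorem min_log : SingKernel (fun z => min (Real.log ‖z‖) 0) := by
  refine of_radial (φ := fun r => min (Real.log r) 0) (ψ := fun r => r * (r * Real.log r)) (B := 0)
    ?_ ?_ (continuous_id.mul Real.continuous_mul_log) ?_
  · refine continuousOn_const.congr fun r hr => min_eq_right (Real.log_nonneg hr)
  · intro r hr; simp [min_eq_right (Real.log_nonneg hr)]
  · intro r hr h1; simp only [min_eq_left (Real.log_nonpos hr.le h1.le)]; ring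

theorem min_log_sq : SingKernel (fun z => (min (Real.log ‖z‖) 0) ^ 2) := by
  refine of_radial (φ := fun r => (min (Real.log r) 0) ^ 2) (ψ := fun r => (r * Real.log r) ^ 2)
    (B := 0) ?_ ?_ (Real.continuous_mul_log.pow 2) ?_
  · refine (continuousOn_const (c := (0 : ℝ) ^ 2)).congr fun r hr => ?_
    exact congrArg (· ^ 2) (min_eq_right (Real.log_nonneg hr))
  · intro r hr; simp [min_eq_right (Real.log_nonneg hr)]
  · intro r hr h1; simp only [min_eq_left (Real.log_nonpos hr.le h1.le)]; ring

end SingKernel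

/-! ### The Riesz kernel as a Fourier multiplier -/

/-- The substitution `r = s^{-1/2}` turns this into a Gaussian integral on the half-line. -/
theorem integral_rpow_mul_exp_neg_div (a : ℝ) :
    ∫ s in Ioi (0 : ℝ), s ^ (-(3 : ℝ) / 2) * Real.exp (-a / s) = √(Real.pi / a) := by
  have h := integral_comp_rpow_Ioi (fun r : ℝ => Real.exp (-a * r ^ 2)) (p := -(1 / 2)) (by norm_num)
  rw [integral_gaussian_Ioi] at h
  have h2 : ∫ s in Ioi (0 : ℝ), s ^ (-(3 : ℝ) / 2) * Real.exp (-a / s)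
      = 2 * ∫ x in Ioi (0 : ℝ), (|-(1 / 2 : ℝ)| * x ^ (-(1 / 2 : ℝ) - 1)) •
        (fun r : ℝ => Real.exp (-a * r ^ 2)) (x ^ (-(1 / 2 : ℝ))) := by
    rw [← integral_const_mul]
    refine setIntegral_congr_fun measurableSet_Ioi fun s (hs : 0 < s) => ?_
    have h3 : (s ^ (-(1 / 2 : ℝ))) ^ 2 = s⁻¹ := by
      rw [← Real.rpow_natCast, ← Real.rpow_mul hs.le, ← Real.rpow_neg_one]; norm_num
    have h4 : |-(1 / 2 : ℝ)| = 1 / 2 := by norm_num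
    have h5 : -(1 / 2 : ℝ) - 1 = -3 / 2 := by norm_num
    simp only [smul_eq_mul]
    rw [h3, h4, h5, ← div_eq_mul_inv]
    ring
  rw [h2, h]; ring

/-- The integral has a nonzero value, whereas a non-integrable function has integral zero by
convention. -/
theorem integrableOn_rpow_mul_exp_neg_div {a : ℝ} (ha : 0 < a) :
    IntegrableOn (fun s : ℝ => s ^ (-(3 : ℝ) / 2) * Real.exp (-a / s)) (Ioi 0) := by
  by_contra h
  have h1 := integral_undef (f := fun s : ℝ => s ^ (-(3 : ℝ) / 2) * Real.exp (-a / s)) h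
  rw [integral_rpow_mul_exp_neg_div a] at h1
  have : 0 < √(Real.pi / a) := Real.sqrt_pos.2 (by positivity)
  linarith

theorem integrable_gaussian_mul_char (b : ℝ) (hb : 0 < b) (y : R3) :
    Integrable (fun v : R3 => Complex.exp (-(b : ℂ) * ‖v‖ ^ 2 +
      2 * Real.pi * Complex.I * inner ℝ y v)) := by
  have := GaussianFourier.integrable_cexp_neg_mul_sq_norm_add (V := R3) (b := (b : ℂ))
    (by simpa using hb) (2 * Real.pi * Complex.I) y
  exact this

/-- The Fourier transform of a Gaussian integrated against a Schwartz function. -/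
theorem integral_fourierInv_mul_gaussian (Θ : 𝓢(R3, ℂ)) (y : R3) {s : ℝ} (hs : 0 < s) :
    ∫ x : R3, 𝓕⁻ (Θ : R3 → ℂ) x * (Real.exp (-Real.pi * s * ‖x - y‖ ^ 2) : ℝ) =
      ∫ ξ : R3, Θ ξ * Complex.exp (2 * Real.pi * Complex.I * inner ℝ y ξ) *
        (s ^ (-(3 : ℝ) / 2) * Real.exp (-(Real.pi * ‖ξ‖ ^ 2) / s) : ℝ) := by
  -- With this width the Fourier transform of the modulated Gaussian `G` is `s^{3/2}` times the
  -- Gaussian on the left, and the claim is the self-adjointness of the Fourier transform.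
  set b : ℝ := Real.pi / s with hb
  have hb0 : 0 < b := by positivity
  set G : R3 → ℂ := fun v => Complex.exp (-(b : ℂ) * ‖v‖ ^ 2 +
      2 * Real.pi * Complex.I * inner ℝ y v) with hG
  have hGi : Integrable G := integrable_gaussian_mul_char b hb0 y
  have h1 : ∀ w, 𝓕 G w = ((s ^ ((3 : ℝ) / 2) : ℝ) : ℂ) *
      (Real.exp (-Real.pi * s * ‖w - y‖ ^ 2) : ℝ) := by
    intro w
    rw [hG, fourier_gaussian_innerProductSpace' (by simpa using hb0)]
    congr 1
    · have : (Real.pi : ℂ) / (b : ℂ) = (s : ℂ) := by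
        rw [hb]; push_cast; field_simp [Real.pi_ne_zero]
      rw [this, Complex.ofReal_cpow hs.le]
      simp
    · rw [Complex.ofReal_exp, norm_sub_rev w y]
      congr 1
      rw [hb]; push_cast
      field_simp
  have h2 := VectorFourier.integral_fourierIntegral_smul_eq_flip (L := innerₗ R3)
    Real.continuous_fourierChar continuous_inner (𝓕⁻ Θ).integrable hGi (μ := volume) (ν := volume)
  have h3 : ∫ ξ : R3, Θ ξ * G ξ = ∫ x, 𝓕⁻ (Θ : R3 → ℂ) x * 𝓕 G x := by
    have e1 : ∀ ξ, VectorFourier.fourierIntegral Real.fourierChar volume (innerₗ R3)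
      (𝓕⁻ Θ : 𝓢(R3, ℂ)) ξ = Θ ξ := by
      intro ξ
      have : (𝓕 (𝓕⁻ Θ : 𝓢(R3, ℂ)) : 𝓢(R3, ℂ)) ξ = Θ ξ := by simp
      rw [← this, SchwartzMap.fourier_coe]; rfl
    have e2 : ∀ x, VectorFourier.fourierIntegral Real.fourierChar volume (innerₗ R3).flip
      G x = 𝓕 G x := by
      intro x; simp [Real.fourier_eq, VectorFourier.fourierIntegral, real_inner_comm]
    simp only [smul_eq_mul, e1, e2] at h2
    rw [h2, ← SchwartzMap.fourierInv_coe]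
  have hs3 : ((s ^ ((3 : ℝ) / 2) : ℝ) : ℂ) ≠ 0 := by
    exact_mod_cast (Real.rpow_pos_of_pos hs _).ne'
  rw [← mul_right_inj' hs3, ← integral_const_mul, ← integral_const_mul]
  simp only [h1] at h3
  calc _ = ∫ x, 𝓕⁻ (Θ : R3 → ℂ) x * (((s ^ ((3 : ℝ) / 2) : ℝ) : ℂ) *
      (Real.exp (-Real.pi * s * ‖x - y‖ ^ 2) : ℝ)) := by congr 1; ext x; ring
    _ = _ := by
      rw [← h3]
      congr 1; ext ξ
      have h5 : ((s ^ ((3 : ℝ) / 2) : ℝ) : ℂ) * (s ^ (-(3 : ℝ) / 2) : ℝ) = 1 := by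
        rw [← Complex.ofReal_mul, ← Real.rpow_add hs]; norm_num
      rw [Complex.ofReal_mul, hG]
      simp only [Complex.exp_add]
      have h6 : ((Real.exp (-(Real.pi * ‖ξ‖ ^ 2) / s) : ℝ) : ℂ) =
          Complex.exp (-(b : ℂ) * ‖ξ‖ ^ 2) := by
        rw [Complex.ofReal_exp, hb]; congr 1; push_cast; ring
      rw [h6]
      linear_combination (-Θ ξ * Complex.exp (-(b : ℂ) * ‖ξ‖ ^ 2) *
        Complex.exp (2 * Real.pi * Complex.I * inner ℝ y ξ)) * h5

theorem SchwartzMap.exists_norm_le {E F : Type*} [NormedAddCommGroup E] [NormedSpace ℝ E]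
    [NormedAddCommGroup F] [NormedSpace ℝ F] (f : 𝓢(E, F)) : ∃ C, ∀ x, ‖f x‖ ≤ C := by
  obtain ⟨C, -, hC⟩ := f.decay 0 0
  exact ⟨C, fun x => by simpa using hC x⟩

theorem SingKernel.integrable_mul_schwartz {k : R3 → ℝ} (hk : SingKernel k) (y : R3)
    (f : 𝓢(R3, ℂ)) : Integrable (fun x => (k (y - x) : ℂ) * f x) := by
  refine (hk.integrable_mul_sub f.continuous.norm f.integrable.norm y).norm.mono' ?_
    (ae_of_all _ fun x => by simp)
  have : AEStronglyMeasurable (fun x => k (y - x)) volume :=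
    hk.aestronglyMeasurable.comp_quasiMeasurePreserving (quasiMeasurePreserving_sub_left _ y)
  exact (Complex.continuous_ofReal.comp_aestronglyMeasurable this).mul
    f.continuous.aestronglyMeasurable

/-- In `ℝ³` the Riesz potential `|x|⁻²` is the convolution kernel of `2π² (-Δ)^{-1/2}`. -/
theorem integral_inv_norm_sq_mul_fourierInv (Θ : 𝓢(R3, ℂ)) (y : R3) :
    ∫ x : R3, (((‖y - x‖ ^ 2)⁻¹ : ℝ) : ℂ) * 𝓕⁻ (Θ : R3 → ℂ) x =
      2 * Real.pi ^ 2 * 𝓕⁻ (fun ξ => Θ ξ / (2 * Real.pi * ‖ξ‖ : ℝ)) y := by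
  -- Subordination: both kernels are superpositions of Gaussians, `|x|⁻² = π ∫₀^∞ e^{-πs|x|²} ds`
  -- and `|ξ|⁻¹ = ∫₀^∞ s^{-3/2} e^{-π|ξ|²/s} ds`, and for each `s` the two Gaussians correspond
  -- under the Fourier transform.
  have hπ := Real.pi_pos
  have hne : ∀ y : R3, ∀ᵐ x : R3, x ≠ y := fun y => by
    simp [ae_iff]
  -- left side
  have L : ∫ x : R3, (((‖y - x‖ ^ 2)⁻¹ : ℝ) : ℂ) * 𝓕⁻ (Θ : R3 → ℂ) x =
      ∫ s in Ioi (0 : ℝ), ∫ x : R3, (Real.pi : ℂ) * (𝓕⁻ (Θ : R3 → ℂ) x *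
        (Real.exp (-Real.pi * s * ‖x - y‖ ^ 2) : ℝ)) := by
    have key : ∀ x : R3, x ≠ y → IntegrableOn (fun s : ℝ => Real.exp (-Real.pi * s * ‖x - y‖ ^ 2))
        (Ioi 0) ∧ ∫ s in Ioi (0 : ℝ), Real.exp (-Real.pi * s * ‖x - y‖ ^ 2) =
          Real.pi⁻¹ * (‖y - x‖ ^ 2)⁻¹ := by
      intro x hx
      have h0 : 0 < ‖x - y‖ := norm_pos_iff.2 (sub_ne_zero.2 hx)
      have h1 : -(Real.pi * ‖x - y‖ ^ 2) < 0 := by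
        have : 0 < Real.pi * ‖x - y‖ ^ 2 := by positivity
        linarith
      have e : (fun s : ℝ => Real.exp (-Real.pi * s * ‖x - y‖ ^ 2)) =
          fun s => Real.exp (-(Real.pi * ‖x - y‖ ^ 2) * s) := by
        ext s; congr 1; ring
      rw [e]
      refine ⟨integrableOn_exp_mul_Ioi h1 0, ?_⟩
      rw [integral_exp_mul_Ioi h1 0, norm_sub_rev y x]
      simp; field_simp
    have hint : Integrable (fun p : R3 × ℝ => (Real.pi : ℂ) * (𝓕⁻ (Θ : R3 → ℂ) p.1 *
        (Real.exp (-Real.pi * p.2 * ‖p.1 - y‖ ^ 2) : ℝ)))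
        (volume.prod (volume.restrict (Ioi 0))) := by
      have hc : Continuous (𝓕⁻ (Θ : R3 → ℂ)) := by
        rw [← SchwartzMap.fourierInv_coe]; exact (𝓕⁻ Θ).continuous
      rw [integrable_prod_iff]
      · constructor
        · filter_upwards [hne y] with x hx
          exact (((key x hx).1.ofReal).const_mul _).const_mul _
        · refine (SingKernel.inv_norm_sq.integrable_mul_schwartz y (𝓕⁻ Θ)).norm.congr ?_
          filter_upwards [hne y] with x hx
          simp only [norm_mul, Complex.norm_real, Real.norm_eq_abs, Real.abs_exp]
          rw [integral_const_mul, integral_const_mul, (key x hx).2, abs_of_pos hπ,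
            abs_of_nonneg (by positivity), SchwartzMap.fourierInv_coe]
          field_simp
      · refine Continuous.aestronglyMeasurable ?_
        fun_prop
    rw [← integral_integral_swap hint]
    refine integral_congr_ae ?_
    filter_upwards [hne y] with x hx
    rw [integral_const_mul, integral_const_mul, integral_complex_ofReal, (key x hx).2]
    push_cast
    field_simp
  have R : ∫ s in Ioi (0 : ℝ), ∫ ξ : R3, (Real.pi : ℂ) * (Θ ξ *
        Complex.exp (2 * Real.pi * Complex.I * inner ℝ y ξ) *
        (s ^ (-(3 : ℝ) / 2) * Real.exp (-(Real.pi * ‖ξ‖ ^ 2) / s) : ℝ)) =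
      2 * Real.pi ^ 2 * 𝓕⁻ (fun ξ => Θ ξ / (2 * Real.pi * ‖ξ‖ : ℝ)) y := by
    have hexp : ∀ ξ : R3, ‖Complex.exp (2 * Real.pi * Complex.I * inner ℝ y ξ)‖ = 1 := by
      intro ξ
      rw [show (2 * Real.pi * Complex.I * inner ℝ y ξ : ℂ) =
        ((2 * Real.pi * inner ℝ y ξ : ℝ) : ℂ) * Complex.I by push_cast; ring]
      exact Complex.norm_exp_ofReal_mul_I _
    have key : ∀ ξ : R3, ξ ≠ 0 → ∫ s in Ioi (0 : ℝ),
        s ^ (-(3 : ℝ) / 2) * Real.exp (-(Real.pi * ‖ξ‖ ^ 2) / s) = ‖ξ‖⁻¹ := by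
      intro ξ hξ
      have h0 : 0 < ‖ξ‖ := norm_pos_iff.2 hξ
      rw [integral_rpow_mul_exp_neg_div]
      rw [show Real.pi / (Real.pi * ‖ξ‖ ^ 2) = (‖ξ‖⁻¹) ^ 2 by field_simp,
        Real.sqrt_sq (by positivity)]
    have hint : Integrable (fun p : R3 × ℝ => (Real.pi : ℂ) * (Θ p.1 *
        Complex.exp (2 * Real.pi * Complex.I * inner ℝ y p.1) *
        (p.2 ^ (-(3 : ℝ) / 2) * Real.exp (-(Real.pi * ‖p.1‖ ^ 2) / p.2) : ℝ)))
        (volume.prod (volume.restrict (Ioi 0))) := by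
      rw [integrable_prod_iff]
      · constructor
        · filter_upwards [hne 0] with ξ hξ
          have h0 : 0 < ‖ξ‖ := norm_pos_iff.2 hξ
          have := (integrableOn_rpow_mul_exp_neg_div (a := Real.pi * ‖ξ‖ ^ 2) (by positivity))
          exact ((this.ofReal (𝕜 := ℂ)).const_mul _).const_mul _
        · refine ((SingKernel.inv_norm.integrable_mul_schwartz 0 Θ).norm.const_mul Real.pi).congr ?_
          filter_upwards [hne 0] with ξ hξ
          simp only [norm_mul, Complex.norm_real, Real.norm_eq_abs, hexp]
          rw [integral_const_mul, integral_const_mul]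
          have : ∫ s in Ioi (0 : ℝ), |s ^ (-(3 : ℝ) / 2) * Real.exp (-(Real.pi * ‖ξ‖ ^ 2) / s)|
              = ‖ξ‖⁻¹ := by
            rw [← key ξ hξ]
            refine setIntegral_congr_fun measurableSet_Ioi fun s (hs : 0 < s) => ?_
            exact abs_of_nonneg (by positivity)
          simp only [abs_mul] at this
          simp only [this, abs_of_pos hπ]
          simp
          ring
      · refine AEStronglyMeasurable.const_mul (AEStronglyMeasurable.mul ?_ ?_) _
        · refine Continuous.aestronglyMeasurable ?_
          have := Θ.continuous
          fun_prop
        · refine (Measurable.aestronglyMeasurable ?_)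
          fun_prop
    rw [← integral_integral_swap hint, Real.fourierInv_eq', ← integral_const_mul]
    refine integral_congr_ae ?_
    filter_upwards [hne 0] with ξ hξ
    have h0 : (‖ξ‖ : ℂ) ≠ 0 := by exact_mod_cast (norm_pos_iff.2 hξ).ne'
    rw [integral_const_mul, integral_const_mul, integral_complex_ofReal, key ξ hξ,
      real_inner_comm]
    have : Complex.exp (2 * Real.pi * Complex.I * (inner ℝ ξ y : ℝ)) =
        Complex.exp (((2 * Real.pi * inner ℝ ξ y : ℝ) : ℂ) * Complex.I) := by
      congr 1; push_cast; ring
    rw [this]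
    push_cast
    field_simp
    rw [smul_eq_mul]
    field_simp
  rw [L, ← R]
  refine setIntegral_congr_fun measurableSet_Ioi fun s hs => ?_
  rw [integral_const_mul, integral_const_mul, integral_fourierInv_mul_gaussian Θ y hs]

/-! ### A Liouville theorem in `L_{1/2}` -/

theorem SchwartzMap.exists_one_add_norm_pow_mul_le {E F : Type*} [NormedAddCommGroup E]
    [NormedSpace ℝ E] [NormedAddCommGroup F] [NormedSpace ℝ F] (f : 𝓢(E, F)) (k n : ℕ) :
    ∃ C, 0 ≤ C ∧ ∀ x, (1 + ‖x‖) ^ k * ‖iteratedFDeriv ℝ n f x‖ ≤ C := by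
  refine ⟨_, ?_, fun x => SchwartzMap.one_add_le_sup_seminorm_apply (𝕜 := ℝ) (m := (k, n)) le_rfl
    le_rfl f x⟩
  positivity

theorem MemLHalf.integrable_mul_schwartz {h : R3 → ℝ} (hh : Continuous h)
    (hi : Integrable (fun x => h x / (1 + ‖x‖ ^ 4))) (S : 𝓢(R3, ℂ)) :
    Integrable (fun x => (h x : ℂ) * S x) := by
  obtain ⟨C, -, hC⟩ := S.exists_one_add_norm_pow_mul_le 4 0
  refine (hi.norm.mul_const C).mono' ?_ (ae_of_all _ fun x => ?_)
  · have := S.continuous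
    exact Continuous.aestronglyMeasurable (by fun_prop)
  · have h1 := hC x
    rw [norm_iteratedFDeriv_zero] at h1
    rw [norm_mul, Complex.norm_real, norm_div, Real.norm_of_nonneg (r := 1 + ‖x‖ ^ 4) (by positivity),
      div_mul_eq_mul_div, mul_div_assoc]
    gcongr
    rw [le_div_iff₀ (by positivity), mul_comm]
    refine le_trans ?_ h1
    gcongr
    have := norm_nonneg x
    nlinarith [pow_nonneg this 2, pow_nonneg this 3]

/-- The Schwartz function `ξ ↦ χ (t ξ) exp (-2πi ⟨a, ξ⟩)` for a cut-off function `χ`. -/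
noncomputable def cutoffChar (χ : ContDiffBump (0 : R3)) (a : R3) (t : ℝ) (ht : t ≠ 0) :
    𝓢(R3, ℂ) :=
  HasCompactSupport.toSchwartzMap
    (f := fun ξ : R3 => (χ (t • ξ) : ℂ) * Complex.exp (((-2 * Real.pi * inner ℝ a ξ : ℝ) : ℂ) *
      Complex.I))
    (by
      refine HasCompactSupport.mul_right ?_
      have := χ.hasCompactSupport.comp_homeomorph (Homeomorph.smulOfNeZero t ht)
      exact this.comp_left (g := fun r : ℝ => (r : ℂ)) rfl)
    (by
      refine ContDiff.mul ?_ ?_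
      · exact Complex.ofRealCLM.contDiff.comp (χ.contDiff.comp (contDiff_const_smul t))
      · refine ContDiff.cexp (ContDiff.mul ?_ contDiff_const)
        refine Complex.ofRealCLM.contDiff.comp ?_
        exact contDiff_const.mul (contDiff_const.inner ℝ contDiff_id))

theorem cutoffChar_apply (χ : ContDiffBump (0 : R3)) (a : R3) {t : ℝ} (ht : t ≠ 0) (ξ : R3) :
    cutoffChar χ a t ht ξ = (χ (t • ξ) : ℂ) *
      Complex.exp (((-2 * Real.pi * inner ℝ a ξ : ℝ) : ℂ) * Complex.I) := rfl

/-- Dilation and modulation on the Fourier side are rescaling and translation in space. So these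
functions are mollifiers centred at `a` of width `t`, concentrating as `t → 0` and spreading out as
`t → ∞`. -/
theorem fourierInv_cutoffChar (χ : ContDiffBump (0 : R3)) (a : R3) {t : ℝ} (ht : 0 < t) (x : R3) :
    (𝓕⁻ (cutoffChar χ a t ht.ne') : 𝓢(R3, ℂ)) x =
      ((t ^ 3)⁻¹ : ℝ) * (𝓕⁻ (cutoffChar χ 0 1 one_ne_zero) : 𝓢(R3, ℂ)) (t⁻¹ • (x - a)) := by
  rw [SchwartzMap.fourierInv_coe, SchwartzMap.fourierInv_coe, Real.fourierInv_eq',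
    Real.fourierInv_eq']
  have h := Measure.integral_comp_smul (volume : Measure R3) (fun η : R3 =>
    Complex.exp (((2 * Real.pi * inner ℝ η (t⁻¹ • (x - a)) : ℝ) : ℂ) * Complex.I) •
      cutoffChar χ 0 1 one_ne_zero η) t
  simp only [finrank_euclideanSpace, Fintype.card_fin] at h
  rw [abs_of_pos (by positivity)] at h
  rw [Complex.real_smul] at h
  rw [← h]
  congr 1; ext ξ
  simp only [cutoffChar_apply, smul_eq_mul, one_smul, inner_zero_left]
  rw [inner_smul_left, inner_smul_right, inner_sub_right, real_inner_comm a ξ]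
  rw [mul_left_comm, ← Complex.exp_add, mul_left_comm, ← Complex.exp_add, mul_comm]
  rw [mul_comm]
  congr 2
  have htc : (t : ℂ) ≠ 0 := by exact_mod_cast ht.ne'
  simp
  field_simp
  ring

/-- The symbol `|ξ|` is smooth and invertible away from the origin, so dividing by it is harmless
when `Θ` vanishes near the origin. This supplies the admissible test functions. -/
theorem halfLaplacian_of_compactSupport (Θ : 𝓢(R3, ℂ)) (hc : HasCompactSupport Θ) {ε : ℝ}
    (hε : 0 < ε) (h0 : ∀ ξ, ‖ξ‖ < ε → Θ ξ = 0) :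
    ∃ φ : 𝓢(R3, ℂ), halfLaplacian φ = 𝓕⁻ (Θ : R3 → ℂ) ∧
      ∀ x, φ x = 𝓕⁻ (fun ξ => Θ ξ / (2 * Real.pi * ‖ξ‖ : ℝ)) x := by
  have hs : ContDiff ℝ ∞ (fun ξ : R3 => Θ ξ / (2 * Real.pi * ‖ξ‖ : ℝ)) := by
    rw [contDiff_iff_contDiffAt]
    intro ξ
    by_cases hξ : ξ = 0
    · refine (contDiffAt_const (c := (0 : ℂ))).congr_of_eventuallyEq ?_
      filter_upwards [Metric.ball_mem_nhds ξ hε] with η hη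
      rw [hξ, Metric.mem_ball, dist_zero_right] at hη
      simp [h0 η hη]
    · simp only [div_eq_mul_inv]
      refine (Θ.smooth ⊤).contDiffAt.mul (ContDiffAt.inv ?_ ?_)
      · refine Complex.ofRealCLM.contDiff.contDiffAt.comp ξ ?_
        exact contDiffAt_const.mul (contDiffAt_norm ℝ hξ)
      · have := Real.pi_pos
        have := norm_pos_iff.2 hξ
        exact_mod_cast (by positivity : (2 * Real.pi * ‖ξ‖) ≠ 0)
  have hc' : HasCompactSupport (fun ξ : R3 => Θ ξ / (2 * Real.pi * ‖ξ‖ : ℝ)) := by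
    simp only [div_eq_mul_inv]
    exact hc.mul_right
  set Ψ : 𝓢(R3, ℂ) := hc'.toSchwartzMap hs with hΨ
  have hΨ' : (Ψ : R3 → ℂ) = (fun ξ : R3 => Θ ξ / (2 * Real.pi * ‖ξ‖ : ℝ)) := rfl
  refine ⟨𝓕⁻ Ψ, ?_, fun x => ?_⟩
  · unfold halfLaplacian
    congr 1
    ext ξ
    rw [← SchwartzMap.fourier_coe, FourierTransform.fourier_fourierInv_eq, hΨ']
    simp only
    by_cases hξ : ξ = 0
    · simp [hξ, h0 0 (by simpa using hε)]
    · have h1 : ((2 * Real.pi * ‖ξ‖ : ℝ) : ℂ) ≠ 0 := by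
        have := Real.pi_pos
        have := norm_pos_iff.2 hξ
        exact_mod_cast (by positivity : (2 * Real.pi * ‖ξ‖) ≠ 0)
      rw [mul_div_cancel₀ _ h1]
  · rw [SchwartzMap.fourierInv_coe, hΨ']

theorem exists_cutoff : ∃ χ : ContDiffBump (0 : R3), χ.rIn = 1 ∧ χ.rOut = 2 :=
  ⟨⟨1, 2, one_pos, one_lt_two⟩, rfl, rfl⟩

/-- The convolution of a function in `L_{1/2}` with a rescaled Schwartz kernel tends to the function
times the integral of the kernel at points of continuity. -/
theorem tendsto_integral_mul_rescaled {h : R3 → ℝ} (hh : Continuous h)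
    (hi : Integrable (fun x => h x / (1 + ‖x‖ ^ 4))) (K : 𝓢(R3, ℂ)) (a : R3) :
    Tendsto (fun t : ℝ => ∫ x, (h x : ℂ) * (((t ^ 3)⁻¹ : ℝ) * K (t⁻¹ • (x - a)))) (𝓝[>] 0)
      (𝓝 ((h a : ℂ) * ∫ z, K z)) := by
  obtain ⟨C, hC0, hC⟩ := K.exists_one_add_norm_pow_mul_le 4 0
  simp only [norm_iteratedFDeriv_zero] at hC
  have hKc := K.continuous
  set B := Metric.closedBall a 1 with hB
  have hBm : MeasurableSet B := Metric.isClosed_closedBall.measurableSet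
  set h₁ : R3 → ℝ := B.indicator h with hh1
  set h₂ : R3 → ℝ := Bᶜ.indicator h with hh2
  have hm1 : AEStronglyMeasurable h₁ volume := hh.aestronglyMeasurable.indicator hBm
  have hm2 : AEStronglyMeasurable h₂ volume := hh.aestronglyMeasurable.indicator hBm.compl
  obtain ⟨M, hM⟩ := (isCompact_closedBall a 1).exists_bound_of_continuousOn hh.continuousOn
  have hM0 : 0 ≤ M := (norm_nonneg _).trans (hM a (by simp))
  have hM1 : ∀ x, ‖h₁ x‖ ≤ M := by
    intro x
    by_cases hx : x ∈ B
    · simpa [hh1, hx] using hM x hx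
    · simpa [hh1, hx] using hM0
  -- the local part
  have T1 : Tendsto (fun t : ℝ => ∫ z, (h₁ (a + t • z) : ℂ) * K z) (𝓝[>] 0)
      (𝓝 (∫ z, (h a : ℂ) * K z)) := by
    refine tendsto_integral_filter_of_dominated_convergence (fun z => M * ‖K z‖) ?_ ?_
      (K.integrable.norm.const_mul M) ?_
    · filter_upwards [self_mem_nhdsWithin] with t ht
      have ht : (0 : ℝ) < t := ht
      refine AEStronglyMeasurable.mul ?_ hKc.aestronglyMeasurable
      refine Complex.continuous_ofReal.comp_aestronglyMeasurable ?_
      exact (((hh.measurable.indicator hBm).comp (by fun_prop : Measurable fun z : R3 => a + t • z))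
        ).aestronglyMeasurable
    · refine Eventually.of_forall fun t => ae_of_all _ fun z => ?_
      rw [norm_mul, Complex.norm_real]
      exact mul_le_mul_of_nonneg_right (hM1 _) (norm_nonneg _)
    · refine ae_of_all _ fun z => ?_
      refine Tendsto.mul_const _ ?_
      refine (Complex.continuous_ofReal.tendsto _).comp ?_
      have h3 : Tendsto (fun t : ℝ => a + t • z) (𝓝[>] 0) (𝓝 a) := by
        have : Tendsto (fun t : ℝ => a + t • z) (𝓝 0) (𝓝 (a + (0 : ℝ) • z)) :=
          Continuous.tendsto (by fun_prop) 0
        simpa using this.mono_left nhdsWithin_le_nhds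
      have h4 : h₁ =ᶠ[𝓝 a] h := by
        filter_upwards [Metric.closedBall_mem_nhds a one_pos] with x hx
        simp [hh1, hB, hx]
      exact ((hh.tendsto a).congr' h4.symm).comp h3
  -- the remaining part
  set D : ℝ := 1 + (1 + ‖a‖) ^ 4 with hD
  have bound2 : ∀ t : ℝ, 0 < t → ∀ x, ‖(h₂ x : ℂ) * (((t ^ 3)⁻¹ : ℝ) * K (t⁻¹ • (x - a)))‖ ≤
      t * (C * D * ‖h x / (1 + ‖x‖ ^ 4)‖) := by
    intro t ht x
    by_cases hx : x ∈ B
    · simp [hh2, hx]; positivity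
    · have hx1 : 1 < ‖x - a‖ := by
        simpa [hB, Metric.mem_closedBall, dist_eq_norm] using hx
      have e1 : h₂ x = h x := by simp [hh2, hx]
      have e2 : ‖K (t⁻¹ • (x - a))‖ ≤ C * t ^ 4 / ‖x - a‖ ^ 4 := by
        have := hC (t⁻¹ • (x - a))
        rw [norm_smul, Real.norm_of_nonneg (by positivity : 0 ≤ t⁻¹)] at this
        rw [le_div_iff₀ (by positivity)]
        have h5 : (t⁻¹ * ‖x - a‖) ^ 4 * ‖K (t⁻¹ • (x - a))‖ ≤ C := by
          refine le_trans ?_ this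
          gcongr
          linarith
        calc ‖K (t⁻¹ • (x - a))‖ * ‖x - a‖ ^ 4
            = ((t⁻¹ * ‖x - a‖) ^ 4 * ‖K (t⁻¹ • (x - a))‖) * t ^ 4 := by field_simp
          _ ≤ C * t ^ 4 := by gcongr
      have e3 : 1 + ‖x‖ ^ 4 ≤ D * ‖x - a‖ ^ 4 := by
        have h6 : ‖x‖ ≤ (1 + ‖a‖) * ‖x - a‖ := by
          have : ‖x‖ ≤ ‖x - a‖ + ‖a‖ := by simpa using norm_add_le (x - a) a
          nlinarith [norm_nonneg a]
        have h7 : ‖x‖ ^ 4 ≤ ((1 + ‖a‖) * ‖x - a‖) ^ 4 := by gcongr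
        have h8 : 1 ≤ ‖x - a‖ ^ 4 := one_le_pow₀ hx1.le
        rw [hD, add_mul, ← mul_pow]; linarith
      rw [e1, norm_mul, norm_mul, Complex.norm_real, Complex.norm_real, norm_div,
        Real.norm_of_nonneg (by positivity : 0 ≤ (t ^ 3)⁻¹),
        Real.norm_of_nonneg (by positivity : 0 ≤ 1 + ‖x‖ ^ 4)]
      calc ‖h x‖ * ((t ^ 3)⁻¹ * ‖K (t⁻¹ • (x - a))‖)
          ≤ ‖h x‖ * ((t ^ 3)⁻¹ * (C * t ^ 4 / ‖x - a‖ ^ 4)) := by gcongr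
        _ = t * (C * (‖h x‖ * (1 / ‖x - a‖ ^ 4))) := by field_simp
        _ ≤ t * (C * (‖h x‖ * (D / (1 + ‖x‖ ^ 4)))) := by
            refine mul_le_mul_of_nonneg_left (mul_le_mul_of_nonneg_left
              (mul_le_mul_of_nonneg_left ?_ (norm_nonneg _)) hC0) ht.le
            rw [div_le_div_iff₀ (by positivity) (by positivity)]
            linarith
        _ = _ := by ring
  have T2 : Tendsto (fun t : ℝ => ∫ x, (h₂ x : ℂ) * (((t ^ 3)⁻¹ : ℝ) * K (t⁻¹ • (x - a))))
      (𝓝[>] 0) (𝓝 0) := by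
    refine squeeze_zero_norm' (a := fun t => t * ∫ x, (C * D * ‖h x / (1 + ‖x‖ ^ 4)‖)) ?_ ?_
    · filter_upwards [self_mem_nhdsWithin] with t ht
      have ht : (0 : ℝ) < t := ht
      rw [← integral_const_mul]
      exact norm_integral_le_of_norm_le ((hi.norm.const_mul _).const_mul _)
        (ae_of_all _ fun x => bound2 t ht x)
    · have : Tendsto (fun t : ℝ => t * ∫ x, (C * D * ‖h x / (1 + ‖x‖ ^ 4)‖)) (𝓝 0) (𝓝 (0 * _)) :=
        tendsto_id.mul_const _
      rw [zero_mul] at this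
      exact this.mono_left nhdsWithin_le_nhds
  have := T1.add T2
  rw [integral_const_mul, add_zero] at this
  refine this.congr' ?_
  filter_upwards [self_mem_nhdsWithin] with t ht
  have ht : (0 : ℝ) < t := ht
  have e1 : ∫ z, (h₁ (a + t • z) : ℂ) * K z =
      ∫ x, (h₁ x : ℂ) * (((t ^ 3)⁻¹ : ℝ) * K (t⁻¹ • (x - a))) := by
    have e2 := Measure.integral_comp_smul (volume : Measure R3)
      (fun y : R3 => (h₁ (a + y) : ℂ) * K (t⁻¹ • y)) t
    simp only [finrank_euclideanSpace, Fintype.card_fin, smul_smul, inv_mul_cancel₀ ht.ne',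
      one_smul] at e2
    rw [e2, abs_of_pos (by positivity), ← integral_smul]
    conv_rhs => rw [← integral_add_left_eq_self _ a]
    congr 1; ext x
    simp
    ring
  rw [e1, ← integral_add]
  · congr 1; ext x
    rw [← add_mul, ← Complex.ofReal_add]
    congr 2
    exact congrFun (indicator_self_add_compl B h) x
  · have hint1 : Integrable h₁ := (integrable_indicator_iff hBm).2
      (hh.continuousOn.integrableOn_compact (isCompact_closedBall a 1))
    refine (hint1.norm.mul_const ((t ^ 3)⁻¹ * C)).mono' ?_ (ae_of_all _ fun x => ?_)
    · exact (Complex.continuous_ofReal.comp_aestronglyMeasurable hm1).mul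
        (by fun_prop : Continuous fun x : R3 => (((t ^ 3)⁻¹ : ℝ) : ℂ) * K (t⁻¹ • (x - a))
        ).aestronglyMeasurable
    · rw [norm_mul, norm_mul, Complex.norm_real, Complex.norm_real,
        Real.norm_of_nonneg (by positivity : 0 ≤ (t ^ 3)⁻¹)]
      gcongr
      refine le_trans ?_ (hC (t⁻¹ • (x - a)))
      refine le_mul_of_one_le_left (norm_nonneg _) (one_le_pow₀ ?_)
      linarith [norm_nonneg (t⁻¹ • (x - a))]
  · refine ((hi.norm.const_mul (C * D)).const_mul t).mono' ?_ (ae_of_all _ fun x => bound2 t ht x)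
    exact (Complex.continuous_ofReal.comp_aestronglyMeasurable hm2).mul
        (by fun_prop : Continuous fun x : R3 => (((t ^ 3)⁻¹ : ℝ) : ℂ) * K (t⁻¹ • (x - a))
        ).aestronglyMeasurable

/-- At large scale the two centres become indistinguishable: by the mean value inequality and the
decay of `∇K`, the difference of the kernels is at most a constant times `|a-b| / (t+|x|)⁴`. This
tends to zero and is dominated by the weight of `L_{1/2}`. -/
theorem tendsto_integral_mul_rescaled_sub {h : R3 → ℝ} (hh : Continuous h)
    (hi : Integrable (fun x => h x / (1 + ‖x‖ ^ 4))) (K : 𝓢(R3, ℂ)) (a b : R3) :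
    Tendsto (fun t : ℝ => ∫ x, (h x : ℂ) * (((t ^ 3)⁻¹ : ℝ) * K (t⁻¹ • (x - a)) -
      ((t ^ 3)⁻¹ : ℝ) * K (t⁻¹ • (x - b)))) atTop (𝓝 0) := by
  obtain ⟨C, hC0, hC⟩ := K.exists_one_add_norm_pow_mul_le 4 1
  have hC' : ∀ x, (1 + ‖x‖) ^ 4 * ‖fderiv ℝ K x‖ ≤ C := by
    intro x; rw [← norm_iteratedFDeriv_one]; exact hC x
  have hKc := K.continuous
  have key : ∀ t : ℝ, 1 ≤ t → ‖a‖ ≤ t → ‖b‖ ≤ t → ∀ x,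
      ‖((t ^ 3)⁻¹ : ℝ) * K (t⁻¹ • (x - a)) - ((t ^ 3)⁻¹ : ℝ) * K (t⁻¹ • (x - b))‖ ≤
        16 * C * ‖a - b‖ / (t + ‖x‖) ^ 4 := by
    intro t ht hat hbt x
    have ht0 : 0 < t := by linarith
    have hmem : ∀ c : R3, ‖c‖ ≤ t → t⁻¹ • (x - c) ∈ Metric.closedBall (t⁻¹ • x) 1 := by
      intro c hc
      rw [Metric.mem_closedBall, dist_eq_norm, ← smul_sub, norm_smul,
        Real.norm_of_nonneg (by positivity)]
      simp
      rw [inv_mul_le_iff₀ ht0]; linarith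
    have hbd : ∀ z ∈ Metric.closedBall (t⁻¹ • x) 1,
        ‖fderiv ℝ K z‖ ≤ 16 * C * t ^ 4 / (t + ‖x‖) ^ 4 := by
      intro z hz
      rw [Metric.mem_closedBall, dist_eq_norm, norm_sub_rev] at hz
      have h1 : ‖x‖ ≤ t * (‖z‖ + 1) := by
        have : ‖t⁻¹ • x‖ ≤ ‖z‖ + 1 := by
          have := norm_add_le (t⁻¹ • x - z) z
          simp only [sub_add_cancel] at this
          linarith
        rw [norm_smul, Real.norm_of_nonneg (by positivity), inv_mul_le_iff₀ ht0] at this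
        exact this
      -- The fourth power of this inequality is the source of the factor 16.
      have h2 : t + ‖x‖ ≤ 2 * t * (1 + ‖z‖) := by nlinarith [norm_nonneg z]
      rw [le_div_iff₀ (by positivity)]
      calc ‖fderiv ℝ K z‖ * (t + ‖x‖) ^ 4 ≤ ‖fderiv ℝ K z‖ * (2 * t * (1 + ‖z‖)) ^ 4 := by gcongr
        _ = 16 * ((1 + ‖z‖) ^ 4 * ‖fderiv ℝ K z‖) * t ^ 4 := by ring
        _ ≤ 16 * C * t ^ 4 := by gcongr; exact hC' z
    have h3 := (convex_closedBall (t⁻¹ • x) 1).norm_image_sub_le_of_norm_fderiv_le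
      (f := (K : R3 → ℂ)) (fun z _ => K.differentiableAt) hbd (hmem b hbt) (hmem a hat)
    rw [← mul_sub, norm_mul, Complex.norm_real, Real.norm_of_nonneg (by positivity)]
    have h4 : ‖t⁻¹ • (x - a) - t⁻¹ • (x - b)‖ = t⁻¹ * ‖a - b‖ := by
      rw [← smul_sub, norm_smul, Real.norm_of_nonneg (by positivity), norm_sub_rev a b]
      congr 2; abel
    rw [h4] at h3
    calc (t ^ 3)⁻¹ * ‖K (t⁻¹ • (x - a)) - K (t⁻¹ • (x - b))‖
        ≤ (t ^ 3)⁻¹ * (16 * C * t ^ 4 / (t + ‖x‖) ^ 4 * (t⁻¹ * ‖a - b‖)) := by gcongr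
      _ = _ := by field_simp
  have h0 : (0 : ℂ) = ∫ x : R3, (0 : ℂ) := by simp
  rw [h0]
  refine tendsto_integral_filter_of_dominated_convergence
    (fun x => 16 * C * ‖a - b‖ * ‖h x / (1 + ‖x‖ ^ 4)‖) ?_ ?_ (hi.norm.const_mul _) ?_
  · exact Eventually.of_forall fun t => Continuous.aestronglyMeasurable (by fun_prop)
  · filter_upwards [eventually_ge_atTop 1, eventually_ge_atTop ‖a‖, eventually_ge_atTop ‖b‖] with
      t h1 h2 h3
    refine ae_of_all _ fun x => ?_
    rw [norm_mul, norm_div, Complex.norm_real,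
      Real.norm_of_nonneg (by positivity : 0 ≤ 1 + ‖x‖ ^ 4)]
    calc _ ≤ ‖h x‖ * (16 * C * ‖a - b‖ / (t + ‖x‖) ^ 4) := by gcongr; exact key t h1 h2 h3 x
      _ ≤ ‖h x‖ * (16 * C * ‖a - b‖ / (1 + ‖x‖ ^ 4)) := by
        gcongr
        have : 0 ≤ ‖x‖ := norm_nonneg x
        calc 1 + ‖x‖ ^ 4 ≤ (1 + ‖x‖) ^ 4 := by nlinarith [pow_nonneg this 2, pow_nonneg this 3]
          _ ≤ _ := by gcongr
      _ = _ := by ring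
  · refine ae_of_all _ fun x => ?_
    rw [← mul_zero (h x : ℂ)]
    refine Tendsto.const_mul _ ?_
    refine squeeze_zero_norm' (a := fun t => 16 * C * ‖a - b‖ / (t + ‖x‖) ^ 4) ?_ ?_
    · filter_upwards [eventually_ge_atTop 1, eventually_ge_atTop ‖a‖, eventually_ge_atTop ‖b‖] with
        t h1 h2 h3 using key t h1 h2 h3 x
    · refine Tendsto.const_div_atTop ?_ _
      exact (tendsto_pow_atTop (by norm_num)).comp (tendsto_atTop_add_const_right _ _ tendsto_id)

/-- A continuous function in `L_{1/2}` whose Fourier transform is supported at the origin is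
constant. -/
theorem eq_const_of_fourier_support {h : R3 → ℝ} (hh : Continuous h)
    (hi : Integrable (fun x => h x / (1 + ‖x‖ ^ 4)))
    (H : ∀ Θ : 𝓢(R3, ℂ), HasCompactSupport Θ → (∃ ε > 0, ∀ ξ, ‖ξ‖ < ε → Θ ξ = 0) →
      ∫ x, (h x : ℂ) * (𝓕⁻ Θ : 𝓢(R3, ℂ)) x = 0) (a b : R3) : h a = h b := by
  obtain ⟨χ, hχ1, -⟩ := exists_cutoff
  set K : 𝓢(R3, ℂ) := 𝓕⁻ (cutoffChar χ 0 1 one_ne_zero) with hK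
  have hKint : ∫ z, K z = 1 := by
    have h1 : (𝓕 K : 𝓢(R3, ℂ)) 0 = ∫ z, K z := by
      rw [SchwartzMap.fourier_coe, Real.fourier_eq']; simp
    rw [← h1, hK, FourierTransform.fourier_fourierInv_eq, cutoffChar_apply]
    simp [χ.one_of_mem_closedBall (x := 0) (by simp [χ.rIn_pos.le])]
  have hintS : ∀ (c : R3) {t : ℝ} (ht : 0 < t), Integrable (fun x => (h x : ℂ) *
      (((t ^ 3)⁻¹ : ℝ) * K (t⁻¹ • (x - c)))) := by
    intro c t ht
    refine (MemLHalf.integrable_mul_schwartz hh hi (𝓕⁻ (cutoffChar χ c t ht.ne'))).congr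
      (ae_of_all _ fun x => ?_)
    simp only
    rw [fourierInv_cutoffChar χ c ht]
  set I : R3 → ℝ → ℂ := fun c t => ∫ x, (h x : ℂ) * (((t ^ 3)⁻¹ : ℝ) * K (t⁻¹ • (x - c))) with hI
  -- Cut-offs at two scales are both equal to one near the origin, so their difference is an
  -- admissible `Θ` and the average does not depend on the scale.
  have hconst : ∀ c t T, 0 < t → 0 < T → I c t = I c T := by
    intro c t T ht hT
    have h1 := H (cutoffChar χ c t ht.ne' - cutoffChar χ c T hT.ne') ?_ ?_
    · have h2 : ∀ x, (h x : ℂ) * (𝓕⁻ (cutoffChar χ c t ht.ne' - cutoffChar χ c T hT.ne') :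
          𝓢(R3, ℂ)) x = (h x : ℂ) * (((t ^ 3)⁻¹ : ℝ) * K (t⁻¹ • (x - c))) -
            (h x : ℂ) * (((T ^ 3)⁻¹ : ℝ) * K (T⁻¹ • (x - c))) := by
        intro x
        have e : (𝓕⁻ (cutoffChar χ c t ht.ne' - cutoffChar χ c T hT.ne') : 𝓢(R3, ℂ)) =
            𝓕⁻ (cutoffChar χ c t ht.ne') - 𝓕⁻ (cutoffChar χ c T hT.ne') :=
          by rw [sub_eq_add_neg, FourierTransform.fourierInv_add, FourierTransform.fourierInv_neg,
            ← sub_eq_add_neg]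
        rw [e, sub_apply, fourierInv_cutoffChar χ c ht, fourierInv_cutoffChar χ c hT, mul_sub]
      simp only [h2] at h1
      rw [integral_sub (hintS c ht) (hintS c hT)] at h1
      exact sub_eq_zero.1 h1
    · have hcs : ∀ {s : ℝ} (hs : s ≠ 0), HasCompactSupport (cutoffChar χ c s hs) := by
        intro s hs
        refine HasCompactSupport.mul_right ?_
        have := χ.hasCompactSupport.comp_homeomorph (Homeomorph.smulOfNeZero s hs)
        exact this.comp_left (g := fun r : ℝ => (r : ℂ)) rfl
      exact (hcs _).sub (hcs _)
    · refine ⟨(max t T)⁻¹, by positivity, fun ξ hξ => ?_⟩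
      have hone : ∀ s, 0 < s → s ≤ max t T → χ (s • ξ) = 1 := by
        intro s hs hsm
        refine χ.one_of_mem_closedBall ?_
        rw [hχ1, Metric.mem_closedBall, dist_zero_right, norm_smul, Real.norm_of_nonneg hs.le]
        calc s * ‖ξ‖ ≤ max t T * (max t T)⁻¹ := by gcongr
          _ = 1 := mul_inv_cancel₀ (by positivity)
      rw [sub_apply, cutoffChar_apply, cutoffChar_apply, hone t ht (le_max_left _ _),
        hone T hT (le_max_right _ _), sub_self]
  -- The small-scale limit identifies the constant value of the average; the large-scale limit then
  -- compares the two centres.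
  have hval : ∀ c t, 0 < t → I c t = h c := by
    intro c t ht
    have h1 := tendsto_integral_mul_rescaled hh hi K c
    rw [hKint, mul_one] at h1
    refine tendsto_nhds_unique (tendsto_const_nhds.congr' ?_) h1
    filter_upwards [self_mem_nhdsWithin] with s hs using hconst c t s ht hs
  have h2 := tendsto_integral_mul_rescaled_sub hh hi K a b
  have h3 : Tendsto (fun _ : ℝ => (h a : ℂ) - h b) atTop (𝓝 0) := by
    refine h2.congr' ?_
    filter_upwards [eventually_gt_atTop 0] with t ht
    simp only [mul_sub]
    rw [integral_sub (hintS a ht) (hintS b ht)]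
    change I a t - I b t = _
    rw [hval a t ht, hval b t ht]
  have h4 := tendsto_nhds_unique h3 tendsto_const_nhds
  exact_mod_cast (sub_eq_zero.1 h4.symm)

/-! ### The equation for `-Δu` -/

theorem integrable_inv_one_add_norm_pow_four :
    Integrable (fun x : R3 => (1 + ‖x‖ ^ 4)⁻¹) := by
  have h := integrable_one_add_norm (E := R3) (μ := volume) (r := 4) (by simp; norm_num)
  refine (h.const_mul 8).mono' ?_ (ae_of_all _ fun x => ?_)
  · exact Continuous.aestronglyMeasurable
      (Continuous.inv₀ (by fun_prop) fun x => by positivity)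
  · rw [Real.norm_of_nonneg (by positivity), Real.rpow_neg (by positivity)]
    rw [show (4 : ℝ) = ((4 : ℕ) : ℝ) by norm_num, Real.rpow_natCast]
    rw [← div_eq_mul_inv, le_div_iff₀ (by positivity), inv_mul_le_iff₀ (by positivity)]
    have := norm_nonneg x
    nlinarith [sq_nonneg (‖x‖ - 1), sq_nonneg (‖x‖ ^ 2 - 1), sq_nonneg (‖x‖ ^ 2 - ‖x‖)]

/-- The Laplacian of a solution is, up to a constant, the Riesz potential of the density. -/
theorem neg_laplacian_eq_riesz {u m : R3 → ℝ} (hu : IsSmoothSolution u (fun x => 2 * m x))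
    (hm : Continuous m) (hmi : Integrable m) : ∃ C : ℝ, ∀ x,
      -(Δ u) x = (Real.pi ^ 2)⁻¹ * (∫ y, (‖x - y‖ ^ 2)⁻¹ * m y) + C := by
  have hk := SingKernel.inv_norm_sq
  set g : R3 → ℝ := fun x => ∫ y, (‖x - y‖ ^ 2)⁻¹ * m y with hg
  have hgc : Continuous g := hk.continuous_integral hm hmi
  have hΔ : Continuous (Δ u) := by
    rw [InnerProductSpace.laplacian_eq_iteratedFDeriv_stdOrthonormalBasis]
    have := hu.contDiff.continuous_iteratedFDeriv (m := 2) (WithTop.coe_le_coe.2 le_top)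
    fun_prop
  have hgi : Integrable (fun x => g x / (1 + ‖x‖ ^ 4)) := by
    have h1 := (hk.integrable_prod integrable_inv_one_add_norm_pow_four (W := 1) (fun x => by
      rw [Real.norm_of_nonneg (by positivity)]
      exact inv_le_one_of_one_le₀ (by linarith [pow_nonneg (norm_nonneg x) 4])) hmi).integral_prod_left
    refine h1.congr (ae_of_all _ fun x => ?_)
    simp only [smul_eq_mul]
    rw [integral_mul_const, div_eq_mul_inv]
  -- It remains to show that the Fourier transform of this difference is supported at the origin.
  -- The factor `π⁻²` is the 2 of the equation divided by the constant `2π²` of the Riesz kernel.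
  set h : R3 → ℝ := fun x => -(Δ u) x - (Real.pi ^ 2)⁻¹ * g x with hh
  have hhc : Continuous h := hΔ.neg.sub (continuous_const.mul hgc)
  have hi : Integrable (fun x => h x / (1 + ‖x‖ ^ 4)) := by
    refine (hu.memLHalf_laplacian.2.neg.sub (hgi.const_mul (Real.pi ^ 2)⁻¹)).congr
      (ae_of_all _ fun x => ?_)
    simp [hh]; ring
  have hw : Integrable (fun x => -(Δ u) x / (1 + ‖x‖ ^ 4)) := by
    refine hu.memLHalf_laplacian.2.neg.congr (ae_of_all _ fun x => ?_)
    simp; ring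
  refine ⟨h 0, fun x => ?_⟩
  rw [← eq_const_of_fourier_support hhc hi ?_ x 0]
  · simp only [hh, hg]; ring
  intro Θ hΘc ⟨ε, hε, hΘ0⟩
  obtain ⟨φ, hφ1, hφ2⟩ := halfLaplacian_of_compactSupport Θ hΘc hε hΘ0
  have h1 := hu.weak_eq φ
  rw [hφ1] at h1
  rw [← SchwartzMap.fourierInv_coe] at h1
  set θ : 𝓢(R3, ℂ) := 𝓕⁻ Θ with hθ
  -- Fubini moves the Riesz kernel onto `θ`, where it produces `2π²` times the test function `φ`.
  have h2 : ∫ x, g x • θ x = ∫ y, m y • ((2 * Real.pi ^ 2 : ℂ) * φ y) := by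
    obtain ⟨W, hW⟩ := θ.exists_norm_le
    rw [hk.integral_integral_swap_smul θ.integrable hW hmi]
    congr 1; ext y
    rw [hφ2, ← integral_inv_norm_sq_mul_fourierInv, ← SchwartzMap.fourierInv_coe]
    congr 2
    ext x
    rw [norm_sub_rev, Complex.real_smul]
  have h3 : ∀ x, (h x : ℂ) * θ x = ((-(Δ u) x : ℝ) : ℂ) * θ x -
      ((Real.pi ^ 2 : ℂ))⁻¹ * (g x • θ x) := by
    intro x; simp only [hh, Complex.real_smul]; push_cast; ring
  simp only [h3]
  rw [integral_sub, integral_const_mul, h1, h2, ← integral_const_mul, sub_eq_zero]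
  · congr 1; ext y
    have : (Real.pi : ℂ) ≠ 0 := by exact_mod_cast Real.pi_ne_zero
    rw [Complex.real_smul]; push_cast; field_simp
  · exact MemLHalf.integrable_mul_schwartz hΔ.neg hw θ
  · refine Integrable.const_mul ?_ _
    exact (MemLHalf.integrable_mul_schwartz hgc hgi θ).congr (ae_of_all _ fun x => by simp)

/-! ### Integration by parts and radial Laplacians -/

theorem laplacian_eq_sum_fderiv {f : R3 → ℝ} (hf : ContDiff ℝ 2 f) (x : R3) :
    (Δ f) x = ∑ i, fderiv ℝ (fun x => fderiv ℝ f x (EuclideanSpace.basisFun (Fin 3) ℝ i)) x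
      (EuclideanSpace.basisFun (Fin 3) ℝ i) := by
  rw [InnerProductSpace.laplacian_eq_iteratedFDeriv_orthonormalBasis f
    (EuclideanSpace.basisFun (Fin 3) ℝ)]
  refine Finset.sum_congr rfl fun i _ => ?_
  rw [iteratedFDeriv_two_apply]
  have h1 : DifferentiableAt ℝ (fderiv ℝ f) x :=
    ((hf.fderiv_right (m := 1) (by norm_num)).differentiable one_ne_zero).differentiableAt
  rw [fderiv_clm_apply h1 (differentiableAt_const _)]
  simp

theorem integral_mul_fderiv_comm {f g : R3 → ℝ} (hf : ContDiff ℝ 1 f) (hg : ContDiff ℝ 1 g)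
    (hc : HasCompactSupport g) (v : R3) :
    ∫ x, f x * fderiv ℝ g x v = -∫ x, fderiv ℝ f x v * g x := by
  have h1 := hf.continuous
  have h2 := hg.continuous
  have h3 : Continuous fun x => fderiv ℝ f x v := (hf.continuous_fderiv one_ne_zero).clm_apply
    continuous_const
  have h4 : Continuous fun x => fderiv ℝ g x v := (hg.continuous_fderiv one_ne_zero).clm_apply
    continuous_const
  refine integral_mul_fderiv_eq_neg_fderiv_mul_of_integrable ?_ ?_ ?_
    (fun x _ => (hf.differentiable one_ne_zero).differentiableAt)
    (fun x _ => (hg.differentiable one_ne_zero).differentiableAt)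
  · exact (h3.mul h2).integrable_of_hasCompactSupport hc.mul_left
  · refine (h1.mul h4).integrable_of_hasCompactSupport (HasCompactSupport.mul_left ?_)
    exact hc.fderiv_apply (𝕜 := ℝ) v
  · exact (h1.mul h2).integrable_of_hasCompactSupport hc.mul_left

theorem integral_fderiv_eq_zero {g : R3 → ℝ} (hg : ContDiff ℝ 1 g)
    (hc : HasCompactSupport g) (v : R3) : ∫ x, fderiv ℝ g x v = 0 := by
  simpa using integral_mul_fderiv_comm (f := fun _ => 1) contDiff_const hg hc v

theorem contDiff_fderiv_apply {f : R3 → ℝ} (hf : ContDiff ℝ 2 f) (v : R3) :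
    ContDiff ℝ 1 (fun x => fderiv ℝ f x v) :=
  (hf.fderiv_right (m := 1) (by norm_num)).clm_apply contDiff_const

theorem continuous_laplacian {f : R3 → ℝ} (hf : ContDiff ℝ 2 f) : Continuous (Δ f) := by
  rw [InnerProductSpace.laplacian_eq_iteratedFDeriv_stdOrthonormalBasis]
  have := hf.continuous_iteratedFDeriv (m := 2) le_rfl
  fun_prop

theorem hasCompactSupport_laplacian {f : R3 → ℝ} (hc : HasCompactSupport f) :
    HasCompactSupport (Δ f) := by
  refine hc.mono' fun x hx => ?_
  by_contra h
  have h0 : f =ᶠ[𝓝 x] 0 := notMem_tsupport_iff_eventuallyEq.1 h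
  have := (InnerProductSpace.laplacian_congr_nhds h0).self_of_nhds
  apply hx
  rw [this]
  exact congrFun (InnerProductSpace.laplacian_const (c := (0 : ℝ))) x

/-- Green's second identity for a compactly supported test function. -/
theorem integral_mul_laplacian_comm {f g : R3 → ℝ} (hf : ContDiff ℝ 2 f) (hg : ContDiff ℝ 2 g)
    (hc : HasCompactSupport g) : ∫ x, f x * (Δ g) x = ∫ x, (Δ f) x * g x := by
  have h12 : (1 : WithTop ℕ∞) ≤ 2 := by norm_num
  simp only [laplacian_eq_sum_fderiv hf, laplacian_eq_sum_fderiv hg, Finset.mul_sum,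
    Finset.sum_mul]
  set b := EuclideanSpace.basisFun (Fin 3) ℝ
  rw [integral_finsetSum, integral_finsetSum]
  · refine Finset.sum_congr rfl fun i _ => ?_
    rw [integral_mul_fderiv_comm (hf.of_le h12) (contDiff_fderiv_apply hg _)
      (hc.fderiv_apply (𝕜 := ℝ) _), integral_mul_fderiv_comm (contDiff_fderiv_apply hf _)
      (hg.of_le h12) hc, neg_neg]
  · intro i _
    exact ((((contDiff_fderiv_apply hf _).continuous_fderiv one_ne_zero).clm_apply
      continuous_const).mul hg.continuous).integrable_of_hasCompactSupport hc.mul_left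
  · intro i _
    refine (hf.continuous.mul (((contDiff_fderiv_apply hg _).continuous_fderiv
      one_ne_zero).clm_apply continuous_const)).integrable_of_hasCompactSupport
      (HasCompactSupport.mul_left ?_)
    exact HasCompactSupport.fderiv_apply (𝕜 := ℝ) (hc.fderiv_apply (𝕜 := ℝ) _) _

theorem hasFDerivAt_radial {F : ℝ → ℝ} {F' : ℝ} (y x : R3)
    (hF : HasDerivAt F F' (‖x - y‖ ^ 2)) :
    HasFDerivAt (fun x : R3 => F (‖x - y‖ ^ 2)) ((2 * F') • innerSL ℝ (x - y)) x := by
  have h1 : HasFDerivAt (fun x : R3 => ‖x - y‖ ^ 2) (2 • innerSL ℝ (x - y)) x := by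
    have := ((hasStrictFDerivAt_norm_sq (x - y)).hasFDerivAt).comp x
      ((hasFDerivAt_id x).sub_const y)
    exact this
  have h2 := hF.hasFDerivAt.comp x h1
  refine h2.congr_fderiv ?_
  ext v
  simp; ring

/-- Using `|x-y|²` as the radial variable keeps everything differentiable at `y`. The coefficient 6
is twice the dimension. -/
theorem laplacian_radial {F F' F'' : ℝ → ℝ} (y : R3) (hF : ∀ s, 0 ≤ s → HasDerivAt F (F' s) s)
    (hF' : ∀ s, 0 ≤ s → HasDerivAt F' (F'' s) s)
    (hc : ContDiff ℝ 2 (fun x : R3 => F (‖x - y‖ ^ 2))) (x : R3) :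
    (Δ (fun x : R3 => F (‖x - y‖ ^ 2))) x =
      4 * F'' (‖x - y‖ ^ 2) * ‖x - y‖ ^ 2 + 6 * F' (‖x - y‖ ^ 2) := by
  rw [laplacian_eq_sum_fderiv hc]
  set b := EuclideanSpace.basisFun (Fin 3) ℝ
  have h1 : ∀ i, fderiv ℝ (fun x => fderiv ℝ (fun x : R3 => F (‖x - y‖ ^ 2)) x (b i)) x (b i) =
      4 * F'' (‖x - y‖ ^ 2) * inner ℝ (x - y) (b i) ^ 2 + 2 * F' (‖x - y‖ ^ 2) := by
    intro i
    have e : (fun x => fderiv ℝ (fun x : R3 => F (‖x - y‖ ^ 2)) x (b i)) =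
        fun x => 2 * F' (‖x - y‖ ^ 2) * inner ℝ (x - y) (b i) := by
      ext x
      rw [(hasFDerivAt_radial y x (hF _ (by positivity))).fderiv]
      rfl
    have h2 := (hasFDerivAt_radial y x (hF' _ (by positivity))).const_mul 2
    have h3 : HasFDerivAt (fun x : R3 => inner ℝ (x - y) (b i)) (innerSL ℝ (b i)) x := by
      have := (innerSL ℝ (b i)).hasFDerivAt.comp x ((hasFDerivAt_id x).sub_const y)
      refine (this.congr_fderiv (by ext; simp)).congr_of_eventuallyEq
        (Eventually.of_forall fun z => ?_)
      simp [real_inner_comm]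
    have h4 : HasFDerivAt (fun x => 2 * F' (‖x - y‖ ^ 2) * inner ℝ (x - y) (b i)) _ x := h2.mul h3
    rw [e, h4.fderiv]
    have : inner ℝ (b i) (b i) = (1 : ℝ) := by simp
    simp only [add_apply, smul_apply, innerSL_apply_apply,
      smul_eq_mul, this]
    ring
  simp only [h1, Finset.sum_add_distrib, ← Finset.mul_sum]
  rw [b.sum_sq_inner_left]
  simp
  ring

/-! ### The logarithmic potential -/

theorem log_norm_eq (z : R3) : Real.log ‖z‖ = min (Real.log ‖z‖) 0 + Real.log (max ‖z‖ 1) := by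
  rcases le_total 1 ‖z‖ with h | h
  · rw [min_eq_right (Real.log_nonneg h), max_eq_left h, zero_add]
  · rw [min_eq_left (Real.log_nonpos (norm_nonneg _) h), max_eq_right h, Real.log_one, add_zero]

theorem abs_half_log_le {z : R3} (hz0 : z ≠ 0) {ε : ℝ} (h0 : 0 < ε) (h1 : ε ≤ 1) :
    |1 / 2 * Real.log (‖z‖ ^ 2 + ε ^ 2)| ≤ |min (Real.log ‖z‖) 0| + ‖z‖ ^ 2 := by
  have hz : 0 < ‖z‖ := norm_pos_iff.2 hz0
  have hp : 0 < ‖z‖ ^ 2 + ε ^ 2 := by positivity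
  have h2 : Real.log (‖z‖ ^ 2 + ε ^ 2) ≤ ‖z‖ ^ 2 := by
    have := Real.log_le_sub_one_of_pos hp
    nlinarith
  have h3 : min (Real.log ‖z‖) 0 ≤ 1 / 2 * Real.log (‖z‖ ^ 2 + ε ^ 2) := by
    refine (min_le_left _ _).trans ?_
    have h4 : Real.log (‖z‖ ^ 2) ≤ Real.log (‖z‖ ^ 2 + ε ^ 2) :=
      Real.log_le_log (by positivity) (by nlinarith)
    rw [Real.log_pow] at h4
    push_cast at h4; linarith
  have h5 := neg_abs_le (min (Real.log ‖z‖) 0)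
  have h6 := abs_nonneg (min (Real.log ‖z‖) 0)
  rw [abs_le]
  constructor <;> nlinarith

theorem ae_ne (y : R3) : ∀ᵐ x : R3, x ≠ y := by simp [ae_iff]

/-- The function `½ log(|z|² + ε²)` is a smooth substitute for `log|z|`, so that integrations by
parts can be done before letting `ε → 0`. -/
theorem tendsto_integral_half_log {w : R3 → ℝ} (hw : Continuous w) (hc : HasCompactSupport w)
    (y : R3) : Tendsto (fun ε : ℝ => ∫ x, 1 / 2 * Real.log (‖x - y‖ ^ 2 + ε ^ 2) * w x) (𝓝[>] 0)
      (𝓝 (∫ x, Real.log ‖x - y‖ * w x)) := by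
  have hwi : Integrable w := hw.integrable_of_hasCompactSupport hc
  refine tendsto_integral_filter_of_dominated_convergence
    (fun x => |min (Real.log ‖x - y‖) 0 * w x| + ‖x - y‖ ^ 2 * |w x|) ?_ ?_ ?_ ?_
  · filter_upwards [self_mem_nhdsWithin] with ε hε
    have hε : (0 : ℝ) < ε := hε
    refine (Continuous.mul (continuous_const.mul (Continuous.log (by fun_prop) fun x => ?_))
      hw).aestronglyMeasurable
    positivity
  · filter_upwards [self_mem_nhdsWithin, Ioc_mem_nhdsGT one_pos] with ε hε hε1
    filter_upwards [ae_ne y] with x hx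
    rw [Real.norm_eq_abs, abs_mul, abs_mul (min _ _), ← add_mul]
    exact mul_le_mul_of_nonneg_right (abs_half_log_le (sub_ne_zero.2 hx) hε1.1 hε1.2)
      (abs_nonneg _)
  · refine Integrable.add ?_ ?_
    · have := (SingKernel.min_log.integrable_mul_sub hw hwi y).norm
      refine this.congr (ae_of_all _ fun x => ?_)
      simp only [norm_sub_rev y x, Real.norm_eq_abs]
    · exact (by fun_prop : Continuous fun x => ‖x - y‖ ^ 2 * |w x|).integrable_of_hasCompactSupport
        (HasCompactSupport.mul_left hc.norm)
  · filter_upwards [ae_ne y] with x hx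
    have h0 : 0 < ‖x - y‖ := norm_pos_iff.2 (sub_ne_zero.2 hx)
    refine Tendsto.mul_const _ ?_
    have h1 : Tendsto (fun ε : ℝ => ‖x - y‖ ^ 2 + ε ^ 2) (𝓝[>] 0) (𝓝 (‖x - y‖ ^ 2)) := by
      have : Tendsto (fun ε : ℝ => ‖x - y‖ ^ 2 + ε ^ 2) (𝓝 0) (𝓝 (‖x - y‖ ^ 2 + 0 ^ 2)) :=
        Continuous.tendsto (by fun_prop) 0
      simpa using this.mono_left nhdsWithin_le_nhds
    have h2 := ((Real.continuousAt_log (by positivity)).tendsto.comp h1).const_mul (1 / 2)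
    rw [Real.log_pow] at h2
    refine h2.trans (le_of_eq ?_)
    congr 1
    push_cast; ring

theorem hasDerivAt_half_log {ε : ℝ} (hε : 0 < ε) {s : ℝ} (hs : 0 ≤ s) :
    HasDerivAt (fun s => 1 / 2 * Real.log (s + ε ^ 2)) (1 / 2 * (s + ε ^ 2)⁻¹) s := by
  have := (((hasDerivAt_id s).add_const (ε ^ 2)).log (by simp; positivity)).const_mul (1 / 2 : ℝ)
  simpa using this

theorem hasDerivAt_half_inv {ε : ℝ} (hε : 0 < ε) {s : ℝ} (hs : 0 ≤ s) :
    HasDerivAt (fun s => 1 / 2 * (s + ε ^ 2)⁻¹) (-(1 / 2) * ((s + ε ^ 2) ^ 2)⁻¹) s := by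
  have : HasDerivAt (fun s => 1 / 2 * (s + ε ^ 2)⁻¹) (1 / 2 * (-1 / (s + ε ^ 2) ^ 2)) s :=
    (((hasDerivAt_id s).add_const (ε ^ 2)).inv (by simp; positivity)).const_mul (1 / 2 : ℝ)
  convert this using 1
  ring

theorem contDiff_half_log {ε : ℝ} (hε : 0 < ε) (y : R3) {n : WithTop ℕ∞} :
    ContDiff ℝ n (fun x : R3 => 1 / 2 * Real.log (‖x - y‖ ^ 2 + ε ^ 2)) := by
  refine contDiff_const.mul (ContDiff.log ?_ fun x => by positivity)
  exact ((contDiff_id.sub contDiff_const).norm_sq ℝ).add contDiff_const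

theorem integral_log_mul_fderiv {ψ : R3 → ℝ} (hψ : ContDiff ℝ 1 ψ) (hc : HasCompactSupport ψ)
    (y v : R3) : ∫ x, Real.log ‖x - y‖ * fderiv ℝ ψ x v =
      -∫ x, inner ℝ (x - y) v * (‖x - y‖ ^ 2)⁻¹ * ψ x := by
  have hcont := hψ.continuous
  have T1 := tendsto_integral_half_log ((hψ.continuous_fderiv one_ne_zero).clm_apply
    continuous_const) (hc.fderiv_apply (𝕜 := ℝ) v) y
  refine tendsto_nhds_unique T1 ?_
  have T2 : Tendsto (fun ε : ℝ => ∫ x, inner ℝ (x - y) v * (‖x - y‖ ^ 2 + ε ^ 2)⁻¹ * ψ x) (𝓝[>] 0)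
      (𝓝 (∫ x, inner ℝ (x - y) v * (‖x - y‖ ^ 2)⁻¹ * ψ x)) := by
    refine tendsto_integral_filter_of_dominated_convergence
      (fun x => ‖v‖ * |‖y - x‖⁻¹ * ψ x|) ?_ ?_ ?_ ?_
    · filter_upwards [self_mem_nhdsWithin] with ε hε
      have hε : (0 : ℝ) < ε := hε
      refine (Continuous.mul (Continuous.mul (by fun_prop)
        (Continuous.inv₀ (by fun_prop) fun x => ?_)) hcont).aestronglyMeasurable
      positivity
    · filter_upwards [self_mem_nhdsWithin] with ε hε
      filter_upwards [ae_ne y] with x hx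
      have hε : (0 : ℝ) < ε := hε
      have h0 : 0 < ‖x - y‖ := norm_pos_iff.2 (sub_ne_zero.2 hx)
      rw [norm_sub_rev y x, Real.norm_eq_abs, abs_mul, abs_mul, abs_mul, ← mul_assoc]
      refine mul_le_mul_of_nonneg_right ?_ (abs_nonneg _)
      rw [abs_of_nonneg (by positivity : 0 ≤ (‖x - y‖ ^ 2 + ε ^ 2)⁻¹),
        abs_of_nonneg (by positivity : 0 ≤ ‖x - y‖⁻¹)]
      calc |inner ℝ (x - y) v| * (‖x - y‖ ^ 2 + ε ^ 2)⁻¹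
          ≤ ‖x - y‖ * ‖v‖ * (‖x - y‖ ^ 2)⁻¹ := by
            gcongr
            · exact abs_real_inner_le_norm _ _
            · nlinarith
        _ = ‖v‖ * ‖x - y‖⁻¹ := by field_simp
    · exact ((SingKernel.inv_norm.integrable_mul_sub hcont
        (hcont.integrable_of_hasCompactSupport hc) y).norm).const_mul _
    · filter_upwards [ae_ne y] with x hx
      have h0 : 0 < ‖x - y‖ := norm_pos_iff.2 (sub_ne_zero.2 hx)
      refine Tendsto.mul_const _ (Tendsto.const_mul _ ?_)
      refine Tendsto.inv₀ ?_ (by positivity)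
      have : Tendsto (fun ε : ℝ => ‖x - y‖ ^ 2 + ε ^ 2) (𝓝 0) (𝓝 (‖x - y‖ ^ 2 + 0 ^ 2)) :=
        Continuous.tendsto (by fun_prop) 0
      simpa using this.mono_left nhdsWithin_le_nhds
  refine T2.neg.congr' ?_
  filter_upwards [self_mem_nhdsWithin] with ε hε
  have hε : (0 : ℝ) < ε := hε
  rw [integral_mul_fderiv_comm (contDiff_half_log hε y) hψ hc v]
  congr 2; ext x
  rw [(hasFDerivAt_radial y x (hasDerivAt_half_log hε (by positivity))).fderiv]
  simp only [smul_apply, innerSL_apply_apply, smul_eq_mul]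
  ring

/-- In dimension three `Δ log|x| = |x|⁻²` also holds weakly, without a mass at the origin: the
Laplacians of the regularisations are bounded by `5|x|⁻²`, which is locally integrable. -/
theorem integral_log_mul_laplacian {φ : R3 → ℝ} (hφ : ContDiff ℝ 2 φ) (hc : HasCompactSupport φ)
    (y : R3) : ∫ x, Real.log ‖x - y‖ * (Δ φ) x = ∫ x, (‖x - y‖ ^ 2)⁻¹ * φ x := by
  have hcont := hφ.continuous
  have T1 := tendsto_integral_half_log (continuous_laplacian hφ) (hasCompactSupport_laplacian hc) y
  refine tendsto_nhds_unique T1 ?_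
  have T2 : Tendsto (fun ε : ℝ => ∫ x, (4 * (-(1 / 2) * ((‖x - y‖ ^ 2 + ε ^ 2) ^ 2)⁻¹) *
      ‖x - y‖ ^ 2 + 6 * (1 / 2 * (‖x - y‖ ^ 2 + ε ^ 2)⁻¹)) * φ x) (𝓝[>] 0)
      (𝓝 (∫ x, (‖x - y‖ ^ 2)⁻¹ * φ x)) := by
    refine tendsto_integral_filter_of_dominated_convergence
      (fun x => 5 * |(‖y - x‖ ^ 2)⁻¹ * φ x|) ?_ ?_ ?_ ?_
    · filter_upwards [self_mem_nhdsWithin] with ε hε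
      have hε : (0 : ℝ) < ε := hε
      have c1 : Continuous fun x : R3 => (‖x - y‖ ^ 2 + ε ^ 2)⁻¹ :=
        Continuous.inv₀ (by fun_prop) fun x => by positivity
      have c2 : Continuous fun x : R3 => ((‖x - y‖ ^ 2 + ε ^ 2) ^ 2)⁻¹ :=
        Continuous.inv₀ (by fun_prop) fun x => by positivity
      refine Continuous.aestronglyMeasurable ?_
      fun_prop
    · filter_upwards [self_mem_nhdsWithin] with ε hε
      filter_upwards [ae_ne y] with x hx
      have hε : (0 : ℝ) < ε := hε
      have h0 : 0 < ‖x - y‖ := norm_pos_iff.2 (sub_ne_zero.2 hx)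
      rw [norm_sub_rev y x, Real.norm_eq_abs, abs_mul _ (φ x), abs_mul _ (φ x), ← mul_assoc 5]
      refine mul_le_mul_of_nonneg_right ?_ (abs_nonneg (φ x))
      rw [abs_of_nonneg (by positivity : 0 ≤ (‖x - y‖ ^ 2)⁻¹)]
      have i1 : (‖x - y‖ ^ 2 + ε ^ 2)⁻¹ ≤ (‖x - y‖ ^ 2)⁻¹ := by gcongr; nlinarith
      have i2 : ((‖x - y‖ ^ 2 + ε ^ 2) ^ 2)⁻¹ * ‖x - y‖ ^ 2 ≤ (‖x - y‖ ^ 2)⁻¹ := by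
        calc ((‖x - y‖ ^ 2 + ε ^ 2) ^ 2)⁻¹ * ‖x - y‖ ^ 2
            ≤ ((‖x - y‖ ^ 2) ^ 2)⁻¹ * ‖x - y‖ ^ 2 := by gcongr; nlinarith
          _ = _ := by field_simp
      have i3 : 0 ≤ (‖x - y‖ ^ 2 + ε ^ 2)⁻¹ := by positivity
      have i4 : 0 ≤ ((‖x - y‖ ^ 2 + ε ^ 2) ^ 2)⁻¹ * ‖x - y‖ ^ 2 := by positivity
      rw [abs_le]
      constructor <;> nlinarith
    · exact ((SingKernel.inv_norm_sq.integrable_mul_sub hcont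
        (hcont.integrable_of_hasCompactSupport hc) y).norm).const_mul _
    · filter_upwards [ae_ne y] with x hx
      have h0 : 0 < ‖x - y‖ := norm_pos_iff.2 (sub_ne_zero.2 hx)
      refine Tendsto.mul_const _ ?_
      have h1 : Tendsto (fun ε : ℝ => ‖x - y‖ ^ 2 + ε ^ 2) (𝓝[>] 0) (𝓝 (‖x - y‖ ^ 2)) := by
        have : Tendsto (fun ε : ℝ => ‖x - y‖ ^ 2 + ε ^ 2) (𝓝 0) (𝓝 (‖x - y‖ ^ 2 + 0 ^ 2)) :=
          Continuous.tendsto (by fun_prop) 0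
        simpa using this.mono_left nhdsWithin_le_nhds
      have h2 := h1.inv₀ (by positivity)
      have h3 := (h1.pow 2).inv₀ (by positivity)
      have h4 := (((h3.const_mul (-(1 / 2))).const_mul 4).mul_const (‖x - y‖ ^ 2)).add
        ((h2.const_mul (1 / 2)).const_mul 6)
      refine h4.trans (le_of_eq ?_)
      congr 1
      field_simp
      ring
  refine T2.congr' ?_
  filter_upwards [self_mem_nhdsWithin] with ε hε
  have hε : (0 : ℝ) < ε := hε
  rw [integral_mul_laplacian_comm (contDiff_half_log hε y) hφ hc]
  congr 1; ext x
  rw [laplacian_radial y (fun s hs => hasDerivAt_half_log hε hs)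
    (fun s hs => hasDerivAt_half_inv hε hs) (contDiff_half_log hε y)]

/-- The normalized logarithmic kernel. -/
noncomputable def logKer (x y : R3) : ℝ := Real.log (1 + ‖y‖) - Real.log ‖x - y‖

/-- The last term is a `SingKernel`. The bracket is continuous and, thanks to the normalisation by
`log(1+|y|)`, bounded in `y` for fixed `x`. Hence the potential exists before any logarithmic moment
of `m` is known. -/
theorem logKer_eq (x y : R3) : logKer x y =
    (Real.log (1 + ‖y‖) - Real.log (max ‖x - y‖ 1)) - min (Real.log ‖x - y‖) 0 := by
  have := log_norm_eq (x - y)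
  unfold logKer; linarith

theorem neg_log_le_logKer_far (x y : R3) :
    -Real.log (1 + ‖x‖) ≤ Real.log (1 + ‖y‖) - Real.log (max ‖x - y‖ 1) := by
  have hx := norm_nonneg x
  have hy := norm_nonneg y
  have h1 : max ‖x - y‖ 1 ≤ (1 + ‖x‖) * (1 + ‖y‖) := by
    refine max_le ((norm_sub_le _ _).trans ?_) ?_ <;> nlinarith [mul_nonneg hx hy]
  have h2 := Real.log_le_log (by positivity) h1
  rw [Real.log_mul (by positivity) (by positivity)] at h2
  linarith

theorem logKer_far_le (x y : R3) :
    Real.log (1 + ‖y‖) - Real.log (max ‖x - y‖ 1) ≤ Real.log (2 + ‖x‖) := by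
  have hx := norm_nonneg x
  have hy := norm_nonneg y
  have h1 : 1 + ‖y‖ ≤ (2 + ‖x‖) * max ‖x - y‖ 1 := by
    have e1 := le_max_left ‖x - y‖ 1
    have e2 := le_max_right ‖x - y‖ 1
    have e3 : ‖y‖ ≤ ‖x‖ + ‖x - y‖ := by
      have := norm_sub_le x (x - y); simpa using this
    nlinarith
  have h2 := Real.log_le_log (by positivity) h1
  rw [Real.log_mul (by positivity) (by positivity)] at h2
  linarith

theorem abs_logKer_far_le (x y : R3) :
    |Real.log (1 + ‖y‖) - Real.log (max ‖x - y‖ 1)| ≤ Real.log (2 + ‖x‖) := by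
  refine abs_le.2 ⟨?_, logKer_far_le x y⟩
  have : Real.log (1 + ‖x‖) ≤ Real.log (2 + ‖x‖) := Real.log_le_log (by positivity) (by linarith)
  linarith [neg_log_le_logKer_far x y]

theorem neg_log_le_logKer (x y : R3) : -Real.log (1 + ‖x‖) ≤ logKer x y := by
  rw [logKer_eq]
  linarith [neg_log_le_logKer_far x y, min_le_right (Real.log ‖x - y‖) 0]

theorem continuous_logKer_far :
    Continuous (fun p : R3 × R3 => Real.log (1 + ‖p.2‖) - Real.log (max ‖p.1 - p.2‖ 1)) := by
  refine Continuous.sub (Continuous.log (by fun_prop) fun p => by positivity)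
    (Continuous.log (by fun_prop) fun p => ?_)
  positivity

section LogPotential

variable {m : R3 → ℝ}

theorem integrable_logKer_far_mul (hmi : Integrable m) (x : R3) :
    Integrable (fun y => (Real.log (1 + ‖y‖) - Real.log (max ‖x - y‖ 1)) * m y) :=
  hmi.bdd_mul (c := Real.log (2 + ‖x‖))
    (continuous_logKer_far.comp (by fun_prop : Continuous fun y : R3 => (x, y))).aestronglyMeasurable
    (ae_of_all _ fun y => abs_logKer_far_le x y)

theorem integrable_logKer_mul (hm : Continuous m) (hmi : Integrable m) (x : R3) :
    Integrable (fun y => logKer x y * m y) := by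
  simp only [logKer_eq, sub_mul _ (min _ _)]
  exact (integrable_logKer_far_mul hmi x).sub (SingKernel.min_log.integrable_mul_sub hm hmi x)

theorem continuous_integral_logKer (hm : Continuous m) (hmi : Integrable m) :
    Continuous (fun x => ∫ y, logKer x y * m y) := by
  simp only [logKer_eq, sub_mul _ (min _ _)]
  have h : ∀ x, ∫ y, ((Real.log (1 + ‖y‖) - Real.log (max ‖x - y‖ 1)) * m y -
      min (Real.log ‖x - y‖) 0 * m y) = (∫ y, (Real.log (1 + ‖y‖) - Real.log (max ‖x - y‖ 1)) * m y)
      - ∫ y, min (Real.log ‖x - y‖) 0 * m y := fun x =>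
    integral_sub (integrable_logKer_far_mul hmi x) (SingKernel.min_log.integrable_mul_sub hm hmi x)
  simp only [h]
  refine Continuous.sub ?_ (SingKernel.min_log.continuous_integral hm hmi)
  rw [continuous_iff_continuousAt]
  intro x₀
  refine continuousAt_of_dominated (bound := fun y => Real.log (3 + ‖x₀‖) * ‖m y‖) ?_ ?_
    (hmi.norm.const_mul _) ?_
  · exact Eventually.of_forall fun x => (integrable_logKer_far_mul hmi x).1
  · filter_upwards [Metric.ball_mem_nhds x₀ one_pos] with x hx
    refine ae_of_all _ fun y => ?_
    rw [norm_mul]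
    refine mul_le_mul_of_nonneg_right ((abs_logKer_far_le x y).trans ?_) (norm_nonneg _)
    rw [Metric.mem_ball, dist_eq_norm] at hx
    refine Real.log_le_log (by positivity) ?_
    have := norm_add_le (x - x₀) x₀
    simp only [sub_add_cancel] at this
    linarith
  · refine ae_of_all _ fun y => ?_
    have := continuous_logKer_far.comp (by fun_prop : Continuous fun x : R3 => (x, y))
    exact (this.mul continuous_const).continuousAt

/-- This lower bound is used twice: for the growth estimate behind the Liouville argument, and to
compare `e^{3p}` with `e^{3u}`. -/
theorem neg_log_mul_le_integral_logKer (hm : Continuous m) (hmi : Integrable m)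
    (hm0 : ∀ x, 0 ≤ m x) (x : R3) :
    -(Real.log (1 + ‖x‖) * ∫ y, m y) ≤ ∫ y, logKer x y * m y := by
  rw [← integral_const_mul, ← integral_neg]
  refine integral_mono (hmi.const_mul _).neg (integrable_logKer_mul hm hmi x) fun y => ?_
  have := mul_le_mul_of_nonneg_right (neg_log_le_logKer x y) (hm0 y)
  simpa using this

/-- Test functions of mean zero, such as derivatives of compactly supported functions, do not see
the normalising term `log(1+|y|)`. -/
theorem integral_logPotential_mul (hmi : Integrable m) {w : R3 → ℝ}
    (hw : Continuous w) (hc : HasCompactSupport w) (h0 : ∫ x, w x = 0) :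
    ∫ x, (∫ y, logKer x y * m y) * w x = -∫ y, m y * ∫ x, Real.log ‖x - y‖ * w x := by
  have hwi : Integrable w := hw.integrable_of_hasCompactSupport hc
  obtain ⟨W, hW⟩ := hw.bounded_above_of_compact_support hc
  have hint : Integrable (fun p : R3 × R3 => logKer p.1 p.2 * m p.2 * w p.1)
      (volume.prod volume) := by
    have e : ∀ p : R3 × R3, logKer p.1 p.2 * m p.2 * w p.1 =
        (Real.log (1 + ‖p.2‖) - Real.log (max ‖p.1 - p.2‖ 1)) * m p.2 * w p.1 -
          (min (Real.log ‖p.1 - p.2‖) 0 * m p.2) • w p.1 := by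
      intro p; rw [logKer_eq, smul_eq_mul]; ring
    simp only [e]
    refine Integrable.sub ?_ ?_
    · have h1 : Continuous fun x : R3 => Real.log (2 + ‖x‖) * |w x| :=
        (Continuous.log (by fun_prop) fun x => by positivity).mul hw.abs
      have h2 : Integrable fun x : R3 => Real.log (2 + ‖x‖) * |w x| :=
        h1.integrable_of_hasCompactSupport (HasCompactSupport.mul_left hc.norm)
      refine (h2.mul_prod hmi.norm).mono' ?_ (ae_of_all _ fun p => ?_)
      · exact (continuous_logKer_far.aestronglyMeasurable.mul hmi.1.comp_snd).mul
          hw.aestronglyMeasurable.comp_fst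
      · simp only [norm_mul, Real.norm_eq_abs]
        have := mul_le_mul_of_nonneg_right (abs_logKer_far_le p.1 p.2)
          (mul_nonneg (abs_nonneg (m p.2)) (abs_nonneg (w p.1)))
        linarith
    · exact SingKernel.min_log.integrable_prod hwi hW hmi
  simp only [← integral_mul_const]
  rw [integral_integral_swap hint, ← integral_neg]
  congr 1; ext y
  have h2 : ∀ x, logKer x y * m y * w x =
      m y * (Real.log (1 + ‖y‖) * w x) - m y * (Real.log ‖x - y‖ * w x) := by
    intro x; rw [logKer]; ring
  simp only [h2]
  have h3 : Integrable (fun x => Real.log ‖x - y‖ * w x) := by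
    have h4 : ∀ x, Real.log ‖x - y‖ * w x = min (Real.log ‖y - x‖) 0 * w x +
        Real.log (max ‖x - y‖ 1) * w x := by
      intro x; rw [norm_sub_rev y x, ← add_mul, ← log_norm_eq]
    simp only [h4]
    refine (SingKernel.min_log.integrable_mul_sub hw hwi y).add ?_
    have h5 : Continuous fun x : R3 => Real.log (max ‖x - y‖ 1) * w x :=
      (Continuous.log (by fun_prop) fun x => by positivity).mul hw
    exact h5.integrable_of_hasCompactSupport hc.mul_left
  rw [integral_sub ((hwi.const_mul _).const_mul _) (h3.const_mul _), integral_const_mul,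
    integral_const_mul, integral_const_mul, h0]
  ring

end LogPotential

/-! ### Bump functions and the mean value property -/

namespace expNegInvGlue

theorem deriv_contDiff {n : ℕ∞} : ContDiff ℝ n (deriv expNegInvGlue) := by
  have h : ContDiff ℝ ((n : WithTop ℕ∞) + 1) expNegInvGlue := by
    have := expNegInvGlue.contDiff (n := n + 1)
    exact_mod_cast this
  exact h.deriv'

theorem hasDerivAt (t : ℝ) : HasDerivAt expNegInvGlue (deriv expNegInvGlue t) t :=
  ((expNegInvGlue.contDiff (n := 1)).differentiable (by norm_num)).differentiableAt.hasDerivAt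

theorem hasDerivAt_deriv (t : ℝ) :
    HasDerivAt (deriv expNegInvGlue) (deriv (deriv expNegInvGlue) t) t :=
  ((deriv_contDiff (n := 1)).differentiable (by norm_num)).differentiableAt.hasDerivAt

theorem deriv_of_nonpos {t : ℝ} (ht : t ≤ 0) : deriv expNegInvGlue t = 0 := by
  refine IsLocalMin.deriv_eq_zero (Eventually.of_forall fun s => ?_)
  rw [zero_of_nonpos ht]; exact expNegInvGlue.nonneg s

theorem deriv_pos {t : ℝ} (ht : 0 < t) : 0 < deriv expNegInvGlue t := by
  have h : expNegInvGlue =ᶠ[𝓝 t] fun s => Real.exp (-s⁻¹) := by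
    filter_upwards [lt_mem_nhds ht] with s hs
    simp [expNegInvGlue, not_le.2 hs]
  have h2 : HasDerivAt (fun s : ℝ => Real.exp (-s⁻¹)) (Real.exp (-t⁻¹) * (t ^ 2)⁻¹) t := by
    have := ((hasDerivAt_inv ht.ne').neg).exp
    simpa using this
  rw [h.deriv_eq, h2.deriv]
  positivity

theorem deriv_nonneg (t : ℝ) : 0 ≤ deriv expNegInvGlue t := by
  rcases le_or_gt t 0 with h | h
  · exact (deriv_of_nonpos h).ge
  · exact (deriv_pos h).le

theorem deriv_deriv_of_nonpos {t : ℝ} (ht : t ≤ 0) : deriv (deriv expNegInvGlue) t = 0 := by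
  refine IsLocalMin.deriv_eq_zero (Eventually.of_forall fun s => ?_)
  rw [deriv_of_nonpos ht]; exact deriv_nonneg s

theorem continuous_deriv : Continuous (deriv expNegInvGlue) :=
  (deriv_contDiff (n := 0)).continuous

theorem continuous_deriv_deriv : Continuous (deriv (deriv expNegInvGlue)) :=
  (deriv_contDiff (n := 1)).continuous_deriv (by norm_num)

end expNegInvGlue

/-- A smooth radial bump function, positive exactly on the unit ball. -/
noncomputable def radialBump (z : R3) : ℝ := deriv expNegInvGlue (1 - ‖z‖ ^ 2)

namespace radialBump

theorem contDiff {n : ℕ∞} : ContDiff ℝ n radialBump :=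
  expNegInvGlue.deriv_contDiff.comp (contDiff_const.sub (contDiff_id.norm_sq ℝ))

theorem continuous : Continuous radialBump := (contDiff (n := 0)).continuous

theorem nonneg (z : R3) : 0 ≤ radialBump z := expNegInvGlue.deriv_nonneg _

theorem eq_zero {z : R3} (hz : 1 ≤ ‖z‖) : radialBump z = 0 :=
  expNegInvGlue.deriv_of_nonpos (by nlinarith)

theorem pos {z : R3} (hz : ‖z‖ < 1) : 0 < radialBump z :=
  expNegInvGlue.deriv_pos (by nlinarith [norm_nonneg z])

theorem hasCompactSupport : HasCompactSupport radialBump := by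
  refine HasCompactSupport.of_support_subset_isCompact (isCompact_closedBall (0 : R3) 1) ?_
  intro z hz
  by_contra h
  rw [Metric.mem_closedBall, dist_zero_right, not_le] at h
  exact hz (eq_zero h.le)

theorem integrable : Integrable radialBump :=
  continuous.integrable_of_hasCompactSupport hasCompactSupport

theorem integral_pos : 0 < ∫ z, radialBump z :=
  continuous.integral_pos_of_hasCompactSupport_nonneg_nonzero hasCompactSupport nonneg
    (x := 0) (pos (by simp)).ne'

theorem exists_le : ∃ B, 0 ≤ B ∧ ∀ z, radialBump z ≤ B := by
  obtain ⟨B, hB⟩ := continuous.bounded_above_of_compact_support hasCompactSupport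
  exact ⟨B, (norm_nonneg _).trans (hB 0), fun z => (le_abs_self _).trans (hB z)⟩

theorem exists_ge : ∃ n₀, 0 < n₀ ∧ ∀ z : R3, ‖z‖ ≤ 1 / 2 → n₀ ≤ radialBump z := by
  obtain ⟨z₀, hz₀, hmin⟩ := (isCompact_closedBall (0 : R3) (1 / 2)).exists_isMinOn
    ⟨0, by simp⟩ continuous.continuousOn
  refine ⟨radialBump z₀, pos ?_, fun z hz => hmin (by simpa using hz)⟩
  rw [Metric.mem_closedBall, dist_zero_right] at hz₀
  linarith

end radialBump

theorem integral_mul_rescaled_eq {q : R3 → ℝ} (a : R3) {t : ℝ} (ht : 0 < t) (f : R3 → ℝ) :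
    ∫ x, q x * ((t ^ 3)⁻¹ * f (t⁻¹ • (x - a))) = ∫ z, q (a + t • z) * f z := by
  have e2 := Measure.integral_comp_smul (volume : Measure R3)
    (fun y : R3 => q (a + y) * f (t⁻¹ • y)) t
  simp only [finrank_euclideanSpace, Fintype.card_fin, smul_smul, inv_mul_cancel₀ ht.ne',
    one_smul] at e2
  rw [e2, abs_of_pos (by positivity), ← integral_smul]
  conv_lhs => rw [← integral_add_left_eq_self _ a]
  congr 1; ext x
  simp; ring

/-- A function is weakly harmonic if it is orthogonal to the Laplacians of all test functions. -/
def WeaklyHarmonic (q : R3 → ℝ) : Prop :=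
  ∀ φ : R3 → ℝ, ContDiff ℝ 2 φ → HasCompactSupport φ → ∫ x, q x * (Δ φ) x = 0

theorem laplacian_profile (a x : R3) {t : ℝ} (ht : 0 < t) :
    (Δ (fun x : R3 => expNegInvGlue (1 - ‖x - a‖ ^ 2 / t ^ 2))) x =
      4 * ((t ^ 4)⁻¹ * deriv (deriv expNegInvGlue) (1 - ‖x - a‖ ^ 2 / t ^ 2)) * ‖x - a‖ ^ 2 +
        6 * (-(t ^ 2)⁻¹ * deriv expNegInvGlue (1 - ‖x - a‖ ^ 2 / t ^ 2)) := by
  have hl : ∀ s : ℝ, HasDerivAt (fun s : ℝ => 1 - s / t ^ 2) (-(t ^ 2)⁻¹) s := by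
    intro s
    simpa using ((hasDerivAt_id s).div_const (t ^ 2)).const_sub 1
  rw [laplacian_radial (F := fun s => expNegInvGlue (1 - s / t ^ 2))
    (F' := fun s => -(t ^ 2)⁻¹ * deriv expNegInvGlue (1 - s / t ^ 2))
    (F'' := fun s => (t ^ 4)⁻¹ * deriv (deriv expNegInvGlue) (1 - s / t ^ 2))]
  · intro s _
    refine ((expNegInvGlue.hasDerivAt _).comp s (hl s)).congr_deriv ?_
    ring
  · intro s _
    refine (((expNegInvGlue.hasDerivAt_deriv _).comp s (hl s)).const_mul _).congr_deriv ?_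
    field_simp
  · refine (expNegInvGlue.contDiff (n := 2)).comp (contDiff_const.sub (ContDiff.div_const ?_ _))
    exact (contDiff_id.sub contDiff_const).norm_sq ℝ

/-- The right-hand side is `1/(2t²)` times the expression in `laplacian_profile`. Thus the change of
the rescaled bump with its scale is the Laplacian of a test function; this is why the bump is taken
to be a derivative of the profile. -/
theorem hasDerivAt_rescaled_profile (r : ℝ) {t : ℝ} (ht : 0 < t) :
    HasDerivAt (fun t : ℝ => (t ^ 3)⁻¹ * deriv expNegInvGlue (1 - r ^ 2 / t ^ 2))
      (1 / 2 * (t ^ 2)⁻¹ * (4 * ((t ^ 4)⁻¹ * deriv (deriv expNegInvGlue) (1 - r ^ 2 / t ^ 2)) *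
        r ^ 2 + 6 * (-(t ^ 2)⁻¹ * deriv expNegInvGlue (1 - r ^ 2 / t ^ 2)))) t := by
  have h1 : HasDerivAt (fun t : ℝ => 1 - r ^ 2 / t ^ 2) (2 * r ^ 2 / t ^ 3) t := by
    have := (((hasDerivAt_const t (r ^ 2)).div (hasDerivAt_pow 2 t) (by positivity)).const_sub 1)
    refine this.congr_deriv ?_
    field_simp
    ring
  have h2 : HasDerivAt (fun t : ℝ => (t ^ 3)⁻¹) (-3 / t ^ 4) t := by
    have := (hasDerivAt_pow 3 t).inv (by positivity)
    refine this.congr_deriv ?_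
    field_simp
    push_cast
    ring
  refine (h2.mul ((expNegInvGlue.hasDerivAt_deriv _).comp t h1)).congr_deriv ?_
  simp only [Function.comp]
  field_simp
  ring

/-- The mean value property of weakly harmonic functions. -/
theorem WeaklyHarmonic.mean_value {q : R3 → ℝ} (hq : Continuous q) (hh : WeaklyHarmonic q)
    (a : R3) {t : ℝ} (ht : 0 < t) :
    ∫ x, q x * ((t ^ 3)⁻¹ * radialBump (t⁻¹ • (x - a))) = q a * ∫ z, radialBump z := by
  set J : ℝ → ℝ := fun t => ∫ x, q x * ((t ^ 3)⁻¹ * deriv expNegInvGlue (1 - ‖x - a‖ ^ 2 / t ^ 2))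
    with hJ
  have hJ' : ∀ t, 0 < t → J t = ∫ x, q x * ((t ^ 3)⁻¹ * radialBump (t⁻¹ • (x - a))) := by
    intro t ht
    rw [hJ]; simp only
    congr 1; ext x
    rw [radialBump, norm_smul, Real.norm_of_nonneg (by positivity)]
    congr 4
    field_simp
  have hE := expNegInvGlue.continuous_deriv
  have hE2 := expNegInvGlue.continuous_deriv_deriv
  have hzero : ∀ (s : ℝ), 0 < s → ∀ x : R3, s ≤ ‖x - a‖ → 1 - ‖x - a‖ ^ 2 / s ^ 2 ≤ 0 := by
    intro s hs x hx
    have : 1 ≤ ‖x - a‖ ^ 2 / s ^ 2 := by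
      rw [le_div_iff₀ (by positivity), one_mul]; gcongr
    linarith
  set F' : ℝ → R3 → ℝ := fun t x => q x * (1 / 2 * (t ^ 2)⁻¹ *
    (4 * ((t ^ 4)⁻¹ * deriv (deriv expNegInvGlue) (1 - ‖x - a‖ ^ 2 / t ^ 2)) *
        ‖x - a‖ ^ 2 + 6 * (-(t ^ 2)⁻¹ * deriv expNegInvGlue (1 - ‖x - a‖ ^ 2 / t ^ 2)))) with hF'
  -- Differentiation under the integral gives `q` paired with the Laplacian of the profile, which
  -- vanishes by weak harmonicity.
  have hderiv : ∀ t, 0 < t → HasDerivAt J 0 t := by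
    intro t ht
    have hcontx : ∀ s : ℝ, 0 < s → Continuous fun x : R3 =>
        q x * ((s ^ 3)⁻¹ * deriv expNegInvGlue (1 - ‖x - a‖ ^ 2 / s ^ 2)) := by
      intro s hs; fun_prop
    have hF'int : ∫ x, F' t x = 0 := by
      have h1 := hh (fun x : R3 => expNegInvGlue (1 - ‖x - a‖ ^ 2 / t ^ 2)) ?_ ?_
      · have h2 : ∀ x, F' t x = (1 / 2 * (t ^ 2)⁻¹) * (q x *
            (Δ (fun x : R3 => expNegInvGlue (1 - ‖x - a‖ ^ 2 / t ^ 2))) x) := by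
          intro x; rw [laplacian_profile a x ht, hF']; ring
        simp only [h2]
        rw [integral_const_mul, h1, mul_zero]
      · refine (expNegInvGlue.contDiff (n := 2)).comp
          (contDiff_const.sub (ContDiff.div_const ?_ _))
        exact (contDiff_id.sub contDiff_const).norm_sq ℝ
      · refine HasCompactSupport.of_support_subset_isCompact (isCompact_closedBall a t) ?_
        intro x hx
        by_contra h
        rw [Metric.mem_closedBall, dist_eq_norm, not_le] at h
        exact hx (expNegInvGlue.zero_of_nonpos (hzero t ht x h.le))
    rw [← hF'int]
    have hcomp : IsCompact (Icc (t / 2) (2 * t) ×ˢ Metric.closedBall a (2 * t)) :=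
      isCompact_Icc.prod (isCompact_closedBall a (2 * t))
    obtain ⟨C, hC⟩ := hcomp.exists_bound_of_continuousOn (f := fun p : ℝ × R3 => F' p.1 p.2) (by
      have hne : ∀ p ∈ Icc (t / 2) (2 * t) ×ˢ Metric.closedBall a (2 * t), p.1 ≠ 0 := by
        rintro p ⟨hp, -⟩
        have := hp.1
        exact (by linarith : 0 < p.1).ne'
      have hc2 : ContinuousOn (fun p : ℝ × R3 => (p.1 ^ 2)⁻¹)
          (Icc (t / 2) (2 * t) ×ˢ Metric.closedBall a (2 * t)) :=
        ContinuousOn.inv₀ (by fun_prop) fun p hp => pow_ne_zero _ (hne p hp)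
      have hc4 : ContinuousOn (fun p : ℝ × R3 => (p.1 ^ 4)⁻¹)
          (Icc (t / 2) (2 * t) ×ˢ Metric.closedBall a (2 * t)) :=
        ContinuousOn.inv₀ (by fun_prop) fun p hp => pow_ne_zero _ (hne p hp)
      have hc1 : ContinuousOn (fun p : ℝ × R3 => 1 - ‖p.2 - a‖ ^ 2 / p.1 ^ 2)
          (Icc (t / 2) (2 * t) ×ˢ Metric.closedBall a (2 * t)) := by
        simp only [div_eq_mul_inv]; fun_prop
      have hd1 := hE.comp_continuousOn hc1
      have hd2 := hE2.comp_continuousOn hc1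
      simp only [Function.comp_def] at hd1 hd2
      rw [hF']
      fun_prop)
    refine (hasDerivAt_integral_of_dominated_loc_of_deriv_le (s := Ioo (t / 2) (2 * t))
      (bound := (Metric.closedBall a (2 * t)).indicator fun _ => C)
      (Ioo_mem_nhds (by linarith) (by linarith)) ?_ ?_ ?_ ?_ ?_ ?_).2
    · filter_upwards [lt_mem_nhds ht] with s hs using (hcontx s hs).aestronglyMeasurable
    · refine (hcontx t ht).integrable_of_hasCompactSupport ?_
      refine HasCompactSupport.of_support_subset_isCompact (isCompact_closedBall a t) ?_
      intro x hx
      by_contra h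
      rw [Metric.mem_closedBall, dist_eq_norm, not_le] at h
      refine hx ?_
      simp only
      rw [expNegInvGlue.deriv_of_nonpos (hzero t ht x h.le)]
      simp
    · refine Continuous.aestronglyMeasurable ?_
      rw [hF']; fun_prop
    · refine ae_of_all _ fun x s hs => ?_
      have hs0 : 0 < s := by linarith [hs.1]
      by_cases hx : x ∈ Metric.closedBall a (2 * t)
      · rw [indicator_of_mem hx]
        exact hC (s, x) ⟨⟨hs.1.le, hs.2.le⟩, hx⟩
      · rw [indicator_of_notMem hx]
        rw [Metric.mem_closedBall, dist_eq_norm, not_le] at hx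
        have h3 := hzero s hs0 x (by linarith [hs.2])
        simp [hF', expNegInvGlue.deriv_of_nonpos h3, expNegInvGlue.deriv_deriv_of_nonpos h3]
    · rw [integrable_indicator_iff Metric.isClosed_closedBall.measurableSet]
      exact (continuous_const.continuousOn).integrableOn_compact (isCompact_closedBall a (2 * t))
    · refine ae_of_all _ fun x s hs => ?_
      have hs0 : 0 < s := by linarith [hs.1]
      exact (hasDerivAt_rescaled_profile ‖x - a‖ hs0).const_mul (q x)
  have hconst : ∀ s, 0 < s → J s = J t := by
    intro s hs
    refine isOpen_Ioi.is_const_of_deriv_eq_zero (s := Ioi (0 : ℝ)) isPreconnected_Ioi ?_ ?_ hs ht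
    · intro r hr; exact (hderiv r hr).differentiableAt.differentiableWithinAt
    · intro r hr; exact (hderiv r hr).deriv
  rw [← hJ' t ht]
  -- The bump concentrates at `a` as the scale tends to zero, which identifies the constant value of
  -- `J`.
  have hlim : Tendsto J (𝓝[>] 0) (𝓝 (∫ z, q a * radialBump z)) := by
    obtain ⟨C, hC⟩ := (isCompact_closedBall a 1).exists_bound_of_continuousOn hq.continuousOn
    have h1 : Tendsto (fun s : ℝ => ∫ z, q (a + s • z) * radialBump z) (𝓝[>] 0)
        (𝓝 (∫ z, q a * radialBump z)) := by
      refine tendsto_integral_filter_of_dominated_convergence (fun z => C * radialBump z) ?_ ?_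
        (radialBump.integrable.const_mul C) ?_
      · have := radialBump.continuous
        exact Eventually.of_forall fun s => Continuous.aestronglyMeasurable (by fun_prop)
      · filter_upwards [Ioc_mem_nhdsGT one_pos] with s hs
        refine ae_of_all _ fun z => ?_
        rw [norm_mul, Real.norm_of_nonneg (radialBump.nonneg z)]
        rcases le_or_gt 1 ‖z‖ with hz | hz
        · simp [radialBump.eq_zero hz]
        · refine mul_le_mul_of_nonneg_right (hC _ ?_) (radialBump.nonneg z)
          simp only [Metric.mem_closedBall, dist_eq_norm, add_sub_cancel_left, norm_smul,
            Real.norm_of_nonneg hs.1.le]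
          nlinarith [hs.1, hs.2, norm_nonneg z]
      · refine ae_of_all _ fun z => Tendsto.mul_const _ ?_
        have : Tendsto (fun s : ℝ => q (a + s • z)) (𝓝 0) (𝓝 (q (a + (0 : ℝ) • z))) :=
          Continuous.tendsto (by fun_prop) 0
        simpa using this.mono_left nhdsWithin_le_nhds
    refine h1.congr' ?_
    filter_upwards [self_mem_nhdsWithin] with s hs
    rw [hJ' s hs, integral_mul_rescaled_eq a hs]
  rw [← integral_const_mul]
  refine tendsto_nhds_unique (tendsto_const_nhds.congr' ?_) hlim
  filter_upwards [self_mem_nhdsWithin] with s hs using (hconst s hs).symm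

/-! ### Functions with vanishing third differences -/

/-- The third order difference of `f` at `x`. -/
def thirdDiff {F : Type*} [AddCommGroup F] (f : R3 → F) (x h₁ h₂ h₃ : R3) : F :=
  (f (x + h₁ + h₂ + h₃) - f (x + h₁ + h₂) - (f (x + h₁ + h₃) - f (x + h₁))) -
    ((f (x + h₂ + h₃) - f (x + h₂)) - (f (x + h₃) - f x))

theorem norm_diff_le {F : Type*} [NormedAddCommGroup F] [NormedSpace ℝ F] {f : R3 → F}
    (hf : ContDiff ℝ 1 f) {C : ℝ} (hC : ∀ z, ‖fderiv ℝ f z‖ ≤ C) (x h : R3) :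
    ‖f (x + h) - f x‖ ≤ C * ‖h‖ := by
  have := convex_univ.norm_image_sub_le_of_norm_fderiv_le (f := f)
    (fun z _ => (hf.differentiable one_ne_zero).differentiableAt) (fun z _ => hC z)
    (mem_univ x) (mem_univ (x + h))
  simpa using this

theorem contDiff_diff {F : Type*} [NormedAddCommGroup F] [NormedSpace ℝ F] {f : R3 → F}
    {n : WithTop ℕ∞} (hf : ContDiff ℝ n f) (h : R3) : ContDiff ℝ n (fun x => f (x + h) - f x) :=
  (hf.comp (contDiff_id.add contDiff_const)).sub hf

theorem fderiv_diff {F : Type*} [NormedAddCommGroup F] [NormedSpace ℝ F] {f : R3 → F}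
    (hf : ContDiff ℝ 1 f) (h x : R3) :
    fderiv ℝ (fun x => f (x + h) - f x) x = fderiv ℝ f (x + h) - fderiv ℝ f x := by
  have hd := hf.differentiable one_ne_zero
  rw [fderiv_fun_sub _ hd.differentiableAt, fderiv_comp_add_right]
  exact hd.differentiableAt.comp x (by fun_prop)

/-- The mean value inequality is applied once for each increment, to `f` and its first two
derivatives. -/
theorem exists_thirdDiff_le {f : R3 → ℝ} (hf : ContDiff ℝ 3 f) (hc : HasCompactSupport f) :
    ∃ D, 0 ≤ D ∧ ∀ x h₁ h₂ h₃, |thirdDiff f x h₁ h₂ h₃| ≤ D * ‖h₁‖ * ‖h₂‖ * ‖h₃‖ := by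
  have h2 : ContDiff ℝ 2 (fderiv ℝ f) := hf.fderiv_right (by norm_num)
  have h1 : ContDiff ℝ 1 (fderiv ℝ (fderiv ℝ f)) := h2.fderiv_right (by norm_num)
  obtain ⟨D, hD⟩ := (h1.continuous_fderiv one_ne_zero).bounded_above_of_compact_support
    (((hc.fderiv (𝕜 := ℝ)).fderiv (𝕜 := ℝ)).fderiv (𝕜 := ℝ))
  refine ⟨D, (norm_nonneg _).trans (hD 0), fun x h₁ h₂ h₃ => ?_⟩
  have f1 : ContDiff ℝ 1 f := hf.of_le (by norm_num)
  have f2 : ContDiff ℝ 1 (fderiv ℝ f) := h2.of_le (by norm_num)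
  have e1 : ∀ z, ‖fderiv ℝ (fderiv ℝ f) (z + h₃) - fderiv ℝ (fderiv ℝ f) z‖ ≤ D * ‖h₃‖ :=
    fun z => norm_diff_le h1 hD z h₃
  have e2 : ∀ z, ‖(fderiv ℝ f (z + h₂ + h₃) - fderiv ℝ f (z + h₂)) -
      (fderiv ℝ f (z + h₃) - fderiv ℝ f z)‖ ≤ D * ‖h₃‖ * ‖h₂‖ := by
    intro z
    refine norm_diff_le (f := fun z => fderiv ℝ f (z + h₃) - fderiv ℝ f z)
      (contDiff_diff f2 h₃) (fun w => ?_) z h₂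
    rw [fderiv_diff f2]; exact e1 w
  have e3 := norm_diff_le (f := fun z => (f (z + h₂ + h₃) - f (z + h₂)) - (f (z + h₃) - f z))
    (C := D * ‖h₃‖ * ‖h₂‖)
    (contDiff_diff (f := fun z => f (z + h₃) - f z) (contDiff_diff f1 h₃) h₂) (fun w => ?_) x h₁
  · rw [Real.norm_eq_abs] at e3
    rw [thirdDiff]
    calc _ ≤ _ := e3
      _ = _ := by ring
  · rw [fderiv_diff (f := fun z => f (z + h₃) - f z) (contDiff_diff f1 h₃), fderiv_diff f1,
      fderiv_diff f1]
    exact e2 w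

/-- A weakly harmonic function whose positive part grows at most quadratically in the mean has
vanishing third differences. -/
theorem WeaklyHarmonic.thirdDiff_eq_zero {q : R3 → ℝ} (hq : Continuous q) (hh : WeaklyHarmonic q)
    {A : ℝ} (hA : ∀ t, 1 ≤ t → ∫ x, max (q x) 0 * ((t ^ 3)⁻¹ * radialBump (t⁻¹ • x)) ≤ A * t ^ 2)
    (h₁ h₂ h₃ : R3) : thirdDiff q 0 h₁ h₂ h₃ = 0 := by
  set κ := ∫ z, radialBump z with hκ
  have hκ0 : 0 < κ := radialBump.integral_pos
  have hbc := radialBump.continuous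
  have hbump : ∀ (f : R3 → ℝ), Continuous f → ∀ (a : R3) {t : ℝ}, 0 < t →
      Integrable (fun x => f x * ((t ^ 3)⁻¹ * radialBump (t⁻¹ • (x - a)))) := by
    intro f hf a t ht
    refine (by fun_prop : Continuous fun x => f x * ((t ^ 3)⁻¹ * radialBump (t⁻¹ • (x - a)))
      ).integrable_of_hasCompactSupport ?_
    refine HasCompactSupport.of_support_subset_isCompact (isCompact_closedBall a t) ?_
    intro x hx
    by_contra h
    rw [Metric.mem_closedBall, dist_eq_norm, not_le] at h
    refine hx ?_
    simp only
    rw [radialBump.eq_zero, mul_zero, mul_zero]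
    rw [norm_smul, Real.norm_of_nonneg (by positivity), le_inv_mul_iff₀ ht, mul_one]
    exact h.le
  obtain ⟨D, hD0, hD⟩ := exists_thirdDiff_le (radialBump.contDiff (n := 3))
    radialBump.hasCompactSupport
  obtain ⟨n₀, hn0, hn⟩ := radialBump.exists_ge
  -- Since `|q| = 2 q⁺ - q` and the mean of `q` is known exactly by the mean value property, the
  -- one-sided growth bound controls `|q|`.
  set A' := 2 * |A| + κ * |q 0| with hA'
  have habs : ∀ t, 1 ≤ t → ∫ x, |q x| * ((t ^ 3)⁻¹ * radialBump (t⁻¹ • (x - 0))) ≤ A' * t ^ 2 := by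
    intro t ht
    have ht0 : 0 < t := by linarith
    have e : ∀ x, |q x| * ((t ^ 3)⁻¹ * radialBump (t⁻¹ • (x - 0))) =
        2 * (max (q x) 0 * ((t ^ 3)⁻¹ * radialBump (t⁻¹ • (x - 0)))) -
          q x * ((t ^ 3)⁻¹ * radialBump (t⁻¹ • (x - 0))) := by
      intro x
      rcases le_total 0 (q x) with h | h
      · rw [abs_of_nonneg h, max_eq_left h]; ring
      · rw [abs_of_nonpos h, max_eq_right h]; ring
    simp only [e]
    rw [integral_sub ((hbump _ (by fun_prop) 0 ht0).const_mul 2) (hbump q hq 0 ht0),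
      integral_const_mul, hh.mean_value hq 0 ht0]
    have h1 := hA t ht
    simp only [sub_zero]
    have h2 : A * t ^ 2 ≤ |A| * t ^ 2 := by gcongr; exact le_abs_self A
    have h3 : -(q 0 * κ) ≤ κ * |q 0| := by nlinarith [neg_abs_le (q 0)]
    have h4 : κ * |q 0| ≤ κ * |q 0| * t ^ 2 := le_mul_of_one_le_right (by positivity)
      (one_le_pow₀ ht)
    rw [hA', add_mul]; linarith
  set H := ‖h₁‖ * ‖h₂‖ * ‖h₃‖ with hH
  -- The mean value property moves the third difference onto the bump. There it gains `t⁻³`, while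
  -- the mean of `|q|` grows only like `t²`.
  have main : ∀ t, 1 ≤ t → ‖h₁‖ + ‖h₂‖ + ‖h₃‖ ≤ t →
      |κ * thirdDiff q 0 h₁ h₂ h₃| ≤ (1024 * D * H / n₀ * A') / t := by
    intro t ht hht
    have ht0 : 0 < t := by linarith
    have e : κ * thirdDiff q 0 h₁ h₂ h₃ = ∫ x, q x * ((t ^ 3)⁻¹ *
        thirdDiff radialBump (t⁻¹ • x) (-(t⁻¹ • h₁)) (-(t⁻¹ • h₂)) (-(t⁻¹ • h₃))) := by
      obtain ⟨g, hg⟩ : ∃ g : R3 → R3 → ℝ, ∀ a x,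
        g a x = q x * ((t ^ 3)⁻¹ * radialBump (t⁻¹ • (x - a))) := ⟨_, fun _ _ => rfl⟩
      have mv : ∀ a, κ * q a = ∫ x, g a x := by
        intro a; simp only [hg]; rw [hh.mean_value hq a ht0, mul_comm]
      have hb : ∀ a, Integrable (fun x => g a x) := by
        intro a; simp only [hg]; exact hbump q hq a ht0
      have hb2 : ∀ a b, Integrable (fun x => g a x - g b x) := fun a b => (hb a).sub (hb b)
      have hb4 : ∀ a b c d, Integrable (fun x => g a x - g b x - (g c x - g d x)) :=
        fun a b c d => (hb2 a b).sub (hb2 c d)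
      have hx : ∀ x, q x * ((t ^ 3)⁻¹ *
          thirdDiff radialBump (t⁻¹ • x) (-(t⁻¹ • h₁)) (-(t⁻¹ • h₂)) (-(t⁻¹ • h₃))) =
          (g (h₁ + h₂ + h₃) x - g (h₁ + h₂) x - (g (h₁ + h₃) x - g h₁ x)) -
            ((g (h₂ + h₃) x - g h₂ x) - (g h₃ x - g 0 x)) := by
        intro x
        simp only [hg, thirdDiff, smul_sub, sub_zero, ← sub_eq_add_neg,
          ← sub_sub]
        ring
      simp only [hx]
      rw [integral_sub (hb4 _ _ _ _) (hb4 _ _ _ _), integral_sub (hb2 _ _) (hb2 _ _),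
        integral_sub (hb2 _ _) (hb2 _ _), integral_sub (hb _) (hb _), integral_sub (hb _) (hb _),
        integral_sub (hb _) (hb _), integral_sub (hb _) (hb _)]
      simp only [thirdDiff, mul_sub, mv, zero_add]
    rw [e]
    -- All eight translated bumps vanish outside the ball of radius `2t`. On that ball the bump of
    -- scale `4t` is at least `n₀`; the factor 64 is `4³`.
    have hpt : ∀ x, ‖q x * ((t ^ 3)⁻¹ *
        thirdDiff radialBump (t⁻¹ • x) (-(t⁻¹ • h₁)) (-(t⁻¹ • h₂)) (-(t⁻¹ • h₃)))‖ ≤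
        64 * D * H / (n₀ * t ^ 3) *
          (|q x| * (((4 * t) ^ 3)⁻¹ * radialBump ((4 * t)⁻¹ • (x - 0)))) := by
      intro x
      rw [norm_mul, norm_mul, Real.norm_of_nonneg (by positivity : 0 ≤ (t ^ 3)⁻¹),
        Real.norm_eq_abs, Real.norm_eq_abs, sub_zero]
      rcases le_or_gt ‖x‖ (2 * t) with hx | hx
      · have h1 := hD (t⁻¹ • x) (-(t⁻¹ • h₁)) (-(t⁻¹ • h₂)) (-(t⁻¹ • h₃))
        simp only [norm_neg, norm_smul, Real.norm_of_nonneg (by positivity : 0 ≤ t⁻¹)] at h1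
        have h2 : n₀ ≤ radialBump ((4 * t)⁻¹ • x) := by
          refine hn _ ?_
          rw [norm_smul, Real.norm_of_nonneg (by positivity), inv_mul_le_iff₀ (by positivity)]
          linarith
        calc |q x| * ((t ^ 3)⁻¹ *
              |thirdDiff radialBump (t⁻¹ • x) (-(t⁻¹ • h₁)) (-(t⁻¹ • h₂)) (-(t⁻¹ • h₃))|)
            ≤ |q x| * ((t ^ 3)⁻¹ * (D * (t⁻¹ * ‖h₁‖) * (t⁻¹ * ‖h₂‖) * (t⁻¹ * ‖h₃‖))) := by
              gcongr
          _ = 64 * D * H / (n₀ * t ^ 3) * (|q x| * (((4 * t) ^ 3)⁻¹ * n₀)) := by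
              rw [hH]; field_simp; norm_num
          _ ≤ _ := by gcongr
      · have hz : ∀ a : R3, ‖a‖ ≤ t → radialBump (t⁻¹ • (x - a)) = 0 := by
          intro a ha
          refine radialBump.eq_zero ?_
          rw [norm_smul, Real.norm_of_nonneg (by positivity), le_inv_mul_iff₀ ht0, mul_one]
          have := norm_sub_norm_le x a
          linarith
        have n1 := norm_nonneg h₁
        have n2 := norm_nonneg h₂
        have n3 := norm_nonneg h₃
        have m12 := norm_add_le h₁ h₂
        have m13 := norm_add_le h₁ h₃
        have m23 := norm_add_le h₂ h₃
        have m123 := norm_add_le (h₁ + h₂) h₃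
        have hx0 : thirdDiff radialBump (t⁻¹ • x) (-(t⁻¹ • h₁)) (-(t⁻¹ • h₂)) (-(t⁻¹ • h₃)) = 0 := by
          have z1 := hz (h₁ + h₂ + h₃) (by linarith)
          have z2 := hz (h₁ + h₂) (by linarith)
          have z3 := hz (h₁ + h₃) (by linarith)
          have z4 := hz (h₂ + h₃) (by linarith)
          have z5 := hz h₁ (by linarith)
          have z6 := hz h₂ (by linarith)
          have z7 := hz h₃ (by linarith)
          have z8 := hz 0 (by simp; linarith)
          simp only [smul_sub, sub_zero, ← sub_sub] at z1 z2 z3 z4 z5 z6 z7 z8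
          simp only [thirdDiff, ← sub_eq_add_neg, z1, z2, z3, z4, z5, z6, z7, z8, sub_zero]
        rw [hx0, abs_zero, mul_zero, mul_zero]
        have := radialBump.nonneg ((4 * t)⁻¹ • x)
        positivity
    have hI := (hbump (fun x => |q x|) (by fun_prop) 0 (t := 4 * t) (by positivity)).const_mul
      (64 * D * H / (n₀ * t ^ 3))
    have h5 := norm_integral_le_of_norm_le hI (ae_of_all _ hpt)
    rw [Real.norm_eq_abs] at h5
    refine h5.trans ?_
    rw [integral_const_mul]
    calc 64 * D * H / (n₀ * t ^ 3) * _ ≤ 64 * D * H / (n₀ * t ^ 3) * (A' * (4 * t) ^ 2) := by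
          gcongr
          exact habs (4 * t) (by linarith)
      _ = (1024 * D * H / n₀ * A') / t := by field_simp; ring
  have hlim : Tendsto (fun t : ℝ => (1024 * D * H / n₀ * A') / t) atTop (𝓝 0) :=
    tendsto_const_nhds.div_atTop tendsto_id
  have h6 : |κ * thirdDiff q 0 h₁ h₂ h₃| ≤ 0 := by
    refine ge_of_tendsto hlim ?_
    filter_upwards [eventually_ge_atTop 1, eventually_ge_atTop (‖h₁‖ + ‖h₂‖ + ‖h₃‖)] with t h1 h2
      using main t h1 h2
  have h7 := abs_eq_zero.1 (le_antisymm h6 (abs_nonneg _))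
  exact (mul_eq_zero.1 h7).resolve_left hκ0.ne'

/-- A continuous function with vanishing third differences is a quadratic polynomial. -/
theorem exists_quadratic_of_thirdDiff {p : R3 → ℝ} (hp : Continuous p)
    (h : ∀ h₁ h₂ h₃, thirdDiff p 0 h₁ h₂ h₃ = 0) :
    ∃ (c : ℝ) (b : R3) (H : R3 →ₗ[ℝ] R3), H.IsSymmetric ∧
      ∀ x, p x = c + inner ℝ b x + 1 / 2 * inner ℝ (H x) x := by
  -- The second difference is the candidate for the Hessian. Vanishing third differences make it
  -- additive, and continuity makes it linear.
  set B : R3 → R3 → ℝ := fun x y => p (x + y) - p x - p y + p 0 with hB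
  have hBsymm : ∀ x y, B x y = B y x := by intro x y; simp only [hB, add_comm x y]; ring
  have hBadd : ∀ x y z, B (x + y) z = B x z + B y z := by
    intro x y z
    have := h x y z
    simp only [thirdDiff, zero_add] at this
    simp only [hB]; linarith
  have hBc : ∀ y, Continuous fun x => B x y := by intro y; simp only [hB]; fun_prop
  let Bl : R3 → R3 →L[ℝ] ℝ := fun y =>
    (AddMonoidHom.mk' (fun x => B x y) (fun a b => hBadd a b y)).toRealLinearMap (hBc y)
  have hBl : ∀ x y, Bl y x = B x y := fun x y => rfl
  let H : R3 →ₗ[ℝ] R3 :=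
    { toFun := fun y => (InnerProductSpace.toDual ℝ R3).symm (Bl y)
      map_add' := by
        intro y z
        rw [← map_add]; congr 1
        ext x
        rw [add_apply, hBl, hBl, hBl, hBsymm x, hBadd, hBsymm y, hBsymm z]
      map_smul' := by
        intro r y
        have : Bl (r • y) = r • Bl y := by
          ext x
          rw [smul_apply, hBl, hBl, hBsymm, hBsymm x, ← hBl, ← hBl, map_smul]
        rw [this]; simp }
  have hH : ∀ x y, inner ℝ (H y) x = B x y := by
    intro x y
    rw [← hBl]
    exact InnerProductSpace.toDual_symm_apply
  -- What remains after removing the quadratic part is additive and continuous, hence linear.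
  set L : R3 → ℝ := fun x => p x - p 0 - 1 / 2 * B x x with hL
  have hLadd : ∀ x y, L (x + y) = L x + L y := by
    intro x y
    have h1 : B (x + y) (x + y) = B x x + 2 * B x y + B y y := by
      rw [hBadd, hBsymm x, hBsymm y, hBadd, hBadd, hBsymm y x]; ring
    have h2 : B x y = p (x + y) - p x - p y + p 0 := rfl
    simp only [hL, h1]; linarith
  have hLc : Continuous L := by simp only [hL, hB]; fun_prop
  let Ll : R3 →L[ℝ] ℝ := (AddMonoidHom.mk' L hLadd).toRealLinearMap hLc
  refine ⟨p 0, (InnerProductSpace.toDual ℝ R3).symm Ll, H, ?_, fun x => ?_⟩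
  · intro x y
    rw [hH, real_inner_comm, hH, hBsymm]
  · rw [hH, InnerProductSpace.toDual_symm_apply]
    change p x = p 0 + L x + 1 / 2 * B x x
    simp only [hL]; ring

/-! ### Splitting `u` into potential and polynomial -/

/-- A smooth function with integrable `m`, whose Laplacian is the negative Riesz potential of `m` up
to a constant, is the logarithmic potential of `m` up to a quadratic polynomial. -/
theorem exists_eq_logPotential_add_quadratic {u m : R3 → ℝ} (hu : ContDiff ℝ 2 u)
    (hm : Continuous m) (hmi : Integrable m) (hm0 : ∀ x, 0 ≤ m x) (hum : ∀ x, u x ≤ m x) {C : ℝ}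
    (hΔ : ∀ x, -(Δ u) x = (Real.pi ^ 2)⁻¹ * (∫ y, (‖x - y‖ ^ 2)⁻¹ * m y) + C) :
    ∃ (c : ℝ) (b : R3) (H : R3 →ₗ[ℝ] R3), H.IsSymmetric ∧
      ∀ x, u x = (Real.pi ^ 2)⁻¹ * (∫ y, logKer x y * m y) +
        (c + inner ℝ b x + 1 / 2 * inner ℝ (H x) x) := by
  set v : R3 → ℝ := fun x => (Real.pi ^ 2)⁻¹ * (∫ y, logKer x y * m y) with hv
  have hvc : Continuous v := continuous_const.mul (continuous_integral_logKer hm hmi)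
  have huc := hu.continuous
  -- The correction compensates the constant `C`, because `Δ|x|² = 6`.
  set q : R3 → ℝ := fun x => u x - v x + C / 6 * ‖x‖ ^ 2 with hq
  have hqc : Continuous q := by fun_prop
  have hharm : WeaklyHarmonic q := by
    intro φ hφ hc
    have hΔc := continuous_laplacian hφ
    have hΔs := hasCompactSupport_laplacian hc
    have hint : ∀ f : R3 → ℝ, Continuous f → Integrable fun x => f x * (Δ φ) x := fun f hf =>
      (hf.mul hΔc).integrable_of_hasCompactSupport hΔs.mul_left
    have hφi : Integrable φ := hφ.continuous.integrable_of_hasCompactSupport hc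
    have e : ∀ x, q x * (Δ φ) x = u x * (Δ φ) x - v x * (Δ φ) x +
        C / 6 * (‖x‖ ^ 2 * (Δ φ) x) := by intro x; simp only [hq]; ring
    have i3 : ∫ x, ‖x‖ ^ 2 * (Δ φ) x = 6 * ∫ x, φ x := by
      have hsq : ContDiff ℝ 2 (fun x : R3 => ‖x‖ ^ 2) := contDiff_id.norm_sq ℝ
      rw [integral_mul_laplacian_comm hsq hφ hc, ← integral_const_mul]
      congr 1; ext x
      have := laplacian_radial (F := fun s => s) (F' := fun _ => 1) (F'' := fun _ => 0) 0
        (fun s _ => hasDerivAt_id s) (fun s _ => hasDerivAt_const s 1) (by simpa using hsq) x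
      simp only [sub_zero] at this
      rw [this]; ring
    have i0 : ∫ x, (Δ φ) x = 0 := by
      have h1 := integral_mul_laplacian_comm (f := fun _ => 1) contDiff_const hφ hc
      have h2 : (Δ (fun _ : R3 => (1 : ℝ))) = 0 := InnerProductSpace.laplacian_const
      rw [h2] at h1
      simpa using h1
    have i2 : ∫ x, v x * (Δ φ) x =
        -∫ x, (Real.pi ^ 2)⁻¹ * (∫ y, (‖x - y‖ ^ 2)⁻¹ * m y) * φ x := by
      simp only [hv, mul_assoc]
      rw [integral_const_mul, integral_const_mul,
        integral_logPotential_mul hmi hΔc hΔs i0]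
      obtain ⟨W, hW⟩ := hφ.continuous.bounded_above_of_compact_support hc
      have := SingKernel.inv_norm_sq.integral_integral_swap_smul hφi hW hmi
      simp only [smul_eq_mul] at this
      rw [this]
      simp only [integral_log_mul_laplacian hφ hc]
      ring
    have i1 := integral_mul_laplacian_comm hu hφ hc
    simp only [e]
    have huv : Integrable fun x => u x * (Δ φ) x - v x * (Δ φ) x :=
      (hint u huc).sub (hint v hvc)
    rw [integral_add huv ((hint (fun x => ‖x‖ ^ 2) (by fun_prop)).const_mul _),
      integral_sub (hint u huc) (hint v hvc), integral_const_mul, i1, i2, i3]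
    have e2 : ∀ x, (Real.pi ^ 2)⁻¹ * (∫ y, (‖x - y‖ ^ 2)⁻¹ * m y) * φ x =
        -((Δ u) x * φ x) - C * φ x := by
      intro x
      have := hΔ x
      rw [eq_sub_of_add_eq this.symm]; ring
    have hui : Integrable fun x => (Δ u) x * φ x :=
      ((continuous_laplacian hu).mul hφ.continuous).integrable_of_hasCompactSupport hc.mul_left
    have huin : Integrable fun x => -((Δ u) x * φ x) := hui.neg
    simp only [e2]
    rw [integral_sub huin (hφi.const_mul C), integral_neg, integral_const_mul]
    ring
  obtain ⟨B, hB0, hB⟩ := radialBump.exists_le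
  set κ := ∫ z, radialBump z with hκ
  have hκ0 : 0 < κ := radialBump.integral_pos
  set V := ∫ y, m y with hV
  have hV0 : 0 ≤ V := integral_nonneg hm0
  -- On the ball of radius `t` the summand `u` is bounded by the integrable `m`, the potential costs
  -- at most `V log(1+|x|) ≤ V t²`, and the correction at most `|C| t²`.
  have hgrow : ∀ t, 1 ≤ t → ∫ x, max (q x) 0 * ((t ^ 3)⁻¹ * radialBump (t⁻¹ • x)) ≤
      (V * B + (V + |C|) * κ) * t ^ 2 := by
    intro t ht
    have ht0 : 0 < t := by linarith
    have hrc := radialBump.continuous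
    have hκt : ∫ x : R3, (t ^ 3)⁻¹ * radialBump (t⁻¹ • x) = κ := by
      have := integral_mul_rescaled_eq (q := fun _ => 1) 0 ht0 radialBump
      simpa using this
    have hri : Integrable fun x : R3 => (t ^ 3)⁻¹ * radialBump (t⁻¹ • x) := by
      by_contra h
      rw [integral_undef h] at hκt
      exact hκ0.ne hκt
    have hpt : ∀ x, max (q x) 0 * ((t ^ 3)⁻¹ * radialBump (t⁻¹ • x)) ≤
        B * m x + (V + |C|) * t ^ 2 * ((t ^ 3)⁻¹ * radialBump (t⁻¹ • x)) := by
      intro x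
      have hr0 := radialBump.nonneg (t⁻¹ • x)
      rcases le_or_gt t ‖x‖ with hx | hx
      · have : radialBump (t⁻¹ • x) = 0 := by
          refine radialBump.eq_zero ?_
          rw [norm_smul, Real.norm_of_nonneg (by positivity), le_inv_mul_iff₀ ht0, mul_one]
          exact hx
        rw [this]
        simpa using mul_nonneg hB0 (hm0 x)
      · have h1 := neg_log_mul_le_integral_logKer hm hmi hm0 x
        have hn := norm_nonneg x
        have h2 : Real.log (1 + ‖x‖) ≤ t ^ 2 := by
          have := Real.log_le_sub_one_of_pos (by positivity : 0 < 1 + ‖x‖)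
          nlinarith
        have h3 : -(V * t ^ 2) ≤ v x := by
          have hpi : (Real.pi ^ 2)⁻¹ ≤ 1 :=
            inv_le_one_of_one_le₀ (one_le_pow₀ (by linarith [Real.pi_gt_three]))
          have hpi0 : 0 ≤ (Real.pi ^ 2)⁻¹ := by positivity
          have h4 : -(V * t ^ 2) ≤ ∫ y, logKer x y * m y := by
            refine le_trans ?_ h1
            rw [neg_le_neg_iff, mul_comm]; gcongr
          have h5 : 0 ≤ V * t ^ 2 := by positivity
          simp only [hv]
          nlinarith
        have h6 : C / 6 * ‖x‖ ^ 2 ≤ |C| * t ^ 2 := by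
          have : C / 6 ≤ |C| := by linarith [le_abs_self C, abs_nonneg C]
          calc C / 6 * ‖x‖ ^ 2 ≤ |C| * ‖x‖ ^ 2 := by gcongr
            _ ≤ _ := by gcongr
        have h7 : max (q x) 0 ≤ m x + (V + |C|) * t ^ 2 := by
          refine max_le ?_ (by have := hm0 x; positivity)
          simp only [hq]; linarith [hum x]
        have h8 : (t ^ 3)⁻¹ * radialBump (t⁻¹ • x) ≤ B := by
          have : (t ^ 3)⁻¹ ≤ 1 := inv_le_one_of_one_le₀ (one_le_pow₀ ht)
          calc (t ^ 3)⁻¹ * radialBump (t⁻¹ • x) ≤ 1 * B := by gcongr; exact hB _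
            _ = B := one_mul B
        calc _ ≤ (m x + (V + |C|) * t ^ 2) * ((t ^ 3)⁻¹ * radialBump (t⁻¹ • x)) := by gcongr
          _ = m x * ((t ^ 3)⁻¹ * radialBump (t⁻¹ • x)) +
            (V + |C|) * t ^ 2 * ((t ^ 3)⁻¹ * radialBump (t⁻¹ • x)) := by ring
          _ ≤ m x * B + (V + |C|) * t ^ 2 * ((t ^ 3)⁻¹ * radialBump (t⁻¹ • x)) := by
            have := hm0 x
            gcongr
          _ = _ := by ring
    refine (integral_mono_of_nonneg (ae_of_all _ fun x => ?_)
      ((hmi.const_mul B).add (hri.const_mul _)) (ae_of_all _ hpt)).trans ?_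
    · have hr0 := radialBump.nonneg (t⁻¹ • x)
      have := le_max_right (q x) 0
      simp only [Pi.zero_apply]
      positivity
    · simp only [Pi.add_apply]
      rw [integral_add (hmi.const_mul B) (hri.const_mul _), integral_const_mul,
        integral_const_mul, hκt]
      have h9 : V * B ≤ V * B * t ^ 2 :=
        le_mul_of_one_le_right (by positivity) (one_le_pow₀ ht)
      linarith
  have hthird := fun h₁ h₂ h₃ => hharm.thirdDiff_eq_zero hqc hgrow h₁ h₂ h₃
  have hpc : Continuous fun x => u x - v x := huc.sub hvc
  -- The correction `C/6 |x|²` has vanishing third differences, so it may be dropped again.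
  obtain ⟨c, b, H, hH, hp⟩ := exists_quadratic_of_thirdDiff hpc (by
    intro h₁ h₂ h₃
    have h1 := hthird h₁ h₂ h₃
    simp only [thirdDiff, hq, zero_add, norm_add_sq_real, inner_add_left, norm_zero] at h1 ⊢
    linarith)
  refine ⟨c, b, H, hH, fun x => ?_⟩
  rw [← hp x]; ring

/-! ### The quadratic part is bounded above -/

theorem not_forall_exp_le_pow {a c C k : ℝ} (ha : 0 < a) (hc : 0 < c) (hC : 0 ≤ C) (hk : 0 ≤ k)
    (N : ℕ) : ¬ ∀ R : ℝ, 1 ≤ R → a * Real.exp (c * R) ≤ C * (2 + k * R) ^ N := by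
  intro h
  have h1 : Tendsto (fun R : ℝ => (c * R) ^ N * Real.exp (-(c * R))) atTop (𝓝 0) :=
    (Real.tendsto_pow_mul_exp_neg_atTop_nhds_zero N).comp (tendsto_id.const_mul_atTop hc)
  have h2 := h1.const_mul (C * (2 + k) ^ N / c ^ N)
  rw [mul_zero] at h2
  refine absurd (ge_of_tendsto h2 ?_) (not_le.2 ha)
  filter_upwards [eventually_ge_atTop 1] with R hR
  have h3 : a * Real.exp (c * R) ≤ C * ((2 + k) * R) ^ N := by
    refine (h R hR).trans ?_
    gcongr
    nlinarith
  have h4 : a = a * Real.exp (c * R) * Real.exp (-(c * R)) := by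
    rw [mul_assoc, ← Real.exp_add]; simp
  rw [h4]
  calc a * Real.exp (c * R) * Real.exp (-(c * R))
      ≤ C * ((2 + k) * R) ^ N * Real.exp (-(c * R)) := by gcongr
    _ = _ := by rw [mul_pow, mul_pow]; field_simp

/-- If `exp (3 p)` is bounded by a polynomially weighted integrable function for a quadratic
polynomial `p`, then `p` attains its maximum. -/
theorem exists_center_of_integrable {m p : R3 → ℝ} (hm0 : ∀ x, 0 ≤ m x) (hmi : Integrable m)
    {c : ℝ} {b : R3} {H : R3 →ₗ[ℝ] R3} (hH : H.IsSymmetric)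
    (hp : ∀ x, p x = c + inner ℝ b x + 1 / 2 * inner ℝ (H x) x) {N : ℕ}
    (hpm : ∀ x, Real.exp (3 * p x) ≤ (1 + ‖x‖) ^ N * m x) :
    (∀ x, inner ℝ (H x) x ≤ 0) ∧
      ∃ (c' : ℝ) (x₀ : R3), ∀ x, p x = c' + 1 / 2 * inner ℝ (H (x - x₀)) (x - x₀) := by
  have hHc : Continuous H := H.continuous_of_finiteDimensional
  have hpc : Continuous p := by rw [funext hp]; fun_prop
  -- The mass of `e^{3p}` in the unit ball about `y` grows at most polynomially in `y`. A positive
  -- direction of the Hessian, or a linear term along its kernel, would make it grow exponentially.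
  set I : R3 → ℝ := fun y => ∫ x in Metric.closedBall 0 1, Real.exp (3 * p (x + y)) with hI
  set V := ∫ x, m x with hV
  have hV0 : 0 ≤ V := integral_nonneg hm0
  have hint : ∀ f : R3 → ℝ, Continuous f → IntegrableOn f (Metric.closedBall 0 1) := fun f hf =>
    hf.continuousOn.integrableOn_compact (isCompact_closedBall 0 1)
  have hmeas : MeasurableSet (Metric.closedBall (0 : R3) 1) :=
    Metric.isClosed_closedBall.measurableSet
  have hIle : ∀ y, I y ≤ V * (2 + ‖y‖) ^ N := by
    intro y
    have hmy : Integrable fun x => m (x + y) := hmi.comp_add_right y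
    calc I y ≤ ∫ x in Metric.closedBall 0 1, (2 + ‖y‖) ^ N * m (x + y) := by
          refine setIntegral_mono_on (hint _ (by fun_prop)) (hmy.const_mul _).integrableOn hmeas ?_
          intro x hx
          rw [Metric.mem_closedBall, dist_zero_right] at hx
          refine (hpm (x + y)).trans ?_
          have := norm_add_le x y
          have := hm0 (x + y)
          exact mul_le_mul_of_nonneg_right (pow_le_pow_left₀ (by positivity) (by linarith) N) this
      _ ≤ ∫ x, (2 + ‖y‖) ^ N * m (x + y) := by
          refine setIntegral_le_integral (hmy.const_mul _) (ae_of_all _ fun x => ?_)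
          have := hm0 (x + y)
          simp only [Pi.zero_apply]; positivity
      _ = V * (2 + ‖y‖) ^ N := by
          rw [integral_const_mul, integral_add_right_eq_self m y, mul_comm]
  have hI0 : 0 < I 0 := by
    rw [hI]; simp only
    rw [setIntegral_pos_iff_support_of_nonneg_ae]
    · have : Function.support (fun x => Real.exp (3 * p (x + 0))) = univ := by
        ext x; simp [(Real.exp_pos _).ne']
      rw [this, univ_inter]
      exact Metric.measure_closedBall_pos _ _ one_pos
    · exact ae_of_all _ fun x => (Real.exp_pos _).le
    · exact hint _ (by fun_prop)
  have hneg : ∀ x, inner ℝ (H x) x ≤ 0 := by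
    intro h
    by_contra hpos
    rw [not_le] at hpos
    refine not_forall_exp_le_pow (a := I 0) (c := inner ℝ (H h) h) hI0 hpos hV0 (norm_nonneg h) N
      fun R hR => ?_
    -- Adding the contributions at `R h` and `-R h` and using the inequality between arithmetic and
    -- geometric means cancels the odd part of `p` along `h`.
    have h1 : 2 * (I 0 * Real.exp (inner ℝ (H h) h * R)) ≤ I (R • h) + I (-(R • h)) := by
      rw [hI]; simp only
      rw [← integral_add (hint _ (by fun_prop)) (hint _ (by fun_prop)), ← integral_mul_const,
        ← integral_const_mul]
      refine setIntegral_mono_on (hint _ (by fun_prop))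
        ((hint _ (by fun_prop)).add (hint _ (by fun_prop))) hmeas fun x _ => ?_
      have e : p (x + R • h) + p (x + -(R • h)) = 2 * p x + R ^ 2 * inner ℝ (H h) h := by
        have h2 : inner ℝ (H x) h = inner ℝ (H h) x := by rw [hH x h, real_inner_comm]
        simp only [hp, map_add, map_neg, map_smul, inner_add_left, inner_add_right, inner_neg_left,
          inner_neg_right, inner_smul_left, inner_smul_right, h2]
        simp
        ring
      set s := Real.exp (3 / 2 * p (x + R • h)) with hs
      set s' := Real.exp (3 / 2 * p (x + -(R • h))) with hs'
      have e1 : Real.exp (3 * p (x + R • h)) = s ^ 2 := by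
        rw [hs, ← Real.exp_nat_mul]; congr 1; push_cast; ring
      have e2 : Real.exp (3 * p (x + -(R • h))) = s' ^ 2 := by
        rw [hs', ← Real.exp_nat_mul]; congr 1; push_cast; ring
      have e3 : Real.exp (3 * p (x + 0)) * Real.exp (inner ℝ (H h) h * R) ≤ s * s' := by
        rw [hs, hs', ← Real.exp_add, ← Real.exp_add, add_zero]
        refine Real.exp_le_exp.2 ?_
        have h3 : inner ℝ (H h) h * R ≤ inner ℝ (H h) h * R ^ 2 :=
          mul_le_mul_of_nonneg_left (by nlinarith) hpos.le
        have h4 : 0 ≤ inner ℝ (H h) h * R ^ 2 := by positivity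
        linarith
      rw [e1, e2]
      nlinarith [sq_nonneg (s - s')]
    have h2 := hIle (R • h)
    have h3 := hIle (-(R • h))
    rw [norm_neg] at h3
    rw [norm_smul, Real.norm_of_nonneg (by linarith : 0 ≤ R), mul_comm R] at h2 h3
    linarith
  refine ⟨hneg, ?_⟩
  -- Along the kernel of `H` the polynomial is affine, so `I` is exactly exponential there.
  have hker : ∀ k, H k = 0 → inner ℝ b k ≤ 0 := by
    intro k hk
    by_contra hpos
    rw [not_le] at hpos
    refine not_forall_exp_le_pow (a := I 0) (c := 3 * inner ℝ b k) hI0 (by positivity) hV0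
      (norm_nonneg k) N fun R hR => ?_
    have h2 := hIle (R • k)
    rw [norm_smul, Real.norm_of_nonneg (by linarith : 0 ≤ R), mul_comm R] at h2
    refine le_trans (le_of_eq ?_) h2
    rw [hI]; simp only
    rw [← integral_mul_const]
    congr 1; ext x
    rw [← Real.exp_add]
    congr 1
    have h3 : inner ℝ (H x) k = 0 := by rw [hH x k, hk, inner_zero_right]
    simp only [hp, map_add, map_smul, hk, smul_zero, add_zero, inner_add_right, inner_smul_right,
      h3]
    ring
  -- The range of a symmetric map is the orthogonal complement of its kernel. A preimage of `b` is
  -- what completing the square needs.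
  have hb : b ∈ LinearMap.range H := by
    rw [← Submodule.orthogonal_orthogonal (LinearMap.range H), hH.orthogonal_range]
    intro k hk
    rw [LinearMap.mem_ker] at hk
    rw [real_inner_comm]
    refine le_antisymm (hker k hk) ?_
    have := hker (-k) (by rw [map_neg, hk, neg_zero])
    rw [inner_neg_right] at this
    linarith
  obtain ⟨x₁, hx₁⟩ := hb
  refine ⟨c - 1 / 2 * inner ℝ (H x₁) x₁, -x₁, fun x => ?_⟩
  rw [hp, ← hx₁, sub_neg_eq_add]
  have h2 : inner ℝ (H x) x₁ = inner ℝ (H x₁) x := by rw [hH x x₁, real_inner_comm]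
  simp only [map_add, inner_add_left, inner_add_right, h2]
  ring

/-! ### The Pohozaev identity -/

section Pohozaev

/-- The vector field `x ↦ η (x / R) x`, where `η` is a cut-off function. -/
noncomputable def cutField (η : ContDiffBump (0 : R3)) (R : ℝ) (z : R3) : R3 := η (R⁻¹ • z) • z

theorem cutField_contDiff (η : ContDiffBump (0 : R3)) (R : ℝ) {n : ℕ∞} :
    ContDiff ℝ n (cutField η R) :=
  (η.contDiff.comp (contDiff_const_smul _)).smul contDiff_id

theorem cutoff_hasCompactSupport (η : ContDiffBump (0 : R3)) {R : ℝ} (hR : 0 < R) :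
    HasCompactSupport (fun z : R3 => η (R⁻¹ • z)) :=
  η.hasCompactSupport.comp_homeomorph (Homeomorph.smulOfNeZero R⁻¹ (inv_ne_zero hR.ne'))

/-- The fields satisfy `ξ_R(x) = R ξ₁(x/R)`, so their Lipschitz constant does not depend on `R`.
This gives the dominating function for the symmetrised kernel. -/
theorem exists_cutField_lipschitz (η : ContDiffBump (0 : R3)) :
    ∃ L, 0 ≤ L ∧ ∀ R, 0 < R → ∀ x y, ‖cutField η R x - cutField η R y‖ ≤ L * ‖x - y‖ := by
  have h1 := cutField_contDiff η 1 (n := 1)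
  obtain ⟨L, hL⟩ := (h1.continuous_fderiv one_ne_zero).bounded_above_of_compact_support
    (HasCompactSupport.fderiv (𝕜 := ℝ) (f := cutField η 1)
      ((cutoff_hasCompactSupport η one_pos).smul_right))
  refine ⟨L, (norm_nonneg _).trans (hL 0), fun R hR x y => ?_⟩
  have e : ∀ z, cutField η R z = R • cutField η 1 (R⁻¹ • z) := by
    intro z
    simp only [cutField, inv_one, one_smul]
    rw [smul_comm R, smul_smul R, mul_inv_cancel₀ hR.ne', one_smul]
  have h2 := convex_univ.norm_image_sub_le_of_norm_fderiv_le (f := cutField η 1)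
    (fun z _ => (h1.differentiable one_ne_zero).differentiableAt) (fun z _ => hL z)
    (mem_univ (R⁻¹ • y)) (mem_univ (R⁻¹ • x))
  rw [e, e, ← smul_sub, norm_smul, Real.norm_of_nonneg hR.le]
  rw [← smul_sub, norm_smul, Real.norm_of_nonneg (by positivity)] at h2
  calc R * _ ≤ R * (L * (R⁻¹ * ‖x - y‖)) := by gcongr
    _ = _ := by field_simp

end Pohozaev

section Pohozaev

variable {m : R3 → ℝ}

theorem integrable_inner_kernel (hm : Continuous m) (hmi : Integrable m) {Ξ : R3 → R3}
    (hΞ : Continuous Ξ) (hc : HasCompactSupport Ξ) :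
    Integrable (fun p : R3 × R3 => inner ℝ (p.1 - p.2) (Ξ p.1) * (‖p.1 - p.2‖ ^ 2)⁻¹ *
      (m p.1 * m p.2)) (volume.prod volume) := by
  have hw : Continuous fun x => ‖Ξ x‖ * m x := by fun_prop
  have hwc : HasCompactSupport fun x => ‖Ξ x‖ * m x := hc.norm.mul_right
  obtain ⟨W, hW⟩ := hw.bounded_above_of_compact_support hwc
  have h := SingKernel.inv_norm.integrable_prod (hw.integrable_of_hasCompactSupport hwc) hW hmi
  refine h.mono (Measurable.aestronglyMeasurable (by fun_prop)) (ae_of_all _ fun p => ?_)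
  simp only [norm_mul, norm_smul, norm_inv, norm_pow, Real.norm_eq_abs, abs_norm]
  have h1 := abs_real_inner_le_norm (p.1 - p.2) (Ξ p.1)
  rcases eq_or_ne (p.1 - p.2) 0 with h0 | h0
  · simp [h0]
  have h2 : 0 < ‖p.1 - p.2‖ := norm_pos_iff.2 h0
  calc |inner ℝ (p.1 - p.2) (Ξ p.1)| * (‖p.1 - p.2‖ ^ 2)⁻¹ * (|m p.1| * |m p.2|)
      ≤ (‖p.1 - p.2‖ * ‖Ξ p.1‖) * (‖p.1 - p.2‖ ^ 2)⁻¹ * (|m p.1| * |m p.2|) := by gcongr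
    _ = _ := by field_simp

theorem fderiv_quadratic {H : R3 →ₗ[ℝ] R3} (hH : H.IsSymmetric) (c : ℝ) (x₀ x e : R3) :
    fderiv ℝ (fun x => c + 1 / 2 * inner ℝ (H (x - x₀)) (x - x₀)) x e =
      inner ℝ (H (x - x₀)) e := by
  have h1 : HasFDerivAt (fun x => H.toContinuousLinearMap (x - x₀)) H.toContinuousLinearMap x := by
    have h : HasFDerivAt (fun x => H.toContinuousLinearMap (x - x₀)) _ x :=
      H.toContinuousLinearMap.hasFDerivAt.comp x ((hasFDerivAt_id x).sub_const x₀)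
    exact h.congr_fderiv (by ext; simp)
  have h2 := ((h1.inner ℝ ((hasFDerivAt_id x).sub_const x₀)).const_mul (1 / 2)).const_add c
  have h3 : inner ℝ (H e) (x - x₀) = inner ℝ (H (x - x₀)) e := by
    rw [hH e, real_inner_comm]
  refine (congrArg (fun L => L e) h2.fderiv).trans ?_
  simp [h3]
  ring

variable {u : R3 → ℝ} {c : ℝ} {x₀ : R3} {H : R3 →ₗ[ℝ] R3}

/-- The integral of `u ∂ₑ(g m)` is computed in two ways: by parts, using `∂ₑ m = 3 m ∂ₑ u`, and by
inserting the representation of `u`. All derivatives fall on compactly supported functions, so the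
potential itself is never differentiated. -/
theorem pohozaev_direction (hu : ContDiff ℝ 1 u) (hm : m = fun x => Real.exp (3 * u x))
    (hmi : Integrable m) (hH : H.IsSymmetric)
    (hrep : ∀ x, u x = (Real.pi ^ 2)⁻¹ * (∫ y, logKer x y * m y) +
      (c + 1 / 2 * inner ℝ (H (x - x₀)) (x - x₀)))
    {g : R3 → ℝ} (hg : ContDiff ℝ 1 g) (hc : HasCompactSupport g) (e : R3) :
    1 / 3 * ∫ x, fderiv ℝ g x e * m x =
      (Real.pi ^ 2)⁻¹ * (∫ p : R3 × R3, inner ℝ (p.1 - p.2) (g p.1 • e) * (‖p.1 - p.2‖ ^ 2)⁻¹ *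
        (m p.1 * m p.2) ∂(volume.prod volume)) -
      ∫ x, inner ℝ (H (x - x₀)) (g x • e) * m x := by
  have hm1 : ContDiff ℝ 1 m := by rw [hm]; exact (contDiff_const.mul hu).exp
  have hmc := hm1.continuous
  have hgc := hg.continuous
  have hψ : ContDiff ℝ 1 fun x => g x * m x := hg.mul hm1
  have hψc : HasCompactSupport fun x => g x * m x := hc.mul_right
  have hHc : Continuous H := H.continuous_of_finiteDimensional
  have hdψ : Continuous fun x => fderiv ℝ (fun x => g x * m x) x e :=
    (hψ.continuous_fderiv one_ne_zero).clm_apply continuous_const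
  have hdψc := hψc.fderiv_apply (𝕜 := ℝ) e
  have hdm : ∀ x, fderiv ℝ m x e = 3 * (m x * fderiv ℝ u x e) := by
    intro x
    have := (((hu.differentiable one_ne_zero) x).hasFDerivAt.const_mul 3).exp
    rw [hm]
    refine (congrArg (fun L => L e) this.fderiv).trans ?_
    simp; ring
  have h1 : 1 / 3 * ∫ x, fderiv ℝ g x e * m x = ∫ x, u x * fderiv ℝ (fun x => g x * m x) x e := by
    rw [integral_mul_fderiv_comm hu hψ hψc]
    have := integral_mul_fderiv_comm hm1 hg hc e
    simp only [mul_comm (fderiv ℝ g _ e)]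
    rw [this, mul_neg, ← integral_const_mul]
    congr 1
    refine integral_congr_ae (ae_of_all _ fun x => ?_)
    simp only [hdm]; ring
  have hquad : ContDiff ℝ 1 fun x => c + 1 / 2 * inner ℝ (H (x - x₀)) (x - x₀) := by
    refine contDiff_const.add (contDiff_const.mul (ContDiff.inner ℝ ?_ (by fun_prop)))
    exact H.toContinuousLinearMap.contDiff.comp (by fun_prop : ContDiff ℝ 1 fun x => x - x₀)
  have h2 := integral_mul_fderiv_comm hquad hψ hψc e
  have hi1 : Integrable (fun x => (Real.pi ^ 2)⁻¹ * ((∫ y, logKer x y * m y) *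
      fderiv ℝ (fun x => g x * m x) x e)) :=
    (((continuous_integral_logKer hmc hmi).mul hdψ).integrable_of_hasCompactSupport
      hdψc.mul_left).const_mul _
  have hi2 : Integrable (fun x => (c + 1 / 2 * inner ℝ (H (x - x₀)) (x - x₀)) *
      fderiv ℝ (fun x => g x * m x) x e) :=
    (hquad.continuous.mul hdψ).integrable_of_hasCompactSupport hdψc.mul_left
  have h3 : ∀ x, u x * fderiv ℝ (fun x => g x * m x) x e = (Real.pi ^ 2)⁻¹ *
      ((∫ y, logKer x y * m y) * fderiv ℝ (fun x => g x * m x) x e) +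
      (c + 1 / 2 * inner ℝ (H (x - x₀)) (x - x₀)) * fderiv ℝ (fun x => g x * m x) x e := by
    intro x
    rw [hrep x]; ring
  rw [h1]
  simp only [h3]
  rw [integral_add hi1 hi2, integral_const_mul, h2,
    integral_logPotential_mul hmi hdψ hdψc (integral_fderiv_eq_zero hψ hψc e), sub_eq_add_neg]
  congr 2
  · have hp := integrable_inner_kernel hmc hmi (Ξ := fun x => g x • e) (by fun_prop)
      hc.smul_right
    rw [integral_prod_symm _ hp, ← integral_neg]
    refine integral_congr_ae (ae_of_all _ fun y => ?_)
    simp only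
    rw [integral_log_mul_fderiv hψ hψc, mul_neg, neg_neg, ← integral_const_mul]
    refine integral_congr_ae (ae_of_all _ fun x => ?_)
    simp only [inner_smul_right]; ring
  · refine integral_congr_ae (ae_of_all _ fun x => ?_)
    simp only [fderiv_quadratic hH, inner_smul_right]; ring

theorem sum_inner_smul_eq (w v : R3) :
    ∑ i, inner ℝ w (inner ℝ v (EuclideanSpace.basisFun (Fin 3) ℝ i) •
      EuclideanSpace.basisFun (Fin 3) ℝ i) = inner ℝ w v := by
  simp only [inner_smul_right]
  rw [← (EuclideanSpace.basisFun (Fin 3) ℝ).sum_inner_mul_inner w v]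
  refine Finset.sum_congr rfl fun i _ => ?_
  rw [real_inner_comm v, mul_comm]

/-- The divergence of a vector field on `ℝ³`. -/
noncomputable def divField (Ξ : R3 → R3) (x : R3) : ℝ :=
  ∑ i, fderiv ℝ (fun x => inner ℝ (Ξ x) (EuclideanSpace.basisFun (Fin 3) ℝ i)) x
    (EuclideanSpace.basisFun (Fin 3) ℝ i)

theorem pohozaev_field (hu : ContDiff ℝ 1 u) (hm : m = fun x => Real.exp (3 * u x))
    (hmi : Integrable m) (hH : H.IsSymmetric)
    (hrep : ∀ x, u x = (Real.pi ^ 2)⁻¹ * (∫ y, logKer x y * m y) +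
      (c + 1 / 2 * inner ℝ (H (x - x₀)) (x - x₀)))
    {Ξ : R3 → R3} (hΞ : ContDiff ℝ 1 Ξ) (hc : HasCompactSupport Ξ) :
    1 / 3 * ∫ x, divField Ξ x * m x =
      (Real.pi ^ 2)⁻¹ * (∫ p : R3 × R3, inner ℝ (p.1 - p.2) (Ξ p.1) * (‖p.1 - p.2‖ ^ 2)⁻¹ *
        (m p.1 * m p.2) ∂(volume.prod volume)) -
      ∫ x, inner ℝ (H (x - x₀)) (Ξ x) * m x := by
  have hmc : Continuous m := by rw [hm]; have := hu.continuous; fun_prop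
  have hHc : Continuous H := H.continuous_of_finiteDimensional
  have hΞc := hΞ.continuous
  set b := EuclideanSpace.basisFun (Fin 3) ℝ with hb
  have hg : ∀ i, ContDiff ℝ 1 fun x => inner ℝ (Ξ x) (b i) := fun i => hΞ.inner ℝ contDiff_const
  have hgc : ∀ i, HasCompactSupport fun x => inner ℝ (Ξ x) (b i) := fun i =>
    hc.mono fun x hx => by
      contrapose! hx
      rw [Function.notMem_support] at hx ⊢
      simp [hx]
  have key := fun i => pohozaev_direction hu hm hmi hH hrep (hg i) (hgc i) (b i)
  have hsc : ∀ i, HasCompactSupport fun x => (inner ℝ (Ξ x) (b i) : ℝ) • b i := fun i =>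
    (hgc i).smul_right
  have e1 : ∫ x, divField Ξ x * m x =
      ∑ i, ∫ x, fderiv ℝ (fun x => inner ℝ (Ξ x) (b i)) x (b i) * m x := by
    rw [← integral_finsetSum]
    · simp only [divField, Finset.sum_mul, ← hb]
    · intro i _
      exact ((((hg i).continuous_fderiv one_ne_zero).clm_apply continuous_const).mul
        hmc).integrable_of_hasCompactSupport ((hgc i).fderiv_apply (𝕜 := ℝ) (b i)).mul_right
  have e2 : ∫ p : R3 × R3, inner ℝ (p.1 - p.2) (Ξ p.1) * (‖p.1 - p.2‖ ^ 2)⁻¹ *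
        (m p.1 * m p.2) ∂(volume.prod volume) = ∑ i, ∫ p : R3 × R3, inner ℝ (p.1 - p.2)
        ((inner ℝ (Ξ p.1) (b i) : ℝ) • b i) * (‖p.1 - p.2‖ ^ 2)⁻¹ *
        (m p.1 * m p.2) ∂(volume.prod volume) := by
    rw [← integral_finsetSum]
    · simp only [← Finset.sum_mul, hb, sum_inner_smul_eq]
    · intro i _
      exact integrable_inner_kernel hmc hmi (Ξ := fun x => (inner ℝ (Ξ x) (b i) : ℝ) • b i)
        (by fun_prop) (hsc i)
  have e3 : ∫ x, inner ℝ (H (x - x₀)) (Ξ x) * m x =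
      ∑ i, ∫ x, inner ℝ (H (x - x₀)) ((inner ℝ (Ξ x) (b i) : ℝ) • b i) * m x := by
    rw [← integral_finsetSum]
    · simp only [← Finset.sum_mul, hb, sum_inner_smul_eq]
    · intro i _
      refine Continuous.integrable_of_hasCompactSupport (by fun_prop) ?_
      refine (hgc i).mono fun x hx => ?_
      contrapose! hx
      rw [Function.notMem_support] at hx ⊢
      simp [hx]
  rw [e1, e2, e3, Finset.mul_sum, Finset.mul_sum, ← Finset.sum_sub_distrib]
  exact Finset.sum_congr rfl fun i _ => key i

theorem divField_cutField (η : ContDiffBump (0 : R3)) (R : ℝ) (x₀ x : R3) :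
    divField (fun x => cutField η R (x - x₀)) x =
      fderiv ℝ η (R⁻¹ • (x - x₀)) (R⁻¹ • (x - x₀)) + 3 * η (R⁻¹ • (x - x₀)) := by
  set b := EuclideanSpace.basisFun (Fin 3) ℝ with hb
  set L := fderiv ℝ η (R⁻¹ • (x - x₀)) with hL
  have hη : HasFDerivAt (fun x : R3 => η (R⁻¹ • (x - x₀))) (R⁻¹ • L) x := by
    have h1 : HasFDerivAt (fun x : R3 => R⁻¹ • (x - x₀)) (R⁻¹ • ContinuousLinearMap.id ℝ R3) x :=
      ((hasFDerivAt_id x).sub_const x₀).const_smul R⁻¹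
    have h2 : HasFDerivAt η L (R⁻¹ • (x - x₀)) :=
      ((η.contDiff (n := 1)).differentiable one_ne_zero _).hasFDerivAt
    have h3 := h2.comp x h1
    exact h3.congr_fderiv (by ext; simp)
  have hi : ∀ i, fderiv ℝ (fun x => inner ℝ (cutField η R (x - x₀)) (b i)) x (b i) =
      η (R⁻¹ • (x - x₀)) + R⁻¹ * (inner ℝ (x - x₀) (b i) * L (b i)) := by
    intro i
    have h1 : HasFDerivAt (fun x : R3 => inner ℝ (x - x₀) (b i)) (innerSL ℝ (b i)) x := by
      have := (innerSL ℝ (b i)).hasFDerivAt.comp x ((hasFDerivAt_id x).sub_const x₀)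
      refine (this.congr_fderiv (by ext; simp)).congr_of_eventuallyEq (Eventually.of_forall fun z => ?_)
      simp [real_inner_comm]
    have h2 := hη.mul h1
    have h3 : (fun x => inner ℝ (cutField η R (x - x₀)) (b i)) =
        fun x => η (R⁻¹ • (x - x₀)) * inner ℝ (x - x₀) (b i) := by
      ext z; simp only [cutField, inner_smul_left]; simp
    rw [h3]
    refine (congrArg (fun L => L (b i)) h2.fderiv).trans ?_
    have : ‖b i‖ = 1 := b.norm_eq_one i
    simp [this]
    ring
  rw [divField]
  simp only [← hb, hi]
  rw [Finset.sum_add_distrib, ← Finset.mul_sum, map_smul]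
  have : ∑ i, inner ℝ (x - x₀) (b i) * L (b i) = L (x - x₀) := by
    conv_rhs => rw [← b.sum_repr' (x - x₀)]
    simp [real_inner_comm]
  rw [this]
  simp
  ring

end Pohozaev

section Pohozaev

variable {u m : R3 → ℝ} {c : ℝ} {x₀ : R3} {H : R3 →ₗ[ℝ] R3}

theorem tendsto_scale {f : R3 → ℝ} (hf : Continuous f) (z : R3) :
    Tendsto (fun R : ℝ => f (R⁻¹ • z)) atTop (𝓝 (f 0)) := by
  have h : Tendsto (fun R : ℝ => R⁻¹ • z) atTop (𝓝 ((0 : ℝ) • z)) :=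
    tendsto_inv_atTop_zero.smul_const z
  rw [zero_smul] at h
  exact (hf.tendsto 0).comp h

theorem tendsto_integral_divField (η : ContDiffBump (0 : R3)) (hm : Continuous m)
    (hmi : Integrable m) :
    Tendsto (fun R : ℝ => ∫ x, divField (fun x => cutField η R (x - x₀)) x * m x) atTop
      (𝓝 (3 * ∫ x, m x)) := by
  have hη : ContDiff ℝ 1 η := η.contDiff
  have hc0 : Continuous fun w => fderiv ℝ η w w :=
    (hη.continuous_fderiv one_ne_zero).clm_apply continuous_id
  have hc : Continuous fun w => fderiv ℝ η w w + 3 * η w := by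
    have := hη.continuous
    fun_prop
  obtain ⟨B, hB⟩ : ∃ B, ∀ w, ‖fderiv ℝ η w w + 3 * η w‖ ≤ B := by
    refine hc.bounded_above_of_compact_support (HasCompactSupport.add ?_ ?_)
    · refine (η.hasCompactSupport.fderiv (𝕜 := ℝ)).mono fun w hw => ?_
      contrapose! hw
      rw [Function.notMem_support] at hw ⊢
      simp [hw]
    · exact η.hasCompactSupport.mul_left
  rw [← integral_const_mul]
  simp only [divField_cutField]
  refine tendsto_integral_filter_of_dominated_convergence (fun x => B * ‖m x‖) ?_ ?_
    (hmi.norm.const_mul B) ?_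
  · refine Eventually.of_forall fun R => Continuous.aestronglyMeasurable ?_
    exact (hc.comp (by fun_prop : Continuous fun x : R3 => R⁻¹ • (x - x₀))).mul hm
  · refine Eventually.of_forall fun R => ae_of_all _ fun x => ?_
    rw [norm_mul]
    exact mul_le_mul_of_nonneg_right (hB _) (norm_nonneg _)
  · refine ae_of_all _ fun x => ?_
    have := tendsto_scale hc (x - x₀)
    have h1 : η 0 = 1 := η.one_of_mem_closedBall (by simp [η.rIn_pos.le])
    simp only [map_zero, zero_add, h1, mul_one] at this
    exact this.mul_const _

/-- Exchanging `x` and `y` replaces the field by half of its difference at the two points. For the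
untruncated field the kernel becomes `⟨x-y, x-y⟩ / |x-y|² = 1`, which leaves half the product of the
masses; the uniform Lipschitz bound gives dominated convergence. -/
theorem tendsto_integral_cutField (η : ContDiffBump (0 : R3)) (hm : Continuous m)
    (hmi : Integrable m) :
    Tendsto (fun R : ℝ => ∫ p : R3 × R3, inner ℝ (p.1 - p.2) (cutField η R (p.1 - x₀)) *
        (‖p.1 - p.2‖ ^ 2)⁻¹ * (m p.1 * m p.2) ∂(volume.prod volume)) atTop
      (𝓝 (1 / 2 * (∫ x, m x) ^ 2)) := by
  obtain ⟨L, hL0, hL⟩ := exists_cutField_lipschitz η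
  have hcc : ∀ R, Continuous (cutField η R) := fun R => (cutField_contDiff η R (n := 1)).continuous
  have hη : Continuous η := η.continuous
  set F : ℝ → R3 × R3 → ℝ := fun R p => inner ℝ (p.1 - p.2)
    (cutField η R (p.1 - x₀) - cutField η R (p.2 - x₀)) * (‖p.1 - p.2‖ ^ 2)⁻¹ * (m p.1 * m p.2)
    with hF
  have hsymm : ∀ R, 0 < R → 1 / 2 * ∫ p, F R p ∂(volume.prod volume) =
      ∫ p : R3 × R3, inner ℝ (p.1 - p.2) (cutField η R (p.1 - x₀)) *
        (‖p.1 - p.2‖ ^ 2)⁻¹ * (m p.1 * m p.2) ∂(volume.prod volume) := by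
    intro R hR
    have hi := integrable_inner_kernel hm hmi (Ξ := fun x => cutField η R (x - x₀))
      ((hcc R).comp (by fun_prop)) (((cutoff_hasCompactSupport η hR).smul_right (f' := id)).comp_homeomorph
        (Homeomorph.subRight x₀))
    set G : R3 × R3 → ℝ := fun p => inner ℝ (p.1 - p.2) (cutField η R (p.1 - x₀)) *
        (‖p.1 - p.2‖ ^ 2)⁻¹ * (m p.1 * m p.2) with hG
    have h1 : F R = fun p => G p + G p.swap := by
      ext p
      simp only [hF, hG, Prod.fst_swap, Prod.snd_swap, inner_sub_right]
      have : inner ℝ (p.2 - p.1) (cutField η R (p.2 - x₀)) =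
          -inner ℝ (p.1 - p.2) (cutField η R (p.2 - x₀)) := by
        rw [← inner_neg_left, neg_sub]
      rw [this, norm_sub_rev p.2 p.1]
      ring
    have h2 : ∫ p, G p.swap ∂(volume.prod volume) = ∫ p, G p ∂(volume.prod volume) :=
      integral_prod_swap G
    have h3 : ∫ p, (G p + G p.swap) ∂(volume.prod volume) = ∫ p, G p ∂(volume.prod volume) +
        ∫ p, G p.swap ∂(volume.prod volume) := integral_add hi hi.swap
    rw [h1, h3, h2]
    ring
  have hlim : Tendsto (fun R => ∫ p, F R p ∂(volume.prod volume)) atTop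
      (𝓝 (∫ p : R3 × R3, m p.1 * m p.2 ∂(volume.prod volume))) := by
    refine tendsto_integral_filter_of_dominated_convergence
      (fun p => L * ‖m p.1 * m p.2‖) ?_ ?_ ((hmi.mul_prod hmi).norm.const_mul L) ?_
    · refine Eventually.of_forall fun R => Measurable.aestronglyMeasurable ?_
      have := (hcc R).measurable
      have := hm.measurable
      simp only [hF]
      fun_prop
    · filter_upwards [eventually_gt_atTop 0] with R hR
      refine ae_of_all _ fun p => ?_
      simp only [hF, norm_mul, norm_inv, norm_pow, norm_norm]
      rw [← norm_mul (m p.1)]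
      refine mul_le_mul_of_nonneg_right ?_ (norm_nonneg _)
      rcases eq_or_ne (p.1 - p.2) 0 with h0 | h0
      · simp [h0, hL0]
      have h2 : 0 < ‖p.1 - p.2‖ := norm_pos_iff.2 h0
      rw [← div_eq_mul_inv, div_le_iff₀ (by positivity)]
      have h3 := hL R hR (p.1 - x₀) (p.2 - x₀)
      rw [sub_sub_sub_cancel_right] at h3
      calc _ ≤ ‖p.1 - p.2‖ * ‖cutField η R (p.1 - x₀) - cutField η R (p.2 - x₀)‖ :=
            norm_inner_le_norm _ _
        _ ≤ ‖p.1 - p.2‖ * (L * ‖p.1 - p.2‖) := by gcongr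
        _ = _ := by ring
    · have hne : ∀ᵐ p : R3 × R3 ∂(volume.prod volume), p.1 ≠ p.2 := by
        refine Measure.ae_prod_iff_ae_ae ?_ |>.2 ?_
        · exact (measurableSet_eq_fun measurable_fst measurable_snd).compl
        · exact ae_of_all _ fun x => (ae_ne x).mono fun y hy => hy.symm
      filter_upwards [hne] with p hp
      have h0 : p.1 - p.2 ≠ 0 := sub_ne_zero.2 hp
      have h2 : ‖p.1 - p.2‖ ≠ 0 := norm_ne_zero_iff.2 h0
      have hη0 : η 0 = 1 := η.one_of_mem_closedBall (by simp [η.rIn_pos.le])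
      have h3 : ∀ z : R3, Tendsto (fun R : ℝ => cutField η R z) atTop (𝓝 z) := fun z => by
        have := (tendsto_scale hη z).smul_const z
        rwa [hη0, one_smul] at this
      have h4 : Tendsto (fun R => F R p) atTop (𝓝 (inner ℝ (p.1 - p.2)
          ((p.1 - x₀) - (p.2 - x₀)) * (‖p.1 - p.2‖ ^ 2)⁻¹ * (m p.1 * m p.2))) :=
        ((tendsto_const_nhds.inner ((h3 _).sub (h3 _))).mul_const _).mul_const _
      rw [sub_sub_sub_cancel_right, real_inner_self_eq_norm_sq, mul_inv_cancel₀ (pow_ne_zero 2 h2),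
        one_mul] at h4
      exact h4
  have h5 := (hlim.const_mul (1 / 2)).congr' ((eventually_gt_atTop 0).mono hsymm)
  rw [integral_prod_mul (μ := volume) (ν := volume) m m, ← sq] at h5
  exact h5

/-- The Pohozaev inequality for `u = v + p`, `v` the logarithmic potential of `e^{3u}` and `p` a
quadratic polynomial which is bounded above, together with its equality case. -/
theorem pohozaev (hu : ContDiff ℝ 1 u) (hm : m = fun x => Real.exp (3 * u x))
    (hmi : Integrable m) (hH : H.IsSymmetric)
    (hrep : ∀ x, u x = (Real.pi ^ 2)⁻¹ * (∫ y, logKer x y * m y) +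
      (c + 1 / 2 * inner ℝ (H (x - x₀)) (x - x₀))) (hneg : ∀ x, inner ℝ (H x) x ≤ 0) :
    ∫ x, m x ≤ 2 * Real.pi ^ 2 ∧
      (∫ x, m x = 2 * Real.pi ^ 2 → ∀ x, inner ℝ (H x) x = 0) := by
  have hmc : Continuous m := by rw [hm]; have := hu.continuous; fun_prop
  have hmpos : ∀ x, 0 < m x := fun x => by rw [hm]; exact Real.exp_pos _
  have hHc : Continuous H := H.continuous_of_finiteDimensional
  set V := ∫ x, m x with hV
  have hVpos : 0 < V := by
    rw [hV, integral_pos_iff_support_of_nonneg (fun x => (hmpos x).le) hmi]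
    have : Function.support m = univ := by ext x; simp [(hmpos x).ne']
    rw [this]; simp
  let η : ContDiffBump (0 : R3) := ⟨1, 2, one_pos, one_lt_two⟩
  set N : ℝ → ℝ := fun R => ∫ x, -inner ℝ (H (x - x₀)) (cutField η R (x - x₀)) * m x with hN
  have key : ∀ R, 0 < R → N R = 1 / 3 * (∫ x, divField (fun x => cutField η R (x - x₀)) x * m x) -
      (Real.pi ^ 2)⁻¹ * (∫ p : R3 × R3, inner ℝ (p.1 - p.2) (cutField η R (p.1 - x₀)) *
        (‖p.1 - p.2‖ ^ 2)⁻¹ * (m p.1 * m p.2) ∂(volume.prod volume)) := by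
    intro R hR
    have := pohozaev_field hu hm hmi hH hrep (Ξ := fun x => cutField η R (x - x₀))
      ((cutField_contDiff η R (n := 1)).comp (by fun_prop))
      (((cutoff_hasCompactSupport η hR).smul_right (f' := id)).comp_homeomorph
        (Homeomorph.subRight x₀))
    rw [this, hN]
    simp only [neg_mul, integral_neg]
    ring
  -- The limit is `V (1 - V/(2π²))`. Each `N R` is nonnegative because `H` is nonpositive.
  have hlim : Tendsto N atTop (𝓝 (1 / 3 * (3 * V) - (Real.pi ^ 2)⁻¹ * (1 / 2 * V ^ 2))) :=
    (((tendsto_integral_divField η hmc hmi).const_mul _).sub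
      ((tendsto_integral_cutField η hmc hmi).const_mul _)).congr'
      ((eventually_gt_atTop 0).mono fun R hR => (key R hR).symm)
  have hpt : ∀ R x, 0 ≤ -inner ℝ (H (x - x₀)) (cutField η R (x - x₀)) * m x := by
    intro R x
    refine mul_nonneg ?_ (hmpos x).le
    rw [cutField, inner_smul_right, ← mul_neg]
    exact mul_nonneg η.nonneg (neg_nonneg.2 (hneg _))
  have hN0 : ∀ R, 0 ≤ N R := fun R => integral_nonneg (hpt R)
  have h0 := ge_of_tendsto' hlim hN0
  have hπ : 0 < Real.pi ^ 2 := by positivity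
  refine ⟨?_, ?_⟩
  · have h1 : 0 ≤ V * (1 - (Real.pi ^ 2)⁻¹ * (1 / 2 * V)) := by linarith
    have h2 := nonneg_of_mul_nonneg_right h1 hVpos
    have h3 : (Real.pi ^ 2)⁻¹ * (1 / 2 * V) ≤ 1 := by linarith
    rw [inv_mul_le_iff₀ hπ] at h3
    linarith
  · intro hVe x
    have hl0 : 1 / 3 * (3 * V) - (Real.pi ^ 2)⁻¹ * (1 / 2 * V ^ 2) = 0 := by
      rw [hVe]; field_simp; ring
    rw [hl0] at hlim
    set ρ := ‖x‖ + 1 with hρ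
    have hcont : Continuous fun z => -inner ℝ (H (z - x₀)) (z - x₀) * m z := by fun_prop
    -- On a fixed ball the cut-off is eventually equal to one, so the integral over the ball is
    -- bounded by `N R`, which tends to zero in the case of equality.
    have hball : ∫ z in Metric.closedBall x₀ ρ, -inner ℝ (H (z - x₀)) (z - x₀) * m z ≤ 0 := by
      refine ge_of_tendsto hlim ?_
      filter_upwards [eventually_ge_atTop ρ] with R hR
      have hR0 : 0 < R := lt_of_lt_of_le (by positivity) hR
      have e : ∫ z in Metric.closedBall x₀ ρ, -inner ℝ (H (z - x₀)) (z - x₀) * m z =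
          ∫ z in Metric.closedBall x₀ ρ, -inner ℝ (H (z - x₀)) (cutField η R (z - x₀)) * m z := by
        refine setIntegral_congr_fun Metric.isClosed_closedBall.measurableSet fun z hz => ?_
        have : η (R⁻¹ • (z - x₀)) = 1 := by
          refine η.one_of_mem_closedBall ?_
          rw [Metric.mem_closedBall, dist_zero_right, norm_smul, norm_inv,
            Real.norm_of_nonneg hR0.le, inv_mul_le_iff₀ hR0]
          rw [Metric.mem_closedBall, dist_eq_norm] at hz
          show _ ≤ R * 1
          linarith
        simp only [cutField, this, one_smul]
      rw [e]
      refine setIntegral_le_integral ?_ (ae_of_all _ (hpt R))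
      have hcf : Continuous fun z => cutField η R (z - x₀) :=
        (cutField_contDiff η R (n := 1)).continuous.comp (by fun_prop)
      refine Continuous.integrable_of_hasCompactSupport (by fun_prop) ?_
      have hcs : HasCompactSupport fun z => cutField η R (z - x₀) :=
        (((cutoff_hasCompactSupport η hR0).smul_right (f' := id)).comp_homeomorph
          (Homeomorph.subRight x₀))
      refine hcs.mono fun z hz => ?_
      contrapose! hz
      rw [Function.notMem_support] at hz ⊢
      simp [hz]
    have hnn : ∀ z, 0 ≤ -inner ℝ (H (z - x₀)) (z - x₀) * m z := fun z =>
      mul_nonneg (neg_nonneg.2 (hneg _)) (hmpos z).le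
    by_contra hx
    have hlt : 0 < -inner ℝ (H x) x := neg_pos.2 (lt_of_le_of_ne (hneg x) hx)
    have hpos : 0 < ∫ z in Metric.ball x₀ ρ, -inner ℝ (H (z - x₀)) (z - x₀) * m z := by
      rw [setIntegral_pos_iff_support_of_nonneg_ae (ae_of_all _ hnn)
        ((hcont.continuousOn.integrableOn_compact (isCompact_closedBall x₀ ρ)).mono_set
          Metric.ball_subset_closedBall)]
      refine ((hcont.isOpen_support).inter Metric.isOpen_ball).measure_pos _ ⟨x + x₀, ?_, ?_⟩
      · rw [Function.mem_support, add_sub_cancel_right]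
        exact (mul_pos hlt (hmpos _)).ne'
      · rw [Metric.mem_ball, dist_eq_norm, add_sub_cancel_right]; linarith
    have hle : ∫ z in Metric.ball x₀ ρ, -inner ℝ (H (z - x₀)) (z - x₀) * m z ≤
        ∫ z in Metric.closedBall x₀ ρ, -inner ℝ (H (z - x₀)) (z - x₀) * m z :=
      setIntegral_mono_set (hcont.continuousOn.integrableOn_compact (isCompact_closedBall x₀ ρ))
        (ae_of_all _ hnn) (Eventually.of_forall Metric.ball_subset_closedBall)
    linarith

end Pohozaev

/-! ### Decay in the case of equality -/

theorem tendsto_setIntegral_closedBall_compl {f : R3 → ℝ} (hf : Integrable f) :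
    Tendsto (fun R : ℝ => ∫ y in (Metric.closedBall 0 R)ᶜ, f y) atTop (𝓝 0) := by
  have h1 := (aecover_closedBall (μ := (volume : Measure R3)) (x := 0)
    (tendsto_id (α := ℝ) (x := atTop))).integral_tendsto_of_countably_generated hf
  have h2 := h1.const_sub (∫ y, f y)
  rw [sub_self] at h2
  refine h2.congr fun R => ?_
  rw [← integral_add_compl (Metric.isClosed_closedBall (x := (0 : R3)) (ε := R)).measurableSet hf]
  simp

/-- Jensen's inequality for the exponential function. -/
theorem mul_exp_integral_div_le {μ : Measure R3} {m f : R3 → ℝ} (hm0 : ∀ x, 0 ≤ m x)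
    (hmi : Integrable m μ) (ha : 0 < ∫ y, m y ∂μ) (hf : Integrable (fun y => f y * m y) μ)
    (hef : Integrable (fun y => Real.exp (f y) * m y) μ) :
    (∫ y, m y ∂μ) * Real.exp ((∫ y, f y * m y ∂μ) / ∫ y, m y ∂μ) ≤
      ∫ y, Real.exp (f y) * m y ∂μ := by
  set a := ∫ y, m y ∂μ
  set J := (∫ y, f y * m y ∂μ) / a with hJ
  have hi : Integrable (fun y => (1 - J) * m y + f y * m y) μ := (hmi.const_mul _).add hf
  have h1 : ∫ y, Real.exp J * ((1 - J) * m y + f y * m y) ∂μ = a * Real.exp J := by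
    rw [integral_const_mul, integral_add (hmi.const_mul _) hf, integral_const_mul]
    have : ∫ y, f y * m y ∂μ = J * a := by rw [hJ]; field_simp
    rw [this]; ring
  rw [← h1]
  refine integral_mono (hi.const_mul _) hef fun y => ?_
  -- The tangent line of the exponential at the weighted mean `J` of `f`.
  have h2 := Real.add_one_le_exp (f y - J)
  rw [Real.exp_sub, le_div_iff₀ (Real.exp_pos _)] at h2
  have := mul_le_mul_of_nonneg_right h2 (hm0 y)
  simp only
  linarith

section Decay

/-- For an exponent at most one the singularity is no worse than `|x-y|⁻¹`, which is integrable
against `m`. -/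
theorem exp_mul_logKer_le {β : ℝ} (h0 : 0 ≤ β) (h1 : β ≤ 1) {x y : R3} (hxy : y ≠ x) :
    Real.exp (β * logKer x y) ≤ 2 + (1 + ‖x‖) * ‖x - y‖⁻¹ := by
  have hd : 0 < ‖x - y‖ := norm_pos_iff.2 (sub_ne_zero.2 hxy.symm)
  have ht : 0 < (1 + ‖y‖) / ‖x - y‖ := by positivity
  have e : logKer x y = Real.log ((1 + ‖y‖) / ‖x - y‖) := by
    rw [logKer, Real.log_div (by positivity) hd.ne']
  have h2 : Real.exp (β * logKer x y) ≤ 1 + (1 + ‖y‖) / ‖x - y‖ := by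
    rcases le_total (logKer x y) 0 with h | h
    · have : Real.exp (β * logKer x y) ≤ 1 :=
        Real.exp_le_one_iff.2 (mul_nonpos_of_nonneg_of_nonpos h0 h)
      linarith
    · have : Real.exp (β * logKer x y) ≤ Real.exp (logKer x y) :=
        Real.exp_le_exp.2 (mul_le_of_le_one_left h h1)
      rw [e, Real.exp_log ht, ← e] at this
      linarith
  have h3 : (1 + ‖y‖) / ‖x - y‖ ≤ 1 + (1 + ‖x‖) * ‖x - y‖⁻¹ := by
    rw [div_le_iff₀ hd, add_mul, mul_assoc, inv_mul_cancel₀ hd.ne']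
    have := norm_sub_norm_le y x
    rw [norm_sub_rev] at this
    linarith
  linarith

theorem logKer_le_of_norm_le {R : ℝ} (hR : 0 ≤ R) {x y : R3} (hx : 2 * R + 2 ≤ ‖x‖) (hy : ‖y‖ ≤ R) :
    logKer x y ≤ Real.log (4 * (1 + R)) - Real.log (1 + ‖x‖) := by
  have h1 : (1 + ‖x‖) / 4 ≤ ‖x - y‖ := by
    have := norm_sub_norm_le x y
    linarith
  have h2 : Real.log (1 + ‖x‖) - Real.log 4 ≤ Real.log ‖x - y‖ := by
    rw [← Real.log_div (by positivity) (by norm_num)]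
    exact Real.log_le_log (by positivity) h1
  have h3 : Real.log (1 + ‖y‖) ≤ Real.log (1 + R) := Real.log_le_log (by positivity) (by linarith)
  rw [Real.log_mul (by norm_num) (by positivity), logKer]
  linarith

variable {u m : R3 → ℝ} {c : ℝ}

theorem exp_setIntegral_logKer_le (hm : Continuous m) (hm0 : ∀ x, 0 < m x) (hmi : Integrable m)
    {S : Set R3} (hS : 0 < ∫ y in S, m y) {β : ℝ} (hβ0 : 0 ≤ β) (hβ1 : β ≤ 1) (x : R3) :
    Real.exp (β * ((∫ y in S, logKer x y * m y) / ∫ y in S, m y)) ≤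
      2 + (∫ y in S, m y)⁻¹ * ((1 + ‖x‖) * ∫ y, ‖x - y‖⁻¹ * m y) := by
  set a := ∫ y in S, m y with ha
  have hLi := integrable_logKer_mul hm hmi x
  have hgi : Integrable fun y => ‖x - y‖⁻¹ * m y :=
    SingKernel.inv_norm.integrable_mul_sub hm hmi x
  have e : (fun y => (2 + (1 + ‖x‖) * ‖x - y‖⁻¹) * m y) =
      fun y => 2 * m y + (1 + ‖x‖) * (‖x - y‖⁻¹ * m y) := by ext y; ring
  have hbd : Integrable fun y => (2 + (1 + ‖x‖) * ‖x - y‖⁻¹) * m y := by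
    rw [e]
    exact (hmi.const_mul _).add (hgi.const_mul _)
  have hexpi : Integrable fun y => Real.exp (β * logKer x y) * m y := by
    refine hbd.mono' (Measurable.aestronglyMeasurable ?_) ?_
    · unfold logKer
      have := hm.measurable
      fun_prop
    · filter_upwards [ae_ne x] with y hy
      rw [norm_mul, Real.norm_of_nonneg (Real.exp_pos _).le, Real.norm_of_nonneg (hm0 y).le]
      exact mul_le_mul_of_nonneg_right (exp_mul_logKer_le hβ0 hβ1 hy) (hm0 y).le
  have hJ := mul_exp_integral_div_le (μ := volume.restrict S) (f := fun y => β * logKer x y)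
    (fun y => (hm0 y).le) hmi.integrableOn hS
    (by simp only [mul_assoc]; exact (hLi.const_mul β).integrableOn) hexpi.integrableOn
  rw [← ha] at hJ
  have hJ2 : ∫ y in S, Real.exp (β * logKer x y) * m y ≤
      2 * a + (1 + ‖x‖) * ∫ y, ‖x - y‖⁻¹ * m y := by
    calc _ ≤ ∫ y in S, (2 + (1 + ‖x‖) * ‖x - y‖⁻¹) * m y := by
          refine setIntegral_mono_ae hexpi.integrableOn hbd.integrableOn ?_
          filter_upwards [ae_ne x] with y hy
          exact mul_le_mul_of_nonneg_right (exp_mul_logKer_le hβ0 hβ1 hy) (hm0 y).le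
      _ = 2 * a + (1 + ‖x‖) * ∫ y in S, ‖x - y‖⁻¹ * m y := by
          rw [e, integral_add (hmi.const_mul _).integrableOn (hgi.const_mul _).integrableOn,
            integral_const_mul, integral_const_mul]
      _ ≤ _ := by
          refine add_le_add le_rfl (mul_le_mul_of_nonneg_left ?_ (by positivity))
          exact setIntegral_le_integral hgi (ae_of_all _ fun y =>
            mul_nonneg (by positivity) (hm0 y).le)
  simp only [mul_assoc, integral_const_mul] at hJ
  rw [← mul_div_assoc]
  have h := hJ.trans hJ2
  rw [mul_comm, ← le_div_iff₀ hS] at h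
  refine h.trans (le_of_eq ?_)
  field_simp

theorem le_two_add_mul_of_le {E a p g : ℝ} (ha : 0 ≤ a) (hp : 1 ≤ p) (hg : 0 ≤ g)
    (h : E ≤ 2 + a * (p * g)) : E ≤ (2 + a) * (p * (1 + g)) := by
  have h1 : 0 ≤ p * g := by positivity
  have h2 : 0 ≤ a * p := by positivity
  linarith

/-- The mass of `m` in a large ball pushes `u` down like `-2 log|x|`, up to a small loss. The
remaining far mass has a small exponent, and Jensen's inequality bounds its contribution by `1 +
|x|` times one plus a potential of `m`. The net power `-7/2` is integrable in dimension three. -/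
theorem exists_one_add_norm_mul_exp_le (hm : Continuous m)
    (hm0 : ∀ x, 0 < m x) (hmi : Integrable m) (hV : ∫ y, m y = 2 * Real.pi ^ 2)
    (hrep : ∀ x, u x = c + (Real.pi ^ 2)⁻¹ * ∫ y, logKer x y * m y) {k : ℝ} (hk : 3 ≤ k) :
    ∃ C R : ℝ, ∀ x, R ≤ ‖x‖ → (1 + ‖x‖) * Real.exp (k * u x) ≤ C *
      ((1 + ‖x‖) ^ (-(7 / 2) : ℝ) + (∫ y, ‖x - y‖⁻¹ * m y) * (1 + ‖x‖) ^ (-(7 / 2) : ℝ)) := by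
  have hπ : 0 < Real.pi ^ 2 := by positivity
  -- The far mass is chosen so small that the exponent `β` in Jensen's inequality is at most one
  -- half.
  obtain ⟨R, hR0, hRa⟩ : ∃ R : ℝ, 0 ≤ R ∧
      ∫ y in (Metric.closedBall (0 : R3) R)ᶜ, m y < Real.pi ^ 2 / (2 * k) :=
    ((eventually_ge_atTop 0).and ((tendsto_setIntegral_closedBall_compl hmi).eventually
      (gt_mem_nhds (by positivity)))).exists
  set S := (Metric.closedBall (0 : R3) R)ᶜ with hS
  have hSm : MeasurableSet S := Metric.isClosed_closedBall.measurableSet.compl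
  set a := ∫ y in S, m y with ha
  have ha0 : 0 < a := by
    rw [ha, setIntegral_pos_iff_support_of_nonneg_ae (ae_of_all _ fun x => (hm0 x).le)
      hmi.integrableOn]
    have : Function.support m = univ := by ext x; simp [(hm0 x).ne']
    rw [this, univ_inter]
    refine Metric.isClosed_closedBall.isOpen_compl.measure_pos _ ?_
    obtain ⟨x, hx⟩ := NormedSpace.exists_lt_norm ℝ R3 R
    exact ⟨x, by simpa [hS] using hx⟩
  set β := k * a / Real.pi ^ 2 with hβ
  have hβ0 : 0 ≤ β := by positivity
  have hβ1 : β ≤ 1 / 2 := by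
    rw [hβ, div_le_iff₀ hπ]
    rw [lt_div_iff₀ (by positivity)] at hRa
    linarith
  set g : R3 → ℝ := fun x => ∫ y, ‖x - y‖⁻¹ * m y with hg
  set D := Real.log (4 * (1 + R)) with hD
  have hD0 : 0 ≤ D := Real.log_nonneg (by linarith)
  refine ⟨Real.exp (k * c + 2 * k * D) * (2 + a⁻¹), 2 * R + 2, ?_⟩
  intro x hx
  have hp : 0 < 1 + ‖x‖ := by positivity
  have hg0 : 0 ≤ g x := integral_nonneg fun y => mul_nonneg (by positivity) (hm0 y).le
  have hLi := integrable_logKer_mul hm hmi x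
  set T := ∫ y in S, logKer x y * m y with hT
  have hball : ∫ y in Sᶜ, logKer x y * m y ≤ (2 * Real.pi ^ 2 - a) * (D - Real.log (1 + ‖x‖)) := by
    have h1 : ∫ y in Sᶜ, m y = 2 * Real.pi ^ 2 - a := by
      rw [← hV, ← integral_add_compl hSm hmi]; ring
    rw [← h1, mul_comm, ← integral_const_mul]
    refine setIntegral_mono_on hLi.integrableOn (hmi.const_mul _).integrableOn hSm.compl ?_
    intro y hy
    rw [hS, compl_compl, Metric.mem_closedBall, dist_zero_right] at hy
    exact mul_le_mul_of_nonneg_right (logKer_le_of_norm_le hR0 hx hy) (hm0 y).le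
  -- The total mass `2π²` gives the exponent `2k - β`, which is at least `6 - 1/2 = 11/2`.
  have hu1 : k * u x ≤ (k * c + 2 * k * D) + -(11 / 2) * Real.log (1 + ‖x‖) +
      k * (Real.pi ^ 2)⁻¹ * T := by
    rw [hrep x, ← integral_add_compl hSm hLi, ← hT]
    have h1 : k * (Real.pi ^ 2)⁻¹ * (∫ y in Sᶜ, logKer x y * m y) ≤
        k * (Real.pi ^ 2)⁻¹ * ((2 * Real.pi ^ 2 - a) * (D - Real.log (1 + ‖x‖))) := by gcongr
    have h2 : k * (Real.pi ^ 2)⁻¹ * ((2 * Real.pi ^ 2 - a) * (D - Real.log (1 + ‖x‖))) =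
        (2 * k - β) * (D - Real.log (1 + ‖x‖)) := by
      rw [hβ]; field_simp
    have hl : 0 ≤ Real.log (1 + ‖x‖) := Real.log_nonneg (by linarith [norm_nonneg x])
    have h3 : (11 / 2 : ℝ) * Real.log (1 + ‖x‖) ≤ (2 * k - β) * Real.log (1 + ‖x‖) :=
      mul_le_mul_of_nonneg_right (by linarith) hl
    have h4 : 0 ≤ β * D := by positivity
    clear_value T D g β
    linarith
  have hJ3 : Real.exp (k * (Real.pi ^ 2)⁻¹ * T) ≤ (2 + a⁻¹) * ((1 + ‖x‖) * (1 + g x)) := by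
    have h1 : Real.exp (k * (Real.pi ^ 2)⁻¹ * T) ≤ 2 + a⁻¹ * ((1 + ‖x‖) * g x) := by
      have := exp_setIntegral_logKer_le hm hm0 hmi ha0 hβ0 (by linarith) x
      rw [← hT, ← ha] at this
      convert this using 2
      rw [hβ]; field_simp
    exact le_two_add_mul_of_le (inv_nonneg.2 ha0.le) (le_add_of_nonneg_right (norm_nonneg x)) hg0 h1
  have hrp : Real.exp (-(11 / 2) * Real.log (1 + ‖x‖)) = (1 + ‖x‖) ^ (-(11 / 2) : ℝ) := by
    rw [Real.rpow_def_of_pos hp, mul_comm]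
  have hr1 : (1 + ‖x‖) * ((1 + ‖x‖) ^ (-(11 / 2) : ℝ) * (1 + ‖x‖)) =
      (1 + ‖x‖) ^ (-(7 / 2) : ℝ) := by
    have : (-(7 / 2) : ℝ) = -(11 / 2) + 1 + 1 := by norm_num
    rw [this, Real.rpow_add_one hp.ne', Real.rpow_add_one hp.ne']
    ring
  have h1 : Real.exp (k * u x) ≤ Real.exp (k * c + 2 * k * D) * (1 + ‖x‖) ^ (-(11 / 2) : ℝ) *
      ((2 + a⁻¹) * ((1 + ‖x‖) * (1 + g x))) := by
    refine (Real.exp_le_exp.2 hu1).trans ?_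
    rw [Real.exp_add, Real.exp_add, hrp]
    exact mul_le_mul_of_nonneg_left hJ3 (by positivity)
  refine (mul_le_mul_of_nonneg_left h1 hp.le).trans (le_of_eq ?_)
  rw [← hr1]
  ring

theorem integrable_one_add_norm_mul_exp (hu : Continuous u) (hm : Continuous m)
    (hm0 : ∀ x, 0 < m x) (hmi : Integrable m) (hV : ∫ y, m y = 2 * Real.pi ^ 2)
    (hrep : ∀ x, u x = c + (Real.pi ^ 2)⁻¹ * ∫ y, logKer x y * m y) {k : ℝ} (hk : 3 ≤ k) :
    Integrable fun x => (1 + ‖x‖) * Real.exp (k * u x) := by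
  obtain ⟨C, R, hfar⟩ := exists_one_add_norm_mul_exp_le hm hm0 hmi hV hrep hk
  set g : R3 → ℝ := fun x => ∫ y, ‖x - y‖⁻¹ * m y with hg
  have hwi : Integrable fun x : R3 => (1 + ‖x‖) ^ (-(7 / 2) : ℝ) :=
    integrable_one_add_norm (by simp; norm_num)
  have hw1 : ∀ x : R3, ‖(1 + ‖x‖) ^ (-(7 / 2) : ℝ)‖ ≤ 1 := fun x => by
    rw [Real.norm_of_nonneg (by positivity)]
    exact Real.rpow_le_one_of_one_le_of_nonpos (by linarith [norm_nonneg x]) (by norm_num)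
  have hgw : Integrable fun x : R3 => g x * (1 + ‖x‖) ^ (-(7 / 2) : ℝ) := by
    have := (SingKernel.inv_norm.integrable_prod hwi hw1 hmi).integral_prod_left
    simp only [smul_eq_mul] at this
    simpa only [smul_eq_mul, integral_mul_const] using this
  have hcont : Continuous fun x => (1 + ‖x‖) * Real.exp (k * u x) := by fun_prop
  have hloc : IntegrableOn (fun x => (1 + ‖x‖) * Real.exp (k * u x))
      (Metric.closedBall 0 R) :=
    hcont.continuousOn.integrableOn_compact (isCompact_closedBall _ _)
  have hout : IntegrableOn (fun x => (1 + ‖x‖) * Real.exp (k * u x))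
      (Metric.closedBall 0 R)ᶜ := by
    refine Integrable.mono' (((hwi.add hgw).const_mul C).integrableOn) hcont.aestronglyMeasurable ?_
    refine (ae_restrict_iff' Metric.isClosed_closedBall.measurableSet.compl).2
      (ae_of_all _ fun x hx => ?_)
    rw [mem_compl_iff, Metric.mem_closedBall, dist_zero_right, not_le] at hx
    rw [Real.norm_of_nonneg (by positivity)]
    exact hfar x hx.le
  have := hloc.union hout
  rwa [union_compl_self, integrableOn_univ] at this

end Decay

theorem SingKernel.integrableOn_closedBall {k : R3 → ℝ} (hk : SingKernel k) (r : ℝ) :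
    IntegrableOn k (Metric.closedBall 0 r) := by
  obtain ⟨k₁, k₂, rfl, h1, -, h2, -⟩ := hk
  exact h1.integrableOn.add (h2.continuousOn.integrableOn_compact (isCompact_closedBall 0 r))

theorem integrable_min_log_sq : Integrable fun z : R3 => (min (Real.log ‖z‖) 0) ^ 2 := by
  refine ((SingKernel.min_log_sq.integrableOn_closedBall 1).integrable_indicator
    Metric.isClosed_closedBall.measurableSet).congr (ae_of_all _ fun z => ?_)
  by_cases hz : ‖z‖ ≤ 1
  · simp [indicator, hz]
  · simp [indicator, hz, min_eq_right (Real.log_nonneg (not_le.1 hz).le)]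

/-! ### Asymptotics at infinity -/

section Asymptotics

variable {m : R3 → ℝ}

/-- Only `y` within distance one of `x` contributes. Young's inequality separates the square of the
kernel, with a small factor, from the tail of `m²`; square integrability of `m` replaces a pointwise
bound. -/
theorem tendsto_integral_min_log_mul (hm2 : Integrable fun y => m y ^ 2) :
    Tendsto (fun x : R3 => ∫ y, min (Real.log ‖x - y‖) 0 * m y) (comap norm atTop) (𝓝 0) := by
  set K := ∫ z : R3, (min (Real.log ‖z‖) 0) ^ 2 with hK
  have hK0 : 0 ≤ K := integral_nonneg fun z => sq_nonneg _
  have hbound : ∀ ε : ℝ, 0 < ε → ∀ x : R3, |∫ y, min (Real.log ‖x - y‖) 0 * m y| ≤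
      ε * K + (4 * ε)⁻¹ * ∫ y in (Metric.closedBall (0 : R3) (‖x‖ - 2))ᶜ, m y ^ 2 := by
    intro ε hε x
    have hS : MeasurableSet (Metric.closedBall (0 : R3) (‖x‖ - 2))ᶜ :=
      Metric.isClosed_closedBall.measurableSet.compl
    have hi1 : Integrable fun y => ε * (min (Real.log ‖x - y‖) 0) ^ 2 :=
      (integrable_min_log_sq.comp_sub_left x).const_mul ε
    have hi2 : Integrable fun y => (4 * ε)⁻¹ *
        (Metric.closedBall (0 : R3) (‖x‖ - 2))ᶜ.indicator (fun y => m y ^ 2) y :=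
      (hm2.indicator hS).const_mul _
    have h1 : ε * K + (4 * ε)⁻¹ * ∫ y in (Metric.closedBall (0 : R3) (‖x‖ - 2))ᶜ, m y ^ 2 =
        ∫ y, (ε * (min (Real.log ‖x - y‖) 0) ^ 2 + (4 * ε)⁻¹ *
        (Metric.closedBall (0 : R3) (‖x‖ - 2))ᶜ.indicator (fun y => m y ^ 2) y) := by
      rw [integral_add hi1 hi2, integral_const_mul, integral_const_mul, integral_indicator hS,
        integral_sub_left_eq_self (fun z : R3 => (min (Real.log ‖z‖) 0) ^ 2)]
    rw [h1, ← Real.norm_eq_abs]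
    refine norm_integral_le_of_norm_le (hi1.add hi2) (ae_of_all _ fun y => ?_)
    rw [norm_mul, Real.norm_eq_abs, Real.norm_eq_abs]
    by_cases hy : y ∈ (Metric.closedBall (0 : R3) (‖x‖ - 2))ᶜ
    · rw [indicator_of_mem hy, ← sq_abs (min _ _), ← sq_abs (m y)]
      have h2 : 0 ≤ (4 * ε)⁻¹ * (2 * ε * |min (Real.log ‖x - y‖) 0| - |m y|) ^ 2 := by positivity
      have h3 : (4 * ε)⁻¹ * (2 * ε * |min (Real.log ‖x - y‖) 0| - |m y|) ^ 2 =
          ε * |min (Real.log ‖x - y‖) 0| ^ 2 + (4 * ε)⁻¹ * |m y| ^ 2 -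
          |min (Real.log ‖x - y‖) 0| * |m y| := by field_simp; ring
      linarith
    · rw [indicator_of_notMem hy]
      rw [mem_compl_iff, not_not, Metric.mem_closedBall, dist_zero_right] at hy
      have h2 : 1 ≤ ‖x - y‖ := by linarith [norm_sub_norm_le x y]
      rw [min_eq_right (Real.log_nonneg h2)]
      simp
  rw [Metric.tendsto_nhds]
  intro δ hδ
  set ε := δ / (2 * (K + 1)) with hε
  have hε0 : 0 < ε := by positivity
  have hεK : ε * K < δ / 2 := by
    rw [hε, div_mul_eq_mul_div, div_lt_iff₀ (by positivity)]
    nlinarith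
  have h1 : Tendsto (fun x : R3 => ‖x‖ - 2) (comap norm atTop) atTop :=
    tendsto_atTop_add_const_right _ (-2) tendsto_comap
  have h2 := ((tendsto_setIntegral_closedBall_compl hm2).comp h1).const_mul (4 * ε)⁻¹
  rw [mul_zero] at h2
  filter_upwards [h2.eventually (gt_mem_nhds (half_pos hδ))] with x hx
  rw [dist_zero_right, Real.norm_eq_abs]
  simp only [Function.comp_apply] at hx
  linarith [hbound ε hε0 x]

theorem abs_log_norm_sub_log_max_le {x : R3} (hx : 1 ≤ ‖x‖) (y : R3) :
    |Real.log ‖x‖ - Real.log (max ‖x - y‖ 1)| ≤ Real.log (1 + ‖y‖) := by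
  have hy := norm_nonneg y
  have h0 : (1 : ℝ) ≤ max ‖x - y‖ 1 := le_max_right _ _
  have h1 : max ‖x - y‖ 1 ≤ ‖x‖ * (1 + ‖y‖) := by
    refine max_le ((norm_sub_le x y).trans ?_) ?_ <;> nlinarith
  have h2 : ‖x‖ ≤ max ‖x - y‖ 1 * (1 + ‖y‖) := by
    have := norm_sub_norm_le x y
    have := le_max_left ‖x - y‖ 1
    nlinarith
  have h3 := Real.log_le_log (by positivity) h1
  have h4 := Real.log_le_log (by positivity) h2
  rw [Real.log_mul (by positivity) (by positivity)] at h3 h4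
  exact abs_le.2 ⟨by linarith, by linarith⟩

theorem abs_log_norm_sub_log_le {x y : R3} (hxy : ‖y‖ < ‖x‖) :
    |Real.log ‖x‖ - Real.log ‖x - y‖| ≤ ‖y‖ / (‖x‖ - ‖y‖) := by
  have hy := norm_nonneg y
  have hx : 0 < ‖x‖ := hy.trans_lt hxy
  have h1 := norm_sub_norm_le x y
  have h2 : 0 < ‖x - y‖ := by linarith
  have h3 : 0 < ‖x‖ - ‖y‖ := by linarith
  refine abs_le.2 ⟨?_, ?_⟩
  · have h4 := Real.log_le_sub_one_of_pos (div_pos h2 hx)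
    rw [Real.log_div h2.ne' hx.ne', div_sub_one hx.ne'] at h4
    have h5 : (‖x - y‖ - ‖x‖) / ‖x‖ ≤ ‖y‖ / (‖x‖ - ‖y‖) :=
      div_le_div₀ hy (by linarith [norm_sub_le x y]) h3 (by linarith)
    linarith
  · have h4 := Real.log_le_sub_one_of_pos (div_pos hx h2)
    rw [Real.log_div hx.ne' h2.ne', div_sub_one h2.ne'] at h4
    have h5 : (‖x‖ - ‖x - y‖) / ‖x - y‖ ≤ ‖y‖ / (‖x‖ - ‖y‖) :=
      div_le_div₀ hy (by linarith) h3 h1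
    linarith

/-- For fixed `y` the difference of logarithms tends to zero, and it is dominated by `log(1+|y|)`.
-/
theorem tendsto_integral_log_sub_mul (hmi : Integrable m)
    (hlm : Integrable fun y => Real.log (1 + ‖y‖) * m y) :
    Tendsto (fun x : R3 => ∫ y, (Real.log ‖x‖ - Real.log (max ‖x - y‖ 1)) * m y)
      (comap norm atTop) (𝓝 0) := by
  have h0 : ∫ y : R3, (0 : ℝ) * m y = 0 := by simp
  rw [← h0]
  have hnorm : Tendsto (fun x : R3 => ‖x‖) (comap norm atTop) atTop := tendsto_comap
  refine tendsto_integral_filter_of_dominated_convergence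
    (fun y => ‖Real.log (1 + ‖y‖) * m y‖) ?_ ?_ hlm.norm ?_
  · refine Eventually.of_forall fun x => AEStronglyMeasurable.mul ?_ hmi.1
    exact Measurable.aestronglyMeasurable (by fun_prop)
  · filter_upwards [hnorm.eventually_ge_atTop 1] with x hx
    refine ae_of_all _ fun y => ?_
    rw [norm_mul, norm_mul]
    refine mul_le_mul_of_nonneg_right ?_ (norm_nonneg _)
    exact (abs_log_norm_sub_log_max_le hx y).trans (le_abs_self _)
  · refine ae_of_all _ fun y => Tendsto.mul_const _ ?_
    rw [tendsto_zero_iff_abs_tendsto_zero]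
    have h1 : Tendsto (fun x : R3 => ‖y‖ / (‖x‖ - ‖y‖)) (comap norm atTop) (𝓝 0) :=
      Tendsto.div_atTop tendsto_const_nhds (tendsto_atTop_add_const_right _ (-‖y‖) hnorm)
    refine squeeze_zero' (Eventually.of_forall fun x => abs_nonneg _) ?_ h1
    filter_upwards [hnorm.eventually_ge_atTop (‖y‖ + 1)] with x hx
    have : 1 ≤ ‖x - y‖ := by linarith [norm_sub_norm_le x y]
    simp only [Function.comp_apply, max_eq_left this]
    exact abs_log_norm_sub_log_le (by linarith)

/-- A continuous function `u` with `∫ e^{3u} = 2π²` which is, up to the constant `c`, the logarithmic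
potential of `e^{3u}`, with the corresponding asymptotics at infinity. -/
structure LogSolution (u : R3 → ℝ) (c : ℝ) : Prop where
  continuous : Continuous u
  integrable_exp : Integrable fun x => Real.exp (3 * u x)
  integral_exp : ∫ x, Real.exp (3 * u x) = 2 * Real.pi ^ 2
  integrable_log_mul : ∀ x, Integrable fun y => Real.log ‖x - y‖ * Real.exp (3 * u y)
  eq_integral : ∀ x, u x = c - (Real.pi ^ 2)⁻¹ * ∫ y, Real.log ‖x - y‖ * Real.exp (3 * u y)
  tendsto : Tendsto (fun x => u x + 2 * Real.log ‖x‖) (comap norm atTop) (𝓝 c)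

theorem exists_logSolution {u : R3 → ℝ} {c : ℝ} (hu : Continuous u)
    (hmi : Integrable fun x => Real.exp (3 * u x))
    (hV : ∫ x, Real.exp (3 * u x) = 2 * Real.pi ^ 2)
    (hrep : ∀ x, u x = c + (Real.pi ^ 2)⁻¹ * ∫ y, logKer x y * Real.exp (3 * u y)) :
    ∃ c', LogSolution u c' := by
  have hm : Continuous fun x => Real.exp (3 * u x) := by fun_prop
  have hm0 : ∀ x, 0 < Real.exp (3 * u x) := fun x => Real.exp_pos _
  -- The exponent 3 gives the logarithmic moment of `m`, and the exponent 6 gives `m ∈ L²`.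
  have h3 := integrable_one_add_norm_mul_exp hu hm hm0 hmi hV hrep (k := 3) le_rfl
  have h6 := integrable_one_add_norm_mul_exp hu hm hm0 hmi hV hrep (k := 6) (by norm_num)
  have hlm : Integrable fun y => Real.log (1 + ‖y‖) * Real.exp (3 * u y) := by
    refine h3.mono' ?_ (ae_of_all _ fun y => ?_)
    · exact Continuous.aestronglyMeasurable ((Continuous.log (by fun_prop)
        fun y => by positivity).mul hm)
    · have h1 : 0 ≤ Real.log (1 + ‖y‖) := Real.log_nonneg (by linarith [norm_nonneg y])
      rw [Real.norm_of_nonneg (by positivity)]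
      refine mul_le_mul_of_nonneg_right ?_ (hm0 y).le
      linarith [Real.log_le_sub_one_of_pos (by positivity : 0 < 1 + ‖y‖)]
  have hm2 : Integrable fun y => Real.exp (3 * u y) ^ 2 := by
    refine h6.mono' (by fun_prop) (ae_of_all _ fun y => ?_)
    rw [Real.norm_of_nonneg (by positivity), ← Real.exp_nat_mul]
    have : ((2 : ℕ) : ℝ) * (3 * u y) = 6 * u y := by push_cast; ring
    rw [this]
    exact le_mul_of_one_le_left (Real.exp_pos _).le (by linarith [norm_nonneg y])
  have hlog : ∀ x, Integrable fun y => Real.log ‖x - y‖ * Real.exp (3 * u y) := by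
    intro x
    refine (hlm.sub (integrable_logKer_mul hm hmi x)).congr (ae_of_all _ fun y => ?_)
    simp only [Pi.sub_apply, logKer]; ring
  have heq : ∀ x, u x = (c + (Real.pi ^ 2)⁻¹ * ∫ y, Real.log (1 + ‖y‖) * Real.exp (3 * u y)) -
      (Real.pi ^ 2)⁻¹ * ∫ y, Real.log ‖x - y‖ * Real.exp (3 * u y) := by
    intro x
    rw [hrep x]
    simp only [logKer, sub_mul]
    rw [integral_sub hlm (hlog x)]
    ring
  refine ⟨c + (Real.pi ^ 2)⁻¹ * ∫ y, Real.log (1 + ‖y‖) * Real.exp (3 * u y), hu, hmi, hV, hlog,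
    heq, ?_⟩
  have ht := (((tendsto_integral_log_sub_mul hmi hlm).sub
    (tendsto_integral_min_log_mul hm2)).const_mul (Real.pi ^ 2)⁻¹).const_add
    (c + (Real.pi ^ 2)⁻¹ * ∫ y, Real.log (1 + ‖y‖) * Real.exp (3 * u y))
  rw [sub_zero, mul_zero, add_zero] at ht
  refine ht.congr fun x => ?_
  have hmin : Integrable fun y => min (Real.log ‖x - y‖) 0 * Real.exp (3 * u y) :=
    SingKernel.min_log.integrable_mul_sub hm hmi x
  have e1 : (fun y => (Real.log ‖x‖ - Real.log (max ‖x - y‖ 1)) * Real.exp (3 * u y)) =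
      fun y => Real.log ‖x‖ * Real.exp (3 * u y) - (Real.log ‖x - y‖ * Real.exp (3 * u y) -
        min (Real.log ‖x - y‖) 0 * Real.exp (3 * u y)) := by
    ext y
    linear_combination Real.exp (3 * u y) * log_norm_eq (x - y)
  have hd : Integrable fun y => Real.log ‖x - y‖ * Real.exp (3 * u y) -
        min (Real.log ‖x - y‖) 0 * Real.exp (3 * u y) := (hlog x).sub hmin
  rw [e1, integral_sub (hmi.const_mul _) hd, integral_sub (hlog x) hmin, integral_const_mul, hV]
  conv_rhs => rw [heq x]
  field_simp
  ring

end Asymptotics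

/-! ### Inversion in a sphere and the ball kernel -/

section Inversion

/-- The inversion in the sphere of radius `l` about the origin. -/
noncomputable def sphInv (l : ℝ) (x : R3) : R3 := (l / ‖x‖) ^ 2 • x

variable {l : ℝ}

theorem sphInv_eq_inversion (l : ℝ) (x : R3) : sphInv l x = EuclideanGeometry.inversion 0 l x := by
  simp [sphInv, EuclideanGeometry.inversion]

theorem norm_sphInv (l : ℝ) (x : R3) : ‖sphInv l x‖ = l ^ 2 / ‖x‖ := by
  have := EuclideanGeometry.dist_inversion_center (0 : R3) x l
  rwa [dist_zero_right, dist_zero_right, ← sphInv_eq_inversion] at this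

theorem sphInv_sphInv (hl : l ≠ 0) (x : R3) : sphInv l (sphInv l x) = x := by
  simp only [sphInv_eq_inversion, EuclideanGeometry.inversion_inversion _ hl]

theorem measurable_sphInv (l : ℝ) : Measurable (sphInv l) := by
  unfold sphInv; fun_prop

/-- The open ball of radius `l` about the origin, without its center. -/
def puncturedBall (l : ℝ) : Set R3 := {x | 0 < ‖x‖ ∧ ‖x‖ < l}

theorem measurableSet_puncturedBall (l : ℝ) : MeasurableSet (puncturedBall l) :=
  (measurableSet_lt measurable_const measurable_norm).inter
    (measurableSet_lt measurable_norm measurable_const)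

theorem puncturedBall_subset (l : ℝ) : puncturedBall l ⊆ Metric.closedBall 0 l := fun x hx => by
  simpa using hx.2.le

theorem sphInv_image_puncturedBall (hl : 0 < l) :
    sphInv l '' puncturedBall l = (Metric.closedBall 0 l)ᶜ := by
  ext y
  rw [mem_compl_iff, mem_closedBall_zero_iff, not_le]
  constructor
  · rintro ⟨x, ⟨h0, h1⟩, rfl⟩
    rw [norm_sphInv, lt_div_iff₀ h0]
    nlinarith
  · intro hy
    refine ⟨sphInv l y, ⟨?_, ?_⟩, sphInv_sphInv hl.ne' y⟩
    · rw [norm_sphInv]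
      have := hl.trans hy
      positivity
    · rw [norm_sphInv, div_lt_iff₀ (hl.trans hy)]
      nlinarith

theorem hasFDerivAt_sphInv {x : R3} (hx : x ≠ 0) :
    HasFDerivAt (sphInv l) ((l / ‖x‖) ^ 2 • ((ℝ ∙ x)ᗮ.reflection : R3 →L[ℝ] R3)) x := by
  have h := EuclideanGeometry.hasFDerivAt_inversion (R := l) hx
  rw [sub_zero, dist_zero_right] at h
  rwa [funext (sphInv_eq_inversion l)]

/-- The derivative is a dilation composed with a reflection, and an involution has determinant `±1`.
-/
theorem abs_det_fderiv_sphInv (l : ℝ) (x : R3) :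
    |((l / ‖x‖) ^ 2 • ((ℝ ∙ x)ᗮ.reflection : R3 →L[ℝ] R3)).det| = (l / ‖x‖) ^ 6 := by
  have h1 : |LinearMap.det ((ℝ ∙ x)ᗮ.reflection : R3 →L[ℝ] R3).toLinearMap| = 1 := by
    have h : (((ℝ ∙ x)ᗮ.reflection : R3 →L[ℝ] R3).toLinearMap * 
        ((ℝ ∙ x)ᗮ.reflection : R3 →L[ℝ] R3).toLinearMap) = 1 := by
      ext1 z
      simp
    have h2 := congrArg LinearMap.det h
    rw [map_mul, map_one] at h2
    rcases mul_self_eq_one_iff.1 h2 with h3 | h3 <;> rw [h3] <;> simp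
  rw [ContinuousLinearMap.det, ContinuousLinearMap.toLinearMap_smul, LinearMap.det_smul, abs_mul,
    h1, mul_one, finrank_euclideanSpace_fin, ← pow_mul, abs_of_nonneg]
  exact Even.pow_nonneg (by decide) _

theorem integral_compl_closedBall (hl : 0 < l) (f : R3 → ℝ) :
    ∫ y in (Metric.closedBall (0 : R3) l)ᶜ, f y =
      ∫ y in puncturedBall l, (l / ‖y‖) ^ 6 * f (sphInv l y) := by
  rw [← sphInv_image_puncturedBall hl,
    integral_image_eq_integral_abs_det_fderiv_smul volume (measurableSet_puncturedBall l)
      (fun x hx => (hasFDerivAt_sphInv (norm_pos_iff.1 hx.1)).hasFDerivWithinAt)]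
  · simp only [abs_det_fderiv_sphInv, smul_eq_mul]
  · exact (Function.LeftInverse.injective (sphInv_sphInv hl.ne')).injOn

theorem integrableOn_compl_closedBall_iff (hl : 0 < l) (f : R3 → ℝ) :
    IntegrableOn f (Metric.closedBall (0 : R3) l)ᶜ ↔
      IntegrableOn (fun y => (l / ‖y‖) ^ 6 * f (sphInv l y)) (puncturedBall l) := by
  rw [← sphInv_image_puncturedBall hl,
    integrableOn_image_iff_integrableOn_abs_det_fderiv_smul volume (measurableSet_puncturedBall l)
      (fun x hx => (hasFDerivAt_sphInv (norm_pos_iff.1 hx.1)).hasFDerivWithinAt)]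
  · simp only [abs_det_fderiv_sphInv, smul_eq_mul]
  · exact (Function.LeftInverse.injective (sphInv_sphInv hl.ne')).injOn

/-- The Green type kernel of the ball of radius `l`. -/
noncomputable def ballKer (l : ℝ) (x y : R3) : ℝ :=
  Real.log ‖sphInv l x - y‖ - Real.log ‖x - y‖ - Real.log (l / ‖x‖)

/-- The last term is positive for two points inside the ball. This gives the positivity of
`ballKer`, and the symmetric form of the right-hand side gives `norm_mul_norm_sphInv_sub_comm`. -/
theorem norm_mul_norm_sphInv_sub_sq {x : R3} (hx : x ≠ 0) (y : R3) :
    (‖x‖ * ‖sphInv l x - y‖) ^ 2 =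
      (l * ‖x - y‖) ^ 2 + (l ^ 2 - ‖x‖ ^ 2) * (l ^ 2 - ‖y‖ ^ 2) := by
  have h0 : ‖x‖ ≠ 0 := norm_ne_zero_iff.2 hx
  rw [mul_pow, mul_pow, norm_sub_sq_real, norm_sub_sq_real, norm_sphInv, sphInv, inner_smul_left]
  simp
  field_simp
  ring

theorem norm_mul_norm_sphInv_sub_comm {x y : R3} (hx : x ≠ 0) (hy : y ≠ 0) :
    ‖x‖ * ‖sphInv l x - y‖ = ‖y‖ * ‖x - sphInv l y‖ := by
  rw [← sq_eq_sq₀ (by positivity) (by positivity), norm_mul_norm_sphInv_sub_sq hx, norm_sub_rev x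
    (sphInv l y), norm_mul_norm_sphInv_sub_sq hy, norm_sub_rev]
  ring

theorem ballKer_eq_log (hl : 0 < l) {x y : R3} (hx : x ∈ puncturedBall l) (hy : y ∈ puncturedBall l)
    (hxy : y ≠ x) : ballKer l x y = Real.log (‖x‖ * ‖sphInv l x - y‖ / (l * ‖x - y‖)) ∧
      l * ‖x - y‖ < ‖x‖ * ‖sphInv l x - y‖ ∧ ‖x‖ * ‖sphInv l x - y‖ ≤ 2 * l ^ 2 := by
  have hx0 : x ≠ 0 := norm_pos_iff.1 hx.1
  have hd : 0 < ‖x - y‖ := norm_pos_iff.2 (sub_ne_zero.2 hxy.symm)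
  have h1 : l * ‖x - y‖ < ‖x‖ * ‖sphInv l x - y‖ := by
    refine lt_of_pow_lt_pow_left₀ 2 (by positivity) ?_
    rw [norm_mul_norm_sphInv_sub_sq hx0]
    have h2 : 0 < l ^ 2 - ‖x‖ ^ 2 := by nlinarith [hx.1, hx.2]
    have h3 : 0 < l ^ 2 - ‖y‖ ^ 2 := by nlinarith [hy.1, hy.2]
    nlinarith [mul_pos h2 h3]
  have h4 : 0 < ‖x‖ * ‖sphInv l x - y‖ := lt_trans (by positivity) h1
  have h5 : 0 < ‖sphInv l x - y‖ := pos_of_mul_pos_right h4 (norm_nonneg x)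
  refine ⟨?_, h1, ?_⟩
  · rw [ballKer, Real.log_div h4.ne' (by positivity), Real.log_mul hx.1.ne' h5.ne',
      Real.log_mul hl.ne' hd.ne', Real.log_div hl.ne' hx.1.ne']
    ring
  · have h6 := norm_sub_le (sphInv l x) y
    rw [norm_sphInv] at h6
    have h7 := mul_le_mul_of_nonneg_left h6 hx.1.le
    rw [mul_add, mul_div_cancel₀ _ hx.1.ne'] at h7
    nlinarith [hx.1, hx.2, hy.1, hy.2]

theorem ballKer_pos (hl : 0 < l) {x y : R3} (hx : x ∈ puncturedBall l) (hy : y ∈ puncturedBall l)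
    (hxy : y ≠ x) : 0 < ballKer l x y := by
  obtain ⟨h1, h2, -⟩ := ballKer_eq_log hl hx hy hxy
  have hd : 0 < ‖x - y‖ := norm_pos_iff.2 (sub_ne_zero.2 hxy.symm)
  rw [h1]
  exact Real.log_pos ((one_lt_div (by positivity)).2 h2)

theorem ballKer_le (hl : 0 < l) {x y : R3} (hx : x ∈ puncturedBall l) (hy : y ∈ puncturedBall l)
    (hxy : y ≠ x) : ballKer l x y ≤ 2 * l * ‖x - y‖⁻¹ := by
  obtain ⟨h1, h2, h3⟩ := ballKer_eq_log hl hx hy hxy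
  have hd : 0 < ‖x - y‖ := norm_pos_iff.2 (sub_ne_zero.2 hxy.symm)
  have h4 : 0 < ‖x‖ * ‖sphInv l x - y‖ := lt_trans (by positivity) h2
  rw [h1]
  refine (Real.log_le_sub_one_of_pos (by positivity)).trans ?_
  have : ‖x‖ * ‖sphInv l x - y‖ / (l * ‖x - y‖) ≤ 2 * l * ‖x - y‖⁻¹ := by
    rw [div_le_iff₀ (by positivity)]
    refine h3.trans (le_of_eq ?_)
    field_simp
  linarith

/-- Oddness under inversion allows the exterior of the ball to be folded onto the interior. -/
theorem ballKer_sphInv (hl : 0 < l) {x y : R3} (hx : x ∈ puncturedBall l)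
    (hy : y ∈ puncturedBall l) (hxy : y ≠ x) : ballKer l x (sphInv l y) = -ballKer l x y := by
  have hx0 : x ≠ 0 := norm_pos_iff.1 hx.1
  have hy0 : y ≠ 0 := norm_pos_iff.1 hy.1
  have hd : 0 < ‖x - y‖ := norm_pos_iff.2 (sub_ne_zero.2 hxy.symm)
  obtain ⟨-, h2, -⟩ := ballKer_eq_log hl hx hy hxy
  have h4 : 0 < ‖x‖ * ‖sphInv l x - y‖ := lt_trans (by positivity) h2
  have h5 : 0 < ‖sphInv l x - y‖ := pos_of_mul_pos_right h4 (norm_nonneg x)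
  have e1 : ‖sphInv l x - sphInv l y‖ = l ^ 2 / (‖x‖ * ‖y‖) * ‖x - y‖ := by
    have := EuclideanGeometry.dist_inversion_inversion hx0 hy0 l
    rwa [dist_zero_right, dist_zero_right, ← sphInv_eq_inversion, ← sphInv_eq_inversion,
      dist_eq_norm, dist_eq_norm] at this
  have e2 : ‖x - sphInv l y‖ = ‖x‖ * ‖sphInv l x - y‖ / ‖y‖ := by
    rw [norm_mul_norm_sphInv_sub_comm hx0 hy0, mul_div_cancel_left₀ _ hy.1.ne']
  have n1 := hx.1.ne'
  have n2 := hy.1.ne'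
  rw [ballKer, ballKer, e1, e2, Real.log_mul (by positivity) hd.ne', Real.log_div (by positivity)
    (by positivity), Real.log_div (by positivity) n2, Real.log_mul n1 n2, Real.log_mul n1 h5.ne',
    Real.log_pow, Real.log_div hl.ne' n1]
  push_cast
  ring

end Inversion

/-! ### Moving spheres -/

theorem closedBall_ae_eq_puncturedBall (l : ℝ) :
    Metric.closedBall (0 : R3) l =ᵐ[volume] puncturedBall l := by
  have h := measure_eq_zero_iff_ae_notMem.1 (Measure.addHaar_sphere volume (0 : R3) l)
  filter_upwards [ae_ne 0, h] with x hx hs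
  rw [mem_sphere_zero_iff_norm] at hs
  refine propext ⟨fun h => ⟨norm_pos_iff.2 hx, ?_⟩, fun h => puncturedBall_subset l h⟩
  exact lt_of_le_of_ne (mem_closedBall_zero_iff.1 h) hs

/-- From `s ≤ ε s² + 1/(4ε)` with `s = |x-y|⁻¹`, and local integrability of `|z|⁻²`. The bound is
small, uniformly in `x`, once `ε` and then the measure of `A` are small. -/
theorem setIntegral_inv_norm_sub_le {A : Set R3} (hA : MeasurableSet A) {r : ℝ}
    (hAr : A ⊆ Metric.closedBall 0 r) {x : R3} (hx : ‖x‖ ≤ r) {ε : ℝ} (hε : 0 < ε) :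
    IntegrableOn (fun y => ‖x - y‖⁻¹) A ∧ ∫ y in A, ‖x - y‖⁻¹ ≤
      ε * (∫ z in Metric.closedBall (0 : R3) (2 * r), (‖z‖ ^ 2)⁻¹) + (4 * ε)⁻¹ * volume.real A := by
  have hB : MeasurableSet (Metric.closedBall (0 : R3) (2 * r)) :=
    Metric.isClosed_closedBall.measurableSet
  set J : R3 → ℝ := (Metric.closedBall (0 : R3) (2 * r)).indicator fun z => (‖z‖ ^ 2)⁻¹ with hJ
  have hJi : Integrable J :=
    (SingKernel.inv_norm_sq.integrableOn_closedBall (2 * r)).integrable_indicator hB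
  have hJx : Integrable fun y => J (x - y) := hJi.comp_sub_left x
  have hJ0 : ∀ z, 0 ≤ J z := fun z => indicator_nonneg (fun _ _ => by positivity) z
  have hfin : volume A ≠ ⊤ :=
    ((measure_mono hAr).trans_lt (isCompact_closedBall 0 r).measure_lt_top).ne
  have hc : IntegrableOn (fun _ : R3 => (4 * ε)⁻¹) A := integrableOn_const hfin
  have hle : ∀ y ∈ A, ‖x - y‖⁻¹ ≤ ε * J (x - y) + (4 * ε)⁻¹ := by
    intro y hy
    have h1 : x - y ∈ Metric.closedBall (0 : R3) (2 * r) := by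
      rw [mem_closedBall_zero_iff]
      have := mem_closedBall_zero_iff.1 (hAr hy)
      linarith [norm_sub_le x y]
    rw [hJ, indicator_of_mem h1, ← inv_pow]
    have h2 : 0 ≤ (4 * ε)⁻¹ * (2 * ε * ‖x - y‖⁻¹ - 1) ^ 2 := by positivity
    have h3 : (4 * ε)⁻¹ * (2 * ε * ‖x - y‖⁻¹ - 1) ^ 2 =
        ε * ‖x - y‖⁻¹ ^ 2 + (4 * ε)⁻¹ - ‖x - y‖⁻¹ := by
      generalize ‖x - y‖⁻¹ = t
      field_simp; ring
    linarith
  have hdom : IntegrableOn (fun y => ε * J (x - y) + (4 * ε)⁻¹) A :=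
    (hJx.const_mul ε).integrableOn.add hc
  have hi : IntegrableOn (fun y => ‖x - y‖⁻¹) A := by
    refine Integrable.mono' hdom (Measurable.aestronglyMeasurable (by fun_prop)) ?_
    refine (ae_restrict_iff' hA).2 (ae_of_all _ fun y hy => ?_)
    rw [Real.norm_of_nonneg (by positivity)]
    exact hle y hy
  refine ⟨hi, (setIntegral_mono_on hi hdom hA hle).trans ?_⟩
  rw [integral_add (hJx.const_mul ε).integrableOn hc, integral_const_mul, setIntegral_const,
    smul_eq_mul, mul_comm (volume.real A)]
  have h1 : ∫ y in A, J (x - y) ≤ ∫ z in Metric.closedBall (0 : R3) (2 * r), (‖z‖ ^ 2)⁻¹ := by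
    rw [← integral_indicator hB, ← hJ, ← integral_sub_left_eq_self J volume x]
    exact setIntegral_le_integral hJx (ae_of_all _ fun y => hJ0 _)
  have := mul_le_mul_of_nonneg_left h1 hε.le
  linarith

/-- The difference of the Kelvin transform of `u` in the sphere of radius `l` and of `u`. -/
noncomputable def kelvinDiff (u : R3 → ℝ) (l : ℝ) (x : R3) : ℝ :=
  u (sphInv l x) + 2 * Real.log (l / ‖x‖) - u x

section MovingSpheres

variable {u : R3 → ℝ} {c l : ℝ}

theorem measurable_kelvinDiff (hu : Continuous u) (l : ℝ) : Measurable (kelvinDiff u l) := by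
  have h1 := hu.measurable
  have h2 := measurable_sphInv l
  unfold kelvinDiff
  fun_prop

theorem continuousAt_kelvinDiff (hu : Continuous u) (hl : 0 < l) {x : R3} (hx : x ≠ 0) :
    ContinuousAt (fun l => kelvinDiff u l x) l := by
  unfold kelvinDiff sphInv
  have hx0 : 0 < ‖x‖ := norm_pos_iff.2 hx
  refine ((hu.continuousAt.comp (by fun_prop)).add (ContinuousAt.mul continuousAt_const
    (ContinuousAt.log (by fun_prop) (by positivity)))).sub continuousAt_const

theorem continuousAt_kelvinDiff_apply (hu : Continuous u) (hl : 0 < l) {x : R3} (hx : x ≠ 0) :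
    ContinuousAt (kelvinDiff u l) x := by
  unfold kelvinDiff sphInv
  have hx0 : 0 < ‖x‖ := norm_pos_iff.2 hx
  have h1 : ContinuousAt (fun x : R3 => l / ‖x‖) x :=
    continuousAt_const.div continuous_norm.continuousAt hx0.ne'
  refine ((hu.continuousAt.comp ((h1.pow 2).smul continuousAt_id)).add
    (ContinuousAt.mul continuousAt_const (ContinuousAt.log h1 (by positivity)))).sub
    hu.continuousAt

theorem pow_mul_exp_sphInv (hl : 0 < l) {y : R3} (hy : 0 < ‖y‖) :
    (l / ‖y‖) ^ 6 * Real.exp (3 * u (sphInv l y)) = Real.exp (3 * (u y + kelvinDiff u l y)) := by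
  have h : Real.exp (6 * Real.log (l / ‖y‖)) = (l / ‖y‖) ^ 6 := by
    rw [mul_comm, Real.exp_mul, Real.exp_log (by positivity)]
    norm_cast
  rw [← h, ← Real.exp_add, kelvinDiff]
  congr 1; ring

/-- Subtracting the integral equations at `x` and at its inverse point gives an integral of
`ballKer` against `e^{3u}` over the whole space; the mass `2π²` supplies exactly the factor 2 in
front of `log(l/|x|)`. Folding the exterior inside then produces the Kelvin transform of the
density. -/
theorem LogSolution.kelvinDiff_eq (hs : LogSolution u c) (hl : 0 < l) {x : R3}
    (hx : x ∈ puncturedBall l) :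
    IntegrableOn (fun y => ballKer l x y * (Real.exp (3 * u y) -
      Real.exp (3 * (u y + kelvinDiff u l y)))) (puncturedBall l) ∧
    -kelvinDiff u l x = (Real.pi ^ 2)⁻¹ * ∫ y in puncturedBall l, ballKer l x y *
      (Real.exp (3 * u y) - Real.exp (3 * (u y + kelvinDiff u l y))) := by
  have hi1 := hs.integrable_log_mul x
  have hi2 := hs.integrable_log_mul (sphInv l x)
  have hi3 := hs.integrable_exp.const_mul (Real.log (l / ‖x‖))
  have e : (fun y => ballKer l x y * Real.exp (3 * u y)) = fun y =>
      (Real.log ‖sphInv l x - y‖ * Real.exp (3 * u y) - Real.log ‖x - y‖ * Real.exp (3 * u y)) -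
        Real.log (l / ‖x‖) * Real.exp (3 * u y) := by
    ext y; rw [ballKer]; ring
  have hi12 : Integrable fun y => Real.log ‖sphInv l x - y‖ * Real.exp (3 * u y) -
      Real.log ‖x - y‖ * Real.exp (3 * u y) := hi2.sub hi1
  have hi : Integrable fun y => ballKer l x y * Real.exp (3 * u y) := by
    rw [e]; exact hi12.sub hi3
  have hB : MeasurableSet (Metric.closedBall (0 : R3) l) :=
    Metric.isClosed_closedBall.measurableSet
  have hP := measurableSet_puncturedBall l
  have hinv : ∀ᵐ y ∂volume.restrict (puncturedBall l),
      (l / ‖y‖) ^ 6 * (ballKer l x (sphInv l y) * Real.exp (3 * u (sphInv l y))) =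
        -(ballKer l x y * Real.exp (3 * (u y + kelvinDiff u l y))) := by
    filter_upwards [ae_restrict_mem hP, ae_restrict_of_ae (ae_ne x)] with y hy hyx
    rw [ballKer_sphInv hl hx hy hyx, ← pow_mul_exp_sphInv hl hy.1]
    ring
  have hiP : IntegrableOn (fun y => ballKer l x y * Real.exp (3 * u y)) (puncturedBall l) :=
    hi.integrableOn
  have hiC : IntegrableOn (fun y => ballKer l x y * Real.exp (3 * (u y + kelvinDiff u l y)))
      (puncturedBall l) := by
    have h1 := (integrableOn_compl_closedBall_iff hl _).1
      (hi.integrableOn (s := (Metric.closedBall (0 : R3) l)ᶜ))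
    refine (h1.congr hinv).neg.congr (ae_of_all _ fun y => ?_)
    simp
  simp only [mul_sub]
  refine ⟨hiP.sub hiC, ?_⟩
  have h1 : ∫ y, ballKer l x y * Real.exp (3 * u y) = -(Real.pi ^ 2 * kelvinDiff u l x) := by
    rw [e, integral_sub hi12 hi3, integral_sub hi2 hi1, integral_const_mul, hs.integral_exp,
      kelvinDiff, hs.eq_integral (sphInv l x), hs.eq_integral x]
    field_simp
    ring
  rw [← integral_add_compl hB hi, setIntegral_congr_set (closedBall_ae_eq_puncturedBall l),
    integral_compl_closedBall hl, integral_congr_ae hinv, integral_neg, ← sub_eq_add_neg,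
    ← integral_sub hiP hiC] at h1
  rw [h1]
  field_simp

/-- The only danger is at the origin, whose inverse point is at infinity. There the asymptotics
bound `u + 2 log|·|` from below; elsewhere compactness suffices. -/
theorem LogSolution.kelvinDiff_bddBelow (hs : LogSolution u c) (hl : 0 < l) :
    ∃ M, 0 ≤ M ∧ ∀ x ∈ puncturedBall l, -kelvinDiff u l x ≤ M := by
  have hu := hs.continuous
  have h1 := hs.tendsto.eventually (lt_mem_nhds (sub_one_lt c))
  rw [eventually_comap] at h1
  obtain ⟨R, hR⟩ := eventually_atTop.1 h1
  obtain ⟨M₁, hM₁⟩ := (isCompact_closedBall (0 : R3) (max R l)).exists_bound_of_continuousOn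
    hu.continuousOn
  refine ⟨|M₁| + |c - 1| + |M₁ - 2 * Real.log l| + 2 * |Real.log l|, by positivity, fun x hx => ?_⟩
  have hux : u x ≤ |M₁| := by
    refine (le_abs_self _).trans ((hM₁ x ?_).trans (le_abs_self _))
    exact Metric.closedBall_subset_closedBall (le_max_right R l) (puncturedBall_subset l hx)
  have hz : l ≤ ‖sphInv l x‖ := by
    rw [norm_sphInv, le_div_iff₀ hx.1]
    nlinarith [hx.1, hx.2]
  have hlog : 2 * Real.log (l / ‖x‖) = 2 * Real.log ‖sphInv l x‖ - 2 * Real.log l := by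
    rw [norm_sphInv, Real.log_div hl.ne' hx.1.ne', Real.log_div (by positivity) hx.1.ne',
      Real.log_pow]
    push_cast; ring
  have a1 := neg_abs_le (c - 1)
  have a2 := le_abs_self (M₁ - 2 * Real.log l)
  have a3 := le_abs_self (Real.log l)
  have a4 := abs_nonneg (c - 1)
  have a5 := abs_nonneg (M₁ - 2 * Real.log l)
  have a6 := abs_nonneg (Real.log l)
  rw [kelvinDiff, hlog]
  rcases le_total R ‖sphInv l x‖ with h | h
  · have := hR _ h _ rfl
    linarith
  · have h2 := hM₁ (sphInv l x) (by
      rw [mem_closedBall_zero_iff]; exact h.trans (le_max_left _ _))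
    have h3 := neg_abs_le (u (sphInv l x))
    rw [Real.norm_eq_abs] at h2
    have h4 := Real.log_le_log hl hz
    linarith

theorem exp_sub_exp_le (a d : ℝ) :
    Real.exp (3 * a) - Real.exp (3 * (a + d)) ≤ 3 * Real.exp (3 * a) * -d := by
  have h1 := Real.add_one_le_exp (3 * d)
  rw [mul_add, Real.exp_add]
  nlinarith [Real.exp_pos (3 * a)]

/-- A maximum principle for domains of small measure. In the integral equation only the set where
the difference is negative raises `-kelvinDiff`. If that set is small, any upper bound for
`-kelvinDiff` improves by a factor one half, and iteration brings it to zero. The threshold is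
uniform for `l ≤ L`. -/
theorem LogSolution.exists_kelvinDiff_nonneg_of_measure_le (hs : LogSolution u c) {L : ℝ}
    (hL : 0 < L) : ∃ δ, 0 < δ ∧ ∀ l, 0 < l → l ≤ L →
      volume.real {y | y ∈ puncturedBall l ∧ kelvinDiff u l y < 0} ≤ δ →
        ∀ x ∈ puncturedBall l, 0 ≤ kelvinDiff u l x := by
  have hu := hs.continuous
  obtain ⟨C, hC⟩ := (isCompact_closedBall (0 : R3) L).exists_bound_of_continuousOn
    (f := fun y => Real.exp (3 * u y)) (by fun_prop)
  have hC0 : 0 ≤ C := (norm_nonneg _).trans (hC 0 (by simp [hL.le]))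
  set I := ∫ z in Metric.closedBall (0 : R3) (2 * L), (‖z‖ ^ 2)⁻¹ with hI
  have hI0 : 0 ≤ I := integral_nonneg fun z => by positivity
  set B := (Real.pi ^ 2)⁻¹ * (2 * L * (3 * C)) with hB
  have hB0 : 0 ≤ B := by positivity
  set ε := (4 * (B * I + 1))⁻¹ with hε
  have hε0 : 0 < ε := by positivity
  refine ⟨ε / (B + 1), by positivity, fun l hl hlL hvol => ?_⟩
  set A := {y | y ∈ puncturedBall l ∧ kelvinDiff u l y < 0} with hA
  have hAm : MeasurableSet A :=
    (measurableSet_puncturedBall l).inter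
      (measurableSet_lt (measurable_kelvinDiff hu l) measurable_const)
  have hAP : A ⊆ puncturedBall l := fun y hy => hy.1
  have hPL : puncturedBall l ⊆ Metric.closedBall 0 L :=
    (puncturedBall_subset l).trans (Metric.closedBall_subset_closedBall hlL)
  have hsmall : B * (ε * I + (4 * ε)⁻¹ * volume.real A) ≤ 1 / 2 := by
    have h1 : B * (ε * I) ≤ 1 / 4 := by
      have : B * (ε * I) = (B * I) / (4 * (B * I + 1)) := by rw [hε]; field_simp
      rw [this, div_le_iff₀ (by positivity)]
      linarith
    have h2 : B * ((4 * ε)⁻¹ * volume.real A) ≤ 1 / 4 := by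
      calc B * ((4 * ε)⁻¹ * volume.real A) ≤ B * ((4 * ε)⁻¹ * (ε / (B + 1))) := by gcongr
        _ = B / (4 * (B + 1)) := by field_simp
        _ ≤ 1 / 4 := by rw [div_le_iff₀ (by positivity)]; linarith
    linarith
  have hstep : ∀ M, 0 ≤ M → (∀ x ∈ puncturedBall l, -kelvinDiff u l x ≤ M) →
      ∀ x ∈ puncturedBall l, -kelvinDiff u l x ≤ M / 2 := by
    intro M hM0 hM x hx
    obtain ⟨hi, he⟩ := hs.kelvinDiff_eq hl hx
    obtain ⟨hAi, hAle⟩ := setIntegral_inv_norm_sub_le hAm (hAP.trans hPL)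
      (mem_closedBall_zero_iff.1 (hPL hx)) hε0
    have hle : ∫ y in puncturedBall l, ballKer l x y *
        (Real.exp (3 * u y) - Real.exp (3 * (u y + kelvinDiff u l y))) ≤
        ∫ y in puncturedBall l, A.indicator (fun y => (2 * L * (3 * C)) * M * ‖x - y‖⁻¹) y := by
      refine setIntegral_mono_on_ae hi ?_ (measurableSet_puncturedBall l) ?_
      · have h1 : IntegrableOn (fun y => (2 * L * (3 * C)) * M * ‖x - y‖⁻¹) A := hAi.const_mul _
        exact (h1.integrable_indicator hAm).integrableOn
      · filter_upwards [ae_ne x] with y hyx hy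
        have hK := (ballKer_pos hl hx hy hyx).le
        by_cases hyA : y ∈ A
        · rw [indicator_of_mem hyA]
          have hCy := hC y (hPL hy)
          rw [Real.norm_of_nonneg (Real.exp_pos _).le] at hCy
          have h0 : 0 ≤ -kelvinDiff u l y := by linarith [hyA.2]
          calc _ ≤ ballKer l x y * (3 * C * M) := by
                refine mul_le_mul_of_nonneg_left ((exp_sub_exp_le _ _).trans ?_) hK
                have := hM y hy
                gcongr
            _ ≤ 2 * l * ‖x - y‖⁻¹ * (3 * C * M) := by
                have := ballKer_le hl hx hy hyx
                gcongr
            _ ≤ 2 * L * ‖x - y‖⁻¹ * (3 * C * M) := by gcongr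
            _ = _ := by ring
        · rw [indicator_of_notMem hyA]
          refine mul_nonpos_of_nonneg_of_nonpos hK (sub_nonpos.2 (Real.exp_le_exp.2 ?_))
          have : 0 ≤ kelvinDiff u l y := by
            by_contra h
            exact hyA ⟨hy, not_le.1 h⟩
          linarith
    rw [setIntegral_indicator hAm, inter_eq_right.2 hAP, integral_const_mul] at hle
    rw [he]
    calc _ ≤ (Real.pi ^ 2)⁻¹ * ((2 * L * (3 * C)) * M * ∫ y in A, ‖x - y‖⁻¹) := by gcongr
      _ = M * (B * ∫ y in A, ‖x - y‖⁻¹) := by rw [hB]; ring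
      _ ≤ M * (B * (ε * I + (4 * ε)⁻¹ * volume.real A)) := by gcongr
      _ ≤ M * (1 / 2) := by gcongr
      _ = M / 2 := by ring
  obtain ⟨M, hM0, hM⟩ := hs.kelvinDiff_bddBelow hl
  have hiter : ∀ n : ℕ, ∀ x ∈ puncturedBall l, -kelvinDiff u l x ≤ M * (1 / 2) ^ n := by
    intro n
    induction n with
    | zero => simpa using hM
    | succ n ih =>
      intro x hx
      have := hstep _ (by positivity) ih x hx
      rw [pow_succ]; linarith
  intro x hx
  have hlim : Tendsto (fun n : ℕ => M * (1 / 2 : ℝ) ^ n) atTop (𝓝 (M * 0)) :=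
    (tendsto_pow_atTop_nhds_zero_of_lt_one (by norm_num) (by norm_num)).const_mul M
  rw [mul_zero] at hlim
  have := ge_of_tendsto' hlim fun n => hiter n x hx
  linarith

end MovingSpheres

section MovingSpheres

variable {u : R3 → ℝ} {c l : ℝ}

theorem isOpen_puncturedBall (l : ℝ) : IsOpen (puncturedBall l) :=
  (isOpen_lt continuous_const continuous_norm).inter (isOpen_lt continuous_norm continuous_const)

theorem LogSolution.tendsto_kelvinDiff (hs : LogSolution u c) (hl : 0 < l) :
    Tendsto (kelvinDiff u l) (𝓝[≠] 0) (𝓝 (c - 2 * Real.log l - u 0)) := by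
  have h1 : Tendsto (sphInv l) (𝓝[≠] 0) (comap norm atTop) := by
    rw [tendsto_comap_iff]
    have h2 : Tendsto (fun x : R3 => l ^ 2 * ‖x‖⁻¹) (𝓝[≠] 0) atTop :=
      (tendsto_inv_nhdsGT_zero.comp (tendsto_norm_nhdsNE_zero (E := R3))).const_mul_atTop
        (by positivity)
    refine h2.congr fun x => ?_
    rw [Function.comp_apply, norm_sphInv, div_eq_mul_inv]
  have h2 : Tendsto u (𝓝[≠] 0) (𝓝 (u 0)) := hs.continuous.continuousAt.tendsto.mono_left inf_le_left
  refine (((hs.tendsto.comp h1).sub_const (2 * Real.log l)).sub h2).congr' ?_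
  filter_upwards [self_mem_nhdsWithin] with x hx
  have hx0 : ‖x‖ ≠ 0 := norm_ne_zero_iff.2 hx
  rw [Function.comp_apply, kelvinDiff, norm_sphInv, Real.log_div hl.ne' hx0,
    Real.log_div (by positivity) hx0, Real.log_pow]
  push_cast; ring

/-- The limit of the difference at the origin must be nonnegative. This keeps the sphere from
growing forever. -/
theorem LogSolution.log_le (hs : LogSolution u c) (hl : 0 < l)
    (h : ∀ x ∈ puncturedBall l, 0 ≤ kelvinDiff u l x) : 2 * Real.log l ≤ c - u 0 := by
  have h1 := ge_of_tendsto (hs.tendsto_kelvinDiff hl) (b := 0) (by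
    filter_upwards [self_mem_nhdsWithin, nhdsWithin_le_nhds (Metric.ball_mem_nhds (0 : R3) hl)]
      with x hx hx2
    exact h x ⟨norm_pos_iff.2 hx, mem_ball_zero_iff.1 hx2⟩)
  linarith

/-- Pointwise information almost everywhere makes the measure of the bad set tend to zero as `l`
decreases to `l₀`, after which the maximum principle for small measure applies. The case `l₀ = 0`
starts the method; positive `l₀` continues it. -/
theorem LogSolution.eventually_kelvinDiff_nonneg (hs : LogSolution u c) {l₀ : ℝ} (h0 : 0 ≤ l₀)
    (h : ∀ᵐ x : R3, ∀ᶠ l in 𝓝[>] l₀, ¬ (x ∈ puncturedBall l ∧ kelvinDiff u l x < 0)) :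
    ∀ᶠ l in 𝓝[>] l₀, ∀ x ∈ puncturedBall l, 0 ≤ kelvinDiff u l x := by
  have hpos : (0 : ℝ) < l₀ + 1 := by linarith
  obtain ⟨δ, hδ, hmain⟩ := hs.exists_kelvinDiff_nonneg_of_measure_le hpos
  have hle : ∀ᶠ l in 𝓝[>] l₀, l ≤ l₀ + 1 :=
    nhdsWithin_le_nhds (Iic_mem_nhds (lt_add_one l₀))
  have hB : volume (Metric.closedBall (0 : R3) (l₀ + 1)) ≠ ⊤ :=
    (isCompact_closedBall _ _).measure_lt_top.ne
  have ht := tendsto_measure_of_ae_tendsto_indicator (μ := (volume : Measure R3)) (𝓝[>] l₀)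
    (A := ∅) (As := fun l => {y | y ∈ puncturedBall l ∧ kelvinDiff u l y < 0})
    MeasurableSet.empty (fun l => (measurableSet_puncturedBall l).inter
      (measurableSet_lt (measurable_kelvinDiff hs.continuous l) measurable_const))
    (B := Metric.closedBall 0 (l₀ + 1)) Metric.isClosed_closedBall.measurableSet hB
    (hle.mono fun l hl y hy => Metric.closedBall_subset_closedBall hl (puncturedBall_subset l hy.1))
    (h.mono fun x hx => hx.mono fun l hl => by simpa using hl)
  rw [measure_empty] at ht
  have ht2 := (ENNReal.tendsto_toReal ENNReal.zero_ne_top).comp ht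
  rw [ENNReal.toReal_zero] at ht2
  filter_upwards [hle, self_mem_nhdsWithin, ht2.eventually (Iic_mem_nhds hδ)] with l hl hl0 hm
  exact hmain l (h0.trans_lt hl0) hl hm

/-- A strong maximum principle: `ballKer` is strictly positive, and the difference is positive on a
neighbourhood of `x₁`. -/
theorem LogSolution.kelvinDiff_pos (hs : LogSolution u c) (hl : 0 < l)
    (h : ∀ x ∈ puncturedBall l, 0 ≤ kelvinDiff u l x) {x₁ : R3} (hx₁ : x₁ ∈ puncturedBall l)
    (hne : kelvinDiff u l x₁ ≠ 0) {x : R3} (hx : x ∈ puncturedBall l) : 0 < kelvinDiff u l x := by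
  obtain ⟨hi, he⟩ := hs.kelvinDiff_eq hl hx
  have hP := measurableSet_puncturedBall l
  set f : R3 → ℝ := fun y => ballKer l x y * (Real.exp (3 * u y) -
    Real.exp (3 * (u y + kelvinDiff u l y))) with hf
  have hle : ∀ y ∈ puncturedBall l, Real.exp (3 * u y) ≤
      Real.exp (3 * (u y + kelvinDiff u l y)) := fun y hy =>
    Real.exp_le_exp.2 (by linarith [h y hy])
  have hpos : 0 < ∫ y in puncturedBall l, -f y := by
    have hi' : IntegrableOn (fun y => -f y) (puncturedBall l) := hi.neg
    rw [setIntegral_pos_iff_support_of_nonneg_ae _ hi']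
    · have h1 : {y | 0 < kelvinDiff u l y} ∩ puncturedBall l ∈ 𝓝 x₁ := by
        refine inter_mem ?_ ((isOpen_puncturedBall l).mem_nhds hx₁)
        exact (continuousAt_kelvinDiff_apply hs.continuous hl
          (norm_pos_iff.1 hx₁.1)).eventually_const_lt (lt_of_le_of_ne (h x₁ hx₁) hne.symm)
      refine (Measure.measure_pos_of_mem_nhds volume h1).trans_le (measure_mono_ae ?_)
      filter_upwards [ae_ne x] with y hyx hy
      refine ⟨?_, hy.2⟩
      rw [Function.mem_support, hf]
      have h2 := ballKer_pos hl hx hy.2 hyx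
      have h3 : Real.exp (3 * u y) < Real.exp (3 * (u y + kelvinDiff u l y)) :=
        Real.exp_lt_exp.2 (by have : 0 < kelvinDiff u l y := hy.1; linarith)
      have h4 : ballKer l x y * (Real.exp (3 * u y) -
          Real.exp (3 * (u y + kelvinDiff u l y))) < 0 :=
        mul_neg_of_pos_of_neg h2 (sub_neg.2 h3)
      exact (neg_pos.2 h4).ne'
    · refine (ae_restrict_iff' hP).2 ?_
      filter_upwards [ae_ne x] with y hyx hy
      have h2 := (ballKer_pos hl hx hy hyx).le
      exact neg_nonneg.2 (mul_nonpos_of_nonneg_of_nonpos h2 (sub_nonpos.2 (hle y hy)))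
  rw [integral_neg] at hpos
  have h5 : (Real.pi ^ 2)⁻¹ * ∫ y in puncturedBall l, f y < 0 :=
    mul_neg_of_pos_of_neg (by positivity) (by linarith)
  linarith

theorem LogSolution.exists_kelvinDiff_eq_zero (hs : LogSolution u c) :
    ∃ l, 0 < l ∧ ∀ x ∈ puncturedBall l, kelvinDiff u l x = 0 := by
  have hu := hs.continuous
  set S := {l | 0 < l ∧ ∀ x ∈ puncturedBall l, 0 ≤ kelvinDiff u l x} with hS
  have hbdd : BddAbove S := by
    refine ⟨Real.exp ((c - u 0) / 2), fun l hl => ?_⟩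
    rw [← Real.log_le_iff_le_exp hl.1]
    linarith [hs.log_le hl.1 hl.2]
  have hne : S.Nonempty := by
    have h1 := hs.eventually_kelvinDiff_nonneg le_rfl (by
      filter_upwards [ae_ne 0] with x hx
      filter_upwards [nhdsWithin_le_nhds (Iio_mem_nhds (norm_pos_iff.2 hx))] with l hl h
      exact lt_asymm h.1.2 hl)
    obtain ⟨l, hl, hl0⟩ := (h1.and self_mem_nhdsWithin).exists
    exact ⟨l, hl0, hl⟩
  set l₀ := sSup S with hl₀
  have hlub : IsLUB S l₀ := isLUB_csSup hne hbdd
  have hpos : 0 < l₀ := by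
    obtain ⟨l, hl⟩ := hne
    exact hl.1.trans_le (hlub.1 hl)
  have hmem : ∀ x ∈ puncturedBall l₀, 0 ≤ kelvinDiff u l₀ x := by
    intro x hx
    by_contra hneg
    have h1 := (continuousAt_kelvinDiff hu hpos (norm_pos_iff.1 hx.1)).eventually_lt_const
      (not_le.1 hneg)
    have h2 : ∀ᶠ l in 𝓝 l₀, ‖x‖ < l := lt_mem_nhds hx.2
    have h3 := (hlub.frequently_mem hne).filter_mono nhdsWithin_le_nhds
    obtain ⟨l, hl, hl1, hl2⟩ := (h3.and_eventually (h1.and h2)).exists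
    exact absurd (hl.2 x ⟨hx.1, hl2⟩) (not_le.2 hl1)
  refine ⟨l₀, hpos, ?_⟩
  by_contra! hex
  obtain ⟨x₁, hx₁, hne₁⟩ := hex
  have hsph := measure_eq_zero_iff_ae_notMem.1 (Measure.addHaar_sphere volume (0 : R3) l₀)
  -- If the difference is not identically zero at the critical radius, it is strictly positive
  -- inside. Points inside stay good and points outside are not yet reached for `l` near `l₀`, and
  -- the sphere is a null set; so the radius could be increased further.
  have h1 := hs.eventually_kelvinDiff_nonneg hpos.le (by
    filter_upwards [ae_ne 0, hsph] with x hx hxs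
    rw [mem_sphere_zero_iff_norm] at hxs
    rcases lt_or_gt_of_ne hxs with hlt | hgt
    · have h2 := hs.kelvinDiff_pos hpos hmem hx₁ hne₁ ⟨norm_pos_iff.2 hx, hlt⟩
      filter_upwards [nhdsWithin_le_nhds
        ((continuousAt_kelvinDiff hu hpos hx).eventually_const_lt h2)] with l hl h
      exact lt_asymm h.2 hl
    · filter_upwards [nhdsWithin_le_nhds (Iio_mem_nhds hgt)] with l hl h
      exact lt_asymm h.1.2 hl)
  obtain ⟨l, hl, hl0⟩ := (h1.and self_mem_nhdsWithin).exists
  exact absurd (hlub.1 (⟨hpos.trans hl0, hl⟩ : l ∈ S)) (not_le.2 hl0)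

theorem LogSolution.exists_kelvin_eq (hs : LogSolution u c) :
    ∃ l, 0 < l ∧ 2 * Real.log l = c - u 0 ∧
      ∀ y, l < ‖y‖ → u y + 2 * Real.log ‖y‖ = u (sphInv l y) + 2 * Real.log l := by
  obtain ⟨l, hl, h⟩ := hs.exists_kelvinDiff_eq_zero
  refine ⟨l, hl, ?_, fun y hy => ?_⟩
  · have h1 : Tendsto (kelvinDiff u l) (𝓝[≠] 0) (𝓝 0) := by
      refine tendsto_const_nhds.congr' ?_
      filter_upwards [self_mem_nhdsWithin, nhdsWithin_le_nhds (Metric.ball_mem_nhds (0 : R3) hl)]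
        with x hx hx2
      exact (h x ⟨norm_pos_iff.2 hx, mem_ball_zero_iff.1 hx2⟩).symm
    have := tendsto_nhds_unique (hs.tendsto_kelvinDiff hl) h1
    linarith
  · have hy0 : 0 < ‖y‖ := hl.trans hy
    have hn := norm_sphInv l y
    have h1 := h (sphInv l y) ⟨by rw [hn]; positivity, by rw [hn, div_lt_iff₀ hy0]; nlinarith⟩
    rw [kelvinDiff, sphInv_sphInv hl.ne', hn, Real.log_div hl.ne' (by positivity),
      Real.log_div (by positivity) hy0.ne', Real.log_pow] at h1
    push_cast at h1
    linarith

/-- The asymptotic constant `c` is the same for every centre, which is what links the different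
critical radii. -/
theorem LogSolution.comp_add_right (hs : LogSolution u c) (a : R3) :
    LogSolution (fun x => u (x + a)) c where
  continuous := by have := hs.continuous; fun_prop
  integrable_exp := hs.integrable_exp.comp_add_right a
  integral_exp := by
    rw [← hs.integral_exp]
    exact integral_add_right_eq_self (fun x => Real.exp (3 * u x)) a
  integrable_log_mul x := by
    have := (hs.integrable_log_mul (x + a)).comp_add_right a
    simpa using this
  eq_integral x := by
    rw [hs.eq_integral (x + a), ← integral_add_right_eq_self _ a]
    simp
  tendsto := by
    have hnorm : Tendsto (fun x : R3 => ‖x‖) (comap norm atTop) atTop := tendsto_comap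
    have h1 : Tendsto (fun x : R3 => x + a) (comap norm atTop) (comap norm atTop) := by
      rw [tendsto_comap_iff]
      refine tendsto_atTop_mono (fun x => ?_) (tendsto_atTop_add_const_right _ (-‖a‖) hnorm)
      have := norm_sub_norm_le x (-a)
      rw [norm_neg, sub_neg_eq_add] at this
      simpa [sub_eq_add_neg] using this
    have h2 : Tendsto (fun x : R3 => Real.log ‖x‖ - Real.log ‖x + a‖) (comap norm atTop) (𝓝 0) := by
      rw [tendsto_zero_iff_abs_tendsto_zero]
      have h3 : Tendsto (fun x : R3 => ‖a‖ / (‖x‖ - ‖a‖)) (comap norm atTop) (𝓝 0) :=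
        Tendsto.div_atTop tendsto_const_nhds (tendsto_atTop_add_const_right _ (-‖a‖) hnorm)
      refine squeeze_zero' (Eventually.of_forall fun x => abs_nonneg _) ?_ h3
      filter_upwards [hnorm.eventually_gt_atTop ‖a‖] with x hx
      have := abs_log_norm_sub_log_le (x := x) (y := -a) (by rwa [norm_neg])
      simpa using this
    have h4 := (hs.tendsto.comp h1).add (h2.const_mul 2)
    rw [mul_zero, add_zero] at h4
    refine h4.congr fun x => ?_
    simp only [Function.comp_apply]; ring

end MovingSpheres

/-! ### The mass of the spherical profile -/

theorem integral_Ioi_sq_mul_inv_cube :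
    ∫ r in Ioi (0 : ℝ), r ^ 2 * ((1 + r ^ 2) ^ 3)⁻¹ = Real.pi / 16 := by
  set F : ℝ → ℝ := fun r => Real.arctan r / 8 + (r ^ 3 - r) / (8 * (1 + r ^ 2) ^ 2) with hF
  have hd : ∀ r : ℝ, HasDerivAt F (r ^ 2 * ((1 + r ^ 2) ^ 3)⁻¹) r := by
    intro r
    have hp : 0 < 1 + r ^ 2 := by positivity
    have h1 := (Real.hasDerivAt_arctan r).div_const 8
    have h2 : HasDerivAt (fun r : ℝ => r ^ 3 - r) (3 * r ^ 2 - 1) r := by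
      exact ((hasDerivAt_pow 3 r).sub (hasDerivAt_id r)).congr_deriv (by norm_num)
    have h3 : HasDerivAt (fun r : ℝ => 8 * (1 + r ^ 2) ^ 2) (8 * (2 * (1 + r ^ 2) * (2 * r))) r := by
      simpa using (((hasDerivAt_pow 2 r).const_add 1).pow 2).const_mul 8
    refine (h1.add (h2.div h3 (by positivity))).congr_deriv ?_
    field_simp
    ring
  have hlim : Tendsto F atTop (𝓝 (Real.pi / 2 / 8 + 0)) := by
    refine Tendsto.add ?_ ?_
    · exact (Real.tendsto_arctan_atTop.mono_right nhdsWithin_le_nhds).div_const 8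
    · have h1 : Tendsto (fun r : ℝ => r⁻¹) atTop (𝓝 0) := tendsto_inv_atTop_zero
      refine squeeze_zero' ?_ ?_ h1
      · filter_upwards [eventually_ge_atTop 1] with r hr
        refine div_nonneg ?_ (by positivity)
        nlinarith [mul_nonneg (by linarith : (0 : ℝ) ≤ r) (by nlinarith : (0 : ℝ) ≤ r ^ 2 - 1)]
      · filter_upwards [eventually_ge_atTop 1] with r hr
        rw [div_le_iff₀ (by positivity), inv_mul_eq_div, le_div_iff₀ (by linarith)]
        nlinarith [sq_nonneg (r ^ 2)]
  rw [integral_Ioi_of_hasDerivAt_of_nonneg' (fun r _ => hd r) (fun r _ => by positivity) hlim]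
  simp [hF]
  ring

theorem integral_inv_one_add_norm_sq_cube :
    ∫ x : R3, ((1 + ‖x‖ ^ 2) ^ 3)⁻¹ = Real.pi ^ 2 / 4 := by
  rw [integral_fun_norm_addHaar volume (fun r => ((1 + r ^ 2) ^ 3)⁻¹)]
  simp only [finrank_euclideanSpace_fin, smul_eq_mul, Nat.add_one_sub_one]
  rw [integral_Ioi_sq_mul_inv_cube, Measure.real, EuclideanSpace.volume_ball_fin_three]
  rw [ENNReal.toReal_mul, ENNReal.toReal_ofReal (by positivity)]
  simp
  ring

theorem integral_inv_cube_quadratic {A C : ℝ} (hA : 0 < A) (hC : 0 < C) (x₁ : R3) :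
    ∫ x, ((A * ‖x - x₁‖ ^ 2 + C) ^ 3)⁻¹ = Real.pi ^ 2 / 4 * ((C * √(A / C)) ^ 3)⁻¹ := by
  have hk : 0 < √(A / C) := Real.sqrt_pos.2 (by positivity)
  have hk2 : √(A / C) ^ 2 = A / C := Real.sq_sqrt (by positivity)
  have e : ∀ x : R3, ((A * ‖x - x₁‖ ^ 2 + C) ^ 3)⁻¹ =
      (C ^ 3)⁻¹ * ((1 + ‖√(A / C) • (x - x₁)‖ ^ 2) ^ 3)⁻¹ := by
    intro x
    rw [norm_smul, Real.norm_of_nonneg hk.le, mul_pow, hk2, ← mul_inv, ← mul_pow]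
    congr 2
    field_simp
    ring
  simp only [e]
  rw [integral_const_mul, integral_sub_right_eq_self
    (fun x : R3 => ((1 + ‖√(A / C) • x‖ ^ 2) ^ 3)⁻¹) x₁,
    Measure.integral_comp_smul volume (fun x : R3 => ((1 + ‖x‖ ^ 2) ^ 3)⁻¹),
    integral_inv_one_add_norm_sq_cube, finrank_euclideanSpace_fin, smul_eq_mul,
    abs_of_pos (by positivity), mul_pow, mul_inv]
  ring

/-! ### Classification in the case of equality -/

section Classification

variable {u : R3 → ℝ} {c : ℝ}

theorem LogSolution.exp_neg_eq (hs : LogSolution u c) (x₀ : R3) : ∃ l, 0 < l ∧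
    Real.exp (-u x₀) = Real.exp (-c) * l ^ 2 ∧ ∀ y, l < ‖y‖ →
      Real.exp (-u (y + x₀)) = ‖y‖ ^ 2 / l ^ 2 * Real.exp (-u (x₀ + sphInv l y)) := by
  obtain ⟨l, hl, h1, h2⟩ := (hs.comp_add_right x₀).exists_kelvin_eq
  rw [zero_add] at h1
  have hsq : ∀ t : ℝ, 0 < t → t ^ 2 = Real.exp (2 * Real.log t) := fun t ht => by
    rw [mul_comm, Real.exp_mul, Real.exp_log ht]; norm_cast
  refine ⟨l, hl, ?_, fun y hy => ?_⟩
  · rw [hsq l hl, ← Real.exp_add, h1]; congr 1; ring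
  · have := h2 y hy
    rw [hsq l hl, hsq _ (hl.trans hy), ← Real.exp_sub, ← Real.exp_add, add_comm x₀]
    congr 1; linarith

/-- As a point goes to infinity its inverse about `x₀` tends to `x₀`, so the Kelvin symmetry turns
the first order expansion of `U = e^{-u}` at `x₀` into `U(te) = A|te-x₀|² + DU(x₀)(te-x₀) + o(t)`,
with `A = e^{-c}`. The left-hand quotient does not involve `x₀`. -/
theorem LogSolution.tendsto_exp_neg (hs : LogSolution u c) (hu : Differentiable ℝ u) (x₀ : R3)
    {e : R3} (he : e ≠ 0) :
    Tendsto (fun t : ℝ => (Real.exp (-u (t • e)) - Real.exp (-c) * (t ^ 2 * ‖e‖ ^ 2)) / t) atTop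
      (𝓝 (fderiv ℝ (fun x => Real.exp (-u x)) x₀ e - 2 * Real.exp (-c) * inner ℝ x₀ e)) := by
  obtain ⟨l, hl, h1, h2⟩ := hs.exp_neg_eq x₀
  set U : R3 → ℝ := fun x => Real.exp (-u x) with hU
  set A := Real.exp (-c) with hA
  have hUd : DifferentiableAt ℝ U x₀ := (hu x₀).neg.exp
  set L := fderiv ℝ U x₀ with hL
  have hne : ‖e‖ ≠ 0 := norm_ne_zero_iff.2 he
  have hyn : Tendsto (fun t : ℝ => ‖t • e - x₀‖ / t) atTop (𝓝 ‖e‖) := by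
    have h3 : Tendsto (fun t : ℝ => ‖e - t⁻¹ • x₀‖) atTop (𝓝 ‖e - (0 : ℝ) • x₀‖) :=
      (tendsto_const_nhds.sub (tendsto_inv_atTop_zero.smul_const x₀)).norm
    rw [zero_smul, sub_zero] at h3
    refine h3.congr' ?_
    filter_upwards [eventually_gt_atTop 0] with t ht
    have : e - t⁻¹ • x₀ = t⁻¹ • (t • e - x₀) := by
      rw [smul_sub, smul_smul, inv_mul_cancel₀ ht.ne', one_smul]
    rw [this, norm_smul, Real.norm_of_nonneg (by positivity), div_eq_inv_mul]
  have hyt : Tendsto (fun t : ℝ => ‖t • e - x₀‖) atTop atTop := by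
    refine (hyn.pos_mul_atTop (by positivity) tendsto_id).congr' ?_
    filter_upwards [eventually_gt_atTop 0] with t ht
    simp only [id]
    field_simp
  have hz : Tendsto (fun t : ℝ => sphInv l (t • e - x₀)) atTop (𝓝 0) := by
    rw [tendsto_zero_iff_norm_tendsto_zero]
    simp only [norm_sphInv]
    exact tendsto_const_nhds.div_atTop hyt
  have hr : Tendsto (fun t : ℝ => (U (x₀ + sphInv l (t • e - x₀)) - U x₀ -
      L (sphInv l (t • e - x₀))) / ‖sphInv l (t • e - x₀)‖) atTop (𝓝 0) := by
    have h3 := (hasFDerivAt_iff_isLittleO_nhds_zero.1 hUd.hasFDerivAt).comp_tendsto hz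
    exact h3.norm_right.tendsto_div_nhds_zero
  have hmain := ((tendsto_inv_atTop_zero.mul_const (A * ‖x₀‖ ^ 2 - L x₀)).const_add
    (L e - 2 * A * inner ℝ x₀ e)).add (hyn.mul hr)
  rw [zero_mul, add_zero, mul_zero, add_zero] at hmain
  refine hmain.congr' ?_
  filter_upwards [eventually_gt_atTop 0, hyt.eventually_gt_atTop l] with t ht hlt
  have h3 := h2 _ hlt
  rw [sub_add_cancel] at h3
  set y := t • e - x₀ with hy
  have hy0 : 0 < ‖y‖ := hl.trans hlt
  have hLz : L (sphInv l y) = (l / ‖y‖) ^ 2 * L y := by rw [sphInv, map_smul, smul_eq_mul]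
  have hLy : L y = t * L e - L x₀ := by rw [hy, map_sub, map_smul, smul_eq_mul]
  have hny : ‖y‖ ^ 2 = t ^ 2 * ‖e‖ ^ 2 - 2 * t * inner ℝ x₀ e + ‖x₀‖ ^ 2 := by
    rw [hy, norm_sub_sq_real, norm_smul, inner_smul_left, real_inner_comm, mul_pow,
      Real.norm_eq_abs, sq_abs]
    simp
    ring
  have h4 : Real.exp (-u (t • e)) = A * ‖y‖ ^ 2 + L y + ‖y‖ *
      ((U (x₀ + sphInv l y) - U x₀ - L (sphInv l y)) / ‖sphInv l y‖) := by
    have h5 : U x₀ = A * l ^ 2 := h1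
    rw [h3, norm_sphInv, hLz, h5]
    simp only [hU]
    field_simp
    ring
  rw [h4, hLy, hny]
  field_simp
  ring

theorem LogSolution.isSpherical (hs : LogSolution u c) (hu : Differentiable ℝ u) :
    IsSpherical u := by
  set U : R3 → ℝ := fun x => Real.exp (-u x) with hU
  set A := Real.exp (-c) with hA
  have hA0 : 0 < A := Real.exp_pos _
  have hUd : Differentiable ℝ U := hu.neg.exp
  -- By uniqueness of limits the linear coefficient at infinity is the same for the centres `x` and
  -- 0.
  have hgrad : ∀ x e, fderiv ℝ U x e - 2 * A * inner ℝ x e = fderiv ℝ U 0 e := by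
    intro x e
    rcases eq_or_ne e 0 with rfl | he
    · simp
    · have := tendsto_nhds_unique (hs.tendsto_exp_neg hu x he) (hs.tendsto_exp_neg hu 0 he)
      rwa [inner_zero_left, mul_zero, sub_zero] at this
  set w := (InnerProductSpace.toDual ℝ R3).symm (fderiv ℝ U 0) with hw
  have hw' : ∀ x, fderiv ℝ U 0 x = inner ℝ w x := fun x => by
    rw [hw, InnerProductSpace.toDual_symm_apply]
  have hF : ∀ x, U x - A * ‖x‖ ^ 2 - fderiv ℝ U 0 x = U 0 := by
    have hd : ∀ x, HasFDerivAt (fun x => U x - A * ‖x‖ ^ 2 - fderiv ℝ U 0 x) (0 : R3 →L[ℝ] ℝ) x := by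
      intro x
      have h1 := ((hUd x).hasFDerivAt.sub
        ((hasStrictFDerivAt_norm_sq x).hasFDerivAt.const_mul A)).sub (fderiv ℝ U 0).hasFDerivAt
      refine h1.congr_fderiv ?_
      ext e
      have := hgrad x e
      simp
      linarith
    intro x
    have := is_const_of_fderiv_eq_zero (𝕜 := ℝ) (fun x => (hd x).differentiableAt)
      (fun x => (hd x).fderiv) x 0
    simpa using this
  set x₁ : R3 := -((2 * A)⁻¹ • w) with hx₁
  set C := U 0 - A * ‖x₁‖ ^ 2 with hC
  have hUx : ∀ x, U x = A * ‖x - x₁‖ ^ 2 + C := by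
    intro x
    have h1 := hF x
    rw [hw'] at h1
    have h2 : inner ℝ x x₁ = -((2 * A)⁻¹ * inner ℝ w x) := by
      rw [hx₁, inner_neg_right, inner_smul_right, real_inner_comm]
    rw [norm_sub_sq_real, h2, hC]
    have h3 : A * (2 * (2 * A)⁻¹) = 1 := by field_simp
    linear_combination h1 - inner ℝ w x * h3
  have hC0 : 0 < C := by
    have h1 : U x₁ = C := by rw [hUx]; simp
    rw [← h1]; exact Real.exp_pos _
  have hm : ∀ x, Real.exp (3 * u x) = ((A * ‖x - x₁‖ ^ 2 + C) ^ 3)⁻¹ := by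
    intro x
    rw [← hUx, hU, ← Real.exp_nat_mul, ← Real.exp_neg]
    congr 1; push_cast; ring
  have hint := hs.integral_exp
  simp only [hm] at hint
  rw [integral_inv_cube_quadratic hA0 hC0] at hint
  -- The mass condition `∫ e^{3u} = 2π²` fixes the product of the two remaining parameters, leaving
  -- the scale `2A`.
  have hAC : A * C = 1 / 4 := by
    have hk : 0 < √(A / C) := Real.sqrt_pos.2 (by positivity)
    have hk2 : √(A / C) ^ 2 = A / C := Real.sq_sqrt (by positivity)
    have h1 : (C * √(A / C)) ^ 3 = (1 / 2) ^ 3 := by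
      have h2 : 0 < (C * √(A / C)) ^ 3 := by positivity
      generalize (C * √(A / C)) ^ 3 = q at hint h2
      field_simp at hint
      linarith
    have h2 : C * √(A / C) = 1 / 2 :=
      (pow_left_inj₀ (by positivity) (by norm_num) (by norm_num)).1 h1
    have h3 : (C * √(A / C)) ^ 2 = A * C := by rw [mul_pow, hk2]; field_simp
    rw [← h3, h2]; norm_num
  refine ⟨x₁, 2 * A, by positivity, funext fun x => ?_⟩
  have hCe : C = 1 / (4 * A) := by field_simp; linarith
  have h1 : u x = Real.log (U x)⁻¹ := by rw [hU, ← Real.exp_neg, Real.log_exp, neg_neg]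
  rw [h1, hUx, sphericalFun, hCe]
  congr 1
  field_simp
  ring

end Classification

/-! ### Conclusion -/

theorem exp_quadratic_part_le {u v p : R3 → ℝ} {V : ℝ} {N : ℕ} (hN : 3 * V / Real.pi ^ 2 ≤ N)
    (hu : ∀ x, u x = (Real.pi ^ 2)⁻¹ * v x + p x) (hv : ∀ x, -(Real.log (1 + ‖x‖) * V) ≤ v x)
    (x : R3) : Real.exp (3 * p x) ≤ (1 + ‖x‖) ^ N * Real.exp (3 * u x) := by
  have hl : 0 ≤ Real.log (1 + ‖x‖) := Real.log_nonneg (by linarith [norm_nonneg x])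
  have h1 : (1 + ‖x‖) ^ N = Real.exp (N * Real.log (1 + ‖x‖)) := by
    rw [Real.exp_nat_mul, Real.exp_log (by positivity)]
  rw [h1, ← Real.exp_add]
  refine Real.exp_le_exp.2 ?_
  have h2 := mul_le_mul_of_nonneg_right hN hl
  have h3 := mul_le_mul_of_nonneg_left (hv x) (by positivity : 0 ≤ 3 * (Real.pi ^ 2)⁻¹)
  have h4 : 3 * (Real.pi ^ 2)⁻¹ * -(Real.log (1 + ‖x‖) * V) =
      -(3 * V / Real.pi ^ 2 * Real.log (1 + ‖x‖)) := by ring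
  rw [hu x]
  linarith

theorem theorem1p4 (u : R3 → ℝ)
    (hu : IsSmoothSolution u (fun x => 2 * Real.exp (3 * u x)))
    (hV : Integrable (fun x : R3 => Real.exp (3 * u x)) volume)
    (hns : ¬ IsSpherical u) :
    ∫ x : R3, Real.exp (3 * u x) < 2 * Real.pi ^ 2 := by
  have hsm := hu.contDiff
  have hu2 : ContDiff ℝ 2 u := hsm.of_le (WithTop.coe_le_coe.2 le_top)
  have hu1 : ContDiff ℝ 1 u := hsm.of_le (WithTop.coe_le_coe.2 le_top)
  have hc := hsm.continuous
  set m : R3 → ℝ := fun x => Real.exp (3 * u x) with hm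
  have hmc : Continuous m := by fun_prop
  have hm0 : ∀ x, 0 ≤ m x := fun x => (Real.exp_pos _).le
  have hum : ∀ x, u x ≤ m x := fun x => by
    have h1 := Real.add_one_le_exp (3 * u x)
    have h2 := hm0 x
    simp only [hm] at h2 ⊢
    linarith
  obtain ⟨C, hC⟩ := neg_laplacian_eq_riesz hu hmc hV
  obtain ⟨c, b, H, hH, hrep⟩ := exists_eq_logPotential_add_quadratic hu2 hmc hV hm0 hum hC
  obtain ⟨N, hN⟩ := exists_nat_ge (3 * (∫ x, m x) / Real.pi ^ 2)
  obtain ⟨hneg, c', x₀, hp⟩ := exists_center_of_integrable hm0 hV hH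
    (p := fun x => c + inner ℝ b x + 1 / 2 * inner ℝ (H x) x) (fun _ => rfl) (N := N)
    (exp_quadratic_part_le hN hrep (neg_log_mul_le_integral_logKer hmc hV hm0))
  have hrep' : ∀ x, u x = (Real.pi ^ 2)⁻¹ * (∫ y, logKer x y * m y) +
      (c' + 1 / 2 * inner ℝ (H (x - x₀)) (x - x₀)) := fun x => by rw [hrep x, ← hp x]
  obtain ⟨hle, heq⟩ := pohozaev hu1 rfl hV hH hrep' hneg
  -- Equality removes the quadratic part, and the classification makes `u` spherical.
  refine lt_of_le_of_ne hle fun hVe => hns ?_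
  have hlog : ∀ x, u x = c' + (Real.pi ^ 2)⁻¹ * ∫ y, logKer x y * Real.exp (3 * u y) := fun x => by
    rw [hrep' x, heq hVe, mul_zero, add_zero, add_comm]
  obtain ⟨c'', hs⟩ := exists_logSolution hc hV hVe hlog
  exact hs.isSpherical (hu1.differentiable one_ne_zero)
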